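/- **Setting.** Let $d \ge 2$ and let $w=(w_1,\dots,w_d)$ satisfy $w_1 \ge \cdots \ge w_d > 0$ and $w_1+\cdots+w_d=1$. Put $\mathsf p_n = w_1^n+\cdots+w_d^n$. Let $S_\infty$ be the group of finitely supported permutations of $\mathbb N=\{1,2,\dots\}$, let $\gamma_n=(1,n+1)$ for $n\ge 1$, and let $\chi:S_\infty\to\mathbb R$ be the character $\chi(\sigma)=\prod_V \mathsf p_{|V|}$, where $V$ runs over the orbits of $\sigma$ with $|V|\ge 2$. Let $U:S_\infty\to B(\mathcal H)$ be the GNS representation of $\chi$: $\mathcal H$ is a complex Hilbert space with vectors $\hat\sigma$ ($\sigma\in S_\infty$) that span a dense subspace and satisfy $\langle\hat\sigma,\hat\tau\rangle=\chi(\sigma\tau^{-1})$ $(=\chi(\sigma^{-1}\tau))$, and $U(\sigma)\hat\tau=\widehat{\sigma\tau}$. Let $\hat 1$ be the vector of the unit of $S_\infty$. A $*$-probability space $(\mathcal A,\varphi)$ is a unital $*$-algebra $\mathcal A$ over $\mathbb C$ with a linear functional $\varphi$ such that $\varphi(1)=1$ and $\varphi(a^*a)\ge 0$ for all $a$. For a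 selfadjoint $a\in\mathcal A$, "the law of $a$ is $\mu$" means that $\mu$ is a Borel probability measure on $\mathbb R$ with finite moments of all orders, $\int t^k\,d\mu(t)=\varphi(a^k)$ for all $k\ge 0$, and that $\mu$ is the only such probability measure. **Traceless CCR-GUE matrices.** A matrix $M=[a_{i,j}]\in M_d(\mathcal A)$ is a traceless CCR-GUE matrix with parameters $w_1,\dots,w_d$ if there are unital $*$-subalgebras $\mathcal A_o$ and $\mathcal A_{i,j}$ ($1\le i<j\le d$) of $\mathcal A$ that are commuting independent (elements of different subalgebras commute, and $\varphi(x_1\cdots x_k)=\varphi(x_1)\cdots\varphi(x_k)$ for $x_1,\dots,x_k$ from distinct subalgebras), such that: (i) for $i<j$ one has $a_{i,j}\in\mathcal A_{i,j}$, $a_{j,i}=a_{i,j}^*$, $a_{i,j}^*a_{i,j}=a_{i,j}a_{i,j}^*+(w_i-w_j)1$, and $\varphi(a_{i,j}^p(a_{i,j}^*)^q)$ equals $p!\,w_j^p$ if $p=q$ and $0$ if $p\ne q$, for all integers $p,q\ge 0$; (ii) $\mathcal A_o$ is commutative and $a_{1,1},\dots,a_{d,d}\in\mathcal A_o$ are selfadjoint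 and form a centred Gaussian family with covariances $c_{i,j}=w_i\delta_{i,j}-w_iw_j$, i.e. $\varphi(a_{i_1,i_1}\cdots a_{i_k,i_k})=\sum_{\rho}\prod_{\{p,q\}\in\rho}c_{i_p,i_q}$ for all $k$ and $i_1,\dots,i_k$, the sum being over the pair-partitions $\rho$ of $\{1,\dots,k\}$. **Theorem.** (a) The averages $\frac1n\sum_{i=1}^n U(\gamma_i)$ converge in the strong operator topology to an operator $A_0\in B(\mathcal H)$; for every $n\ge1$ the operator $\frac1{\sqrt n}\sum_{i=1}^n(U(\gamma_i)-A_0)$ has a law $\mu_n$ with respect to the vector state $T\mapsto\langle T\hat 1,\hat 1\rangle$; and the measures $\mu_n$ converge weakly to a (unique) probability measure $\mu_w$ on $\mathbb R$, which depends only on $w$. (b) For every $*$-probability space $(\mathcal A,\varphi)$ and every traceless CCR-GUE matrix $M\in M_d(\mathcal A)$ with parameters $w_1,\dots,w_d$, the law of $M$ with respect to the functional $\varphi_w(X)=\sum_{i=1}^d w_i\,\varphi(x_{i,i})$ on $M_d(\mathcal A)$ is $\mu_w$. -/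

import Mathlib

open scoped ComplexOrder

namespace StarCLT

/-! ### The infinite symmetric group and the character of a weight tuple -/

/-- A tuple of weights `w₁ ≥ w₂ ≥ ⋯ ≥ w_d > 0` with `w₁ + ⋯ + w_d = 1`. -/
structure Weights (d : ℕ) where
  wt : Fin d → ℝ
  anti : Antitone wt
  pos : ∀ i, 0 < wt i
  sum_eq_one : ∑ i, wt i = 1

/-- The infinite symmetric group: all permutations of a countable set that fix all but finitely
many points.  The ground set is `{0, 1, 2, …}` (that is, `{1, 2, 3, …}` shifted by one). -/
def SInf : Subgroup (Equiv.Perm ℕ) where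
  carrier := {σ | {x | σ x ≠ x}.Finite}
  one_mem' := by simp
  mul_mem' := by
    intro a b ha hb
    refine (Set.Finite.union ha hb).subset ?_
    intro x hx
    by_contra h
    simp only [Set.mem_union, Set.mem_ofPred_eq, not_or, not_not] at h
    exact hx (by rw [Equiv.Perm.mul_apply, h.2, h.1])
  inv_mem' := by
    intro a ha
    refine Set.Finite.subset ha ?_
    intro x hx h
    exact hx (by rw [Equiv.Perm.inv_eq_iff_eq, h])

/-- The star transposition exchanging the base point `0` with `n` (used for `n ≥ 1`). -/
def starTransposition (n : ℕ) : SInf :=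
  ⟨Equiv.swap 0 n, by
    refine (Set.toFinite {0, n}).subset ?_
    intro x hx
    by_contra h
    simp only [Set.mem_insert_iff, Set.mem_singleton_iff, not_or] at h
    exact hx (Equiv.swap_apply_of_ne_of_ne h.1 h.2)⟩

/-- The orbits of `σ` that have at least two elements. -/
def nontrivialOrbits (σ : Equiv.Perm ℕ) : Set (Set ℕ) :=
  {V | (∃ x, V = {y | σ.SameCycle x y}) ∧ 2 ≤ V.ncard}

/-- The power sum `p_n = w₁ⁿ + ⋯ + w_dⁿ`. -/
noncomputable def powerSum {d : ℕ} (w : Weights d) (n : ℕ) : ℝ := ∑ i, w.wt i ^ n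

/-- The character `χ(σ) = ∏ p_{|V|}`, the product over the orbits `V` of `σ` with `|V| ≥ 2`. -/
noncomputable def character {d : ℕ} (w : Weights d) (σ : SInf) : ℝ :=
  ∏ᶠ V ∈ nontrivialOrbits σ, powerSum w V.ncard

/-! ### Positivity of the character (needed for the GNS construction) -/

theorem character_inv {d : ℕ} (w : Weights d) (σ : SInf) :
    character w σ⁻¹ = character w σ := by
  simp [character, nontrivialOrbits]

open Classical in
theorem sum_coloring {d N : ℕ} (w : Fin d → ℝ) (S : Setoid (Fin N)) :
    ∑ f : Fin N → Fin d, (if ∀ a b, S.r a b → f a = f b then ∏ a, w (f a) else 0)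
      = ∏ q : Quotient S, ∑ i, w i ^ (Finset.univ.filter
          (fun a : Fin N => (Quotient.mk S a) = q)).card := by
  rw [Finset.prod_univ_sum, Fintype.piFinset_univ, ← Finset.sum_filter]
  symm
  refine Finset.sum_bij (fun g _ a => g (Quotient.mk S a)) ?_ ?_ ?_ ?_
  · intro g _
    simp only [Finset.mem_filter, Finset.mem_univ, true_and]
    intro a b hab
    rw [Quotient.sound (s := S) hab]
  · intro g _ g' _ h
    funext q
    induction q using Quotient.inductionOn with
    | h a => exact congrFun h a
  · intro f hf
    simp only [Finset.mem_filter, Finset.mem_univ, true_and] at hf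
    exact ⟨Quotient.lift f hf, Finset.mem_univ _, rfl⟩
  · intro g _
    rw [← Finset.prod_fiberwise Finset.univ (fun a : Fin N => Quotient.mk S a)]
    refine Finset.prod_congr rfl ?_
    intro q _
    rw [Finset.prod_congr rfl (g := fun _ => w (g q)), Finset.prod_const]
    intro a ha
    exact congrArg (fun q => w (g q)) (Finset.mem_filter.mp ha).2

open Classical in
/-- The character counts, with weights, the colorings that are constant on orbits. -/
theorem character_eq_sum {d N : ℕ} (w : Weights d) (σ : SInf)
    (hσ : ∀ x, N ≤ x → (σ : Equiv.Perm ℕ) x = x) :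
    character w σ = ∑ f : Fin N → Fin d,
      (if ∀ a b : Fin N, (σ : Equiv.Perm ℕ).SameCycle a b → f a = f b
        then ∏ a, w.wt (f a) else 0) := by
  set s : Equiv.Perm ℕ := (σ : Equiv.Perm ℕ) with hs
  have hlt : ∀ a b : ℕ, s.SameCycle a b → a < N → b < N := by
    intro a b hab ha
    by_contra hb
    have hfix : s b = b := hσ b (not_lt.mp hb)
    have : a = b := (hab.symm.eq_of_left hfix).symm
    omega
  let S : Setoid (Fin N) :=
    ⟨fun a b => s.SameCycle a b, ⟨fun a => Equiv.Perm.SameCycle.refl _ _, fun h => h.symm,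
      fun h h' => h.trans h'⟩⟩
  have key := sum_coloring w.wt S
  refine Eq.trans ?_ key.symm
  let orb : Quotient S → Set ℕ := Quotient.lift (fun a : Fin N => {y : ℕ | s.SameCycle a y}) (by
    intro a b hab
    ext y
    exact ⟨fun h => Equiv.Perm.SameCycle.trans (Equiv.Perm.SameCycle.symm hab) h,
      fun h => Equiv.Perm.SameCycle.trans hab h⟩)
  have horb_inj : Function.Injective orb := by
    intro q q'
    induction q using Quotient.inductionOn with
    | h a =>
      induction q' using Quotient.inductionOn with
      | h b =>
        intro h
        apply Quotient.sound
        have : (b : ℕ) ∈ {y : ℕ | s.SameCycle a y} := by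
          have h' : {y : ℕ | s.SameCycle a y} = {y : ℕ | s.SameCycle b y} := h
          rw [h']
          exact Equiv.Perm.SameCycle.refl _ _
        exact this
  have hcard : ∀ q, (orb q).ncard
      = (Finset.univ.filter (fun a : Fin N => (Quotient.mk S a) = q)).card := by
    intro q
    induction q using Quotient.inductionOn with
    | h a =>
      have : orb (Quotient.mk S a) = (fun b : Fin N => (b : ℕ)) ''
          (Finset.univ.filter (fun b : Fin N => (Quotient.mk S b) = Quotient.mk S a) :
            Set (Fin N)) := by
        ext y
        constructor
        · intro hy
          refine ⟨⟨y, hlt a y hy a.2⟩, ?_, rfl⟩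
          simp only [Finset.coe_filter, Finset.mem_univ, true_and, Set.mem_ofPred_eq]
          exact Quotient.sound (s := S) (Equiv.Perm.SameCycle.symm hy)
        · rintro ⟨b, hb, rfl⟩
          simp only [Finset.coe_filter, Finset.mem_univ, true_and, Set.mem_ofPred_eq] at hb
          exact Equiv.Perm.SameCycle.symm (Quotient.exact (s := S) hb)
      rw [this, Set.ncard_image_of_injective _ Fin.val_injective, Set.ncard_coe_finset]
  have hset : nontrivialOrbits s = orb '' {q | 2 ≤ (orb q).ncard} := by
    ext V
    constructor
    · rintro ⟨⟨x, rfl⟩, h2⟩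
      have hx : x < N := by
        by_contra hx
        have hfix : s x = x := hσ x (not_lt.mp hx)
        have : {y | s.SameCycle x y} = {x} := by
          ext y
          constructor
          · intro hy
            exact (Equiv.Perm.SameCycle.eq_of_left hy hfix).symm
          · rintro rfl
            exact Equiv.Perm.SameCycle.refl _ _
        rw [this, Set.ncard_singleton] at h2
        omega
      exact ⟨Quotient.mk S ⟨x, hx⟩, h2, rfl⟩
    · rintro ⟨q, hq, rfl⟩
      induction q using Quotient.inductionOn with
      | h a => exact ⟨⟨a, rfl⟩, hq⟩
  unfold character
  rw [← hs, hset, finprod_mem_image horb_inj.injOn]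
  rw [finprod_mem_eq_finite_toFinset_prod _ (Set.toFinite _)]
  have hpos : ∀ q, 1 ≤ (orb q).ncard := by
    intro q
    rw [hcard]
    induction q using Quotient.inductionOn with
    | h a =>
      apply Finset.card_pos.mpr
      exact ⟨a, by simp⟩
  rw [Finset.prod_subset (Finset.subset_univ _)]
  · refine Finset.prod_congr rfl fun q _ => ?_
    rw [powerSum, hcard]
  · intro q _ hq
    simp only [Set.Finite.mem_toFinset, Set.mem_ofPred_eq, not_le] at hq
    have h1 : (orb q).ncard = 1 := by
      have := hpos q
      omega
    simp [h1, powerSum, w.sum_eq_one]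

open Classical in
/-- `χ` is of positive type. -/
theorem character_posType {d : ℕ} (w : Weights d) (x : SInf →₀ ℂ) :
    0 ≤ ∑ σ ∈ x.support, ∑ τ ∈ x.support,
      starRingEnd ℂ (x σ) * x τ * (character w (σ⁻¹ * τ) : ℂ) := by
  obtain ⟨N, hN⟩ : ∃ N : ℕ, ∀ σ ∈ x.support, ∀ n, N ≤ n → (σ : Equiv.Perm ℕ) n = n := by
    have hfin : (⋃ σ ∈ x.support, {n | (σ : Equiv.Perm ℕ) n ≠ n}).Finite :=
      Set.Finite.biUnion x.support.finite_toSet (fun σ _ => σ.2)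
    obtain ⟨B, hB⟩ := hfin.bddAbove
    refine ⟨B + 1, fun σ hσ n hn => ?_⟩
    by_contra h
    have : n ≤ B := hB (Set.mem_biUnion hσ h)
    omega
  have hd : 0 < d := by
    rcases Nat.eq_zero_or_pos d with rfl | h
    · have := w.sum_eq_one
      simp at this
    · exact h
  let ext0 : (Fin N → Fin d) → ℕ → Fin d := fun f n => if h : n < N then f ⟨n, h⟩ else ⟨0, hd⟩
  have hinv : ∀ (f : Fin N → Fin d) (σ τ : SInf), σ ∈ x.support → τ ∈ x.support →
      ((∀ a b : Fin N, ((σ⁻¹ * τ : SInf) : Equiv.Perm ℕ).SameCycle a b → f a = f b) ↔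
        (fun n => ext0 f ((σ : Equiv.Perm ℕ)⁻¹ n)) =
          (fun n => ext0 f ((τ : Equiv.Perm ℕ)⁻¹ n))) := by
    intro f σ τ hσ hτ
    set s : Equiv.Perm ℕ := ((σ⁻¹ * τ : SInf) : Equiv.Perm ℕ) with hs
    have hsfix : ∀ n, N ≤ n → s n = n := by
      intro n hn
      rw [hs, Subgroup.coe_mul, Equiv.Perm.mul_apply, hN τ hτ n hn, Subgroup.coe_inv,
        Equiv.Perm.inv_eq_iff_eq, hN σ hσ n hn]
    have hslt : ∀ n, n < N → s n < N := by
      intro n hn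
      by_contra h
      have h1 := hsfix _ (not_lt.mp h)
      have h2 := s.injective h1
      omega
    have step1 : ((fun n => ext0 f ((σ : Equiv.Perm ℕ)⁻¹ n)) =
          (fun n => ext0 f ((τ : Equiv.Perm ℕ)⁻¹ n))) ↔ ∀ n, ext0 f (s n) = ext0 f n := by
      constructor
      · intro h n
        have := congrFun h ((τ : Equiv.Perm ℕ) n)
        simpa [hs] using this
      · intro h
        funext n
        have := h ((τ : Equiv.Perm ℕ)⁻¹ n)
        simpa [hs] using this
    rw [step1]
    constructor
    · intro h n
      by_cases hn : n < N
      · have h1 := h ⟨n, hn⟩ ⟨s n, hslt n hn⟩ ⟨1, by simp⟩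
        simp only [ext0, hn, hslt n hn, dif_pos]
        exact h1.symm
      · rw [hsfix n (not_lt.mp hn)]
    · intro h a b hab
      obtain ⟨k, hk⟩ := hab
      have hz : ∀ (k : ℤ) (n : ℕ), ext0 f ((s ^ k) n) = ext0 f n := by
        intro k
        induction k using Int.induction_on with
        | zero => intro n; simp
        | succ k ih =>
          intro n
          rw [zpow_add, Equiv.Perm.mul_apply, ih, zpow_one, h]
        | pred k ih =>
          intro n
          rw [zpow_sub, Equiv.Perm.mul_apply, ih, zpow_one]
          have := h (s⁻¹ n)
          simpa using this.symm
      have := hz k a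
      rw [hk] at this
      simpa [ext0] using this.symm
  have hchar : ∀ σ ∈ x.support, ∀ τ ∈ x.support, (character w (σ⁻¹ * τ) : ℂ)
      = ∑ f : Fin N → Fin d, (if (fun n => ext0 f ((σ : Equiv.Perm ℕ)⁻¹ n)) =
          (fun n => ext0 f ((τ : Equiv.Perm ℕ)⁻¹ n)) then ((∏ a, w.wt (f a) : ℝ) : ℂ) else 0) := by
    intro σ hσ τ hτ
    rw [character_eq_sum (N := N) w (σ⁻¹ * τ) (by
      intro n hn
      rw [Subgroup.coe_mul, Equiv.Perm.mul_apply, hN τ hτ n hn, Subgroup.coe_inv,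
        Equiv.Perm.inv_eq_iff_eq, hN σ hσ n hn]), Complex.ofReal_sum]
    refine Finset.sum_congr rfl fun f _ => ?_
    simp only [hinv f σ τ hσ hτ]
    split_ifs <;> simp
  have hrw : ∑ σ ∈ x.support, ∑ τ ∈ x.support,
      starRingEnd ℂ (x σ) * x τ * (character w (σ⁻¹ * τ) : ℂ)
      = ∑ f : Fin N → Fin d, ((∏ a, w.wt (f a) : ℝ) : ℂ) *
        ∑ h ∈ x.support.image (fun σ : SInf => fun n => ext0 f ((σ : Equiv.Perm ℕ)⁻¹ n)),
          (starRingEnd ℂ (∑ σ ∈ x.support.filter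
            (fun σ : SInf => (fun n => ext0 f ((σ : Equiv.Perm ℕ)⁻¹ n)) = h), x σ)) *
          (∑ σ ∈ x.support.filter
            (fun σ : SInf => (fun n => ext0 f ((σ : Equiv.Perm ℕ)⁻¹ n)) = h), x σ) := by
    have e1 : ∑ σ ∈ x.support, ∑ τ ∈ x.support,
        starRingEnd ℂ (x σ) * x τ * (character w (σ⁻¹ * τ) : ℂ)
        = ∑ σ ∈ x.support, ∑ τ ∈ x.support, ∑ f : Fin N → Fin d,
          starRingEnd ℂ (x σ) * x τ * (if (fun n => ext0 f ((σ : Equiv.Perm ℕ)⁻¹ n)) =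
          (fun n => ext0 f ((τ : Equiv.Perm ℕ)⁻¹ n)) then
            ((∏ a, w.wt (f a) : ℝ) : ℂ) else 0) := by
      refine Finset.sum_congr rfl fun σ hσ => Finset.sum_congr rfl fun τ hτ => ?_
      rw [hchar σ hσ τ hτ, Finset.mul_sum]
    rw [e1]
    rw [Finset.sum_congr rfl (fun σ _ => Finset.sum_comm), Finset.sum_comm]
    refine Finset.sum_congr rfl fun f _ => ?_
    set F : SInf → ℕ → Fin d := fun σ n => ext0 f ((σ : Equiv.Perm ℕ)⁻¹ n) with hF
    rw [← Finset.sum_fiberwise_of_maps_to (t := x.support.image F) (g := F)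
      (fun σ hσ => Finset.mem_image_of_mem F hσ), Finset.mul_sum]
    refine Finset.sum_congr rfl fun h _ => ?_
    rw [map_sum, Finset.sum_mul, Finset.mul_sum]
    refine Finset.sum_congr rfl fun σ hσ => ?_
    have hσh : F σ = h := (Finset.mem_filter.mp hσ).2
    rw [Finset.mul_sum, Finset.mul_sum, Finset.sum_filter]
    refine Finset.sum_congr rfl fun τ _ => ?_
    change _ * (if F σ = F τ then _ else _) = _
    rw [hσh]
    by_cases hτ : F τ = h
    · rw [if_pos hτ.symm, if_pos hτ]; ring
    · rw [if_neg (Ne.symm hτ), if_neg hτ]; ring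
  rw [hrw]
  refine Finset.sum_nonneg fun f _ => mul_nonneg ?_ (Finset.sum_nonneg fun h _ => ?_)
  · exact_mod_cast Finset.prod_nonneg fun a _ => (w.pos _).le
  · exact star_mul_self_nonneg _

/-! ### The GNS representation of the character -/

/-- Finitely supported functions on `S_∞`, with the semi-inner product
`⟨σ, τ⟩ = χ(σ⁻¹ τ)` extended sesquilinearly (conjugate linear in the first variable). -/
@[nolint unusedArguments]
def PreGNS {d : ℕ} (_w : Weights d) : Type := SInf →₀ ℂ

noncomputable instance {d : ℕ} (w : Weights d) : AddCommGroup (PreGNS w) :=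
  inferInstanceAs (AddCommGroup (SInf →₀ ℂ))

noncomputable instance {d : ℕ} (w : Weights d) : Module ℂ (PreGNS w) :=
  inferInstanceAs (Module ℂ (SInf →₀ ℂ))

/-- The identity map from finitely supported functions to `PreGNS`. -/
noncomputable def toPreGNS {d : ℕ} (w : Weights d) : (SInf →₀ ℂ) ≃ₗ[ℂ] PreGNS w :=
  LinearEquiv.refl ℂ _

/-- The sesquilinear form `⟨∑ a_σ σ, ∑ b_τ τ⟩ = ∑ conj(a_σ) b_τ χ(σ⁻¹ τ)`. -/
noncomputable def gnsForm {d : ℕ} (w : Weights d) (x y : SInf →₀ ℂ) : ℂ :=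
  x.sum fun σ a => y.sum fun τ b => starRingEnd ℂ a * b * (character w (σ⁻¹ * τ) : ℂ)

noncomputable abbrev preGNSCore {d : ℕ} (w : Weights d) :
    PreInnerProductSpace.Core ℂ (PreGNS w) where
  inner x y := gnsForm w ((toPreGNS w).symm x) ((toPreGNS w).symm y)
  conj_inner_symm x y := by
    simp only [gnsForm, Finsupp.sum, map_sum, map_mul, Complex.conj_conj, Complex.conj_ofReal]
    rw [Finset.sum_comm]
    refine Finset.sum_congr rfl fun σ _ => Finset.sum_congr rfl fun τ _ => ?_
    rw [← character_inv w (τ⁻¹ * σ), mul_inv_rev, inv_inv]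
    ring
  re_inner_nonneg x := by
    have h := character_posType w ((toPreGNS w).symm x)
    exact (Complex.le_def.mp h).1
  add_left x y z := by
    simp only [gnsForm, map_add]
    rw [Finsupp.sum_add_index']
    · intro σ
      simp
    · intro σ a b
      rw [← Finsupp.sum_add]
      refine Finsupp.sum_congr fun τ _ => ?_
      rw [map_add]
      ring
  smul_left x y r := by
    simp only [gnsForm, map_smul]
    rw [Finsupp.sum_smul_index' (by intro σ; simp), Finsupp.mul_sum]
    refine Finsupp.sum_congr fun σ _ => ?_
    rw [Finsupp.mul_sum]
    refine Finsupp.sum_congr fun τ _ => ?_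
    simp only [smul_eq_mul, map_mul]
    ring

noncomputable instance {d : ℕ} (w : Weights d) : SeminormedAddCommGroup (PreGNS w) :=
  InnerProductSpace.Core.toSeminormedAddCommGroup (c := preGNSCore w)

noncomputable instance {d : ℕ} (w : Weights d) : InnerProductSpace ℂ (PreGNS w) :=
  InnerProductSpace.ofCore (preGNSCore w)

/-- The Hilbert space of the GNS representation of the character `χ`. -/
abbrev GNS {d : ℕ} (w : Weights d) : Type := UniformSpace.Completion (PreGNS w)

/-- The vector `σ̂` of the GNS space that corresponds to the permutation `σ`. -/
noncomputable def hat {d : ℕ} (w : Weights d) (σ : SInf) : GNS w :=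
  ((toPreGNS w (Finsupp.single σ 1) : PreGNS w) : GNS w)

/-- Left translation by `σ`, as a linear map. -/
noncomputable def leftTranslation {d : ℕ} (w : Weights d) (σ : SInf) : PreGNS w →ₗ[ℂ] PreGNS w :=
  (toPreGNS w).toLinearMap ∘ₗ Finsupp.lmapDomain ℂ ℂ (fun τ : SInf => σ * τ) ∘ₗ
    (toPreGNS w).symm.toLinearMap

theorem preGNS_inner {d : ℕ} (w : Weights d) (x y : PreGNS w) :
    inner ℂ x y = gnsForm w ((toPreGNS w).symm x) ((toPreGNS w).symm y) := rfl

theorem norm_leftTranslation {d : ℕ} (w : Weights d) (σ : SInf) (x : PreGNS w) :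
    ‖leftTranslation w σ x‖ = ‖x‖ := by
  have h : inner ℂ (leftTranslation w σ x) (leftTranslation w σ x) = inner ℂ x x := by
    rw [preGNS_inner, preGNS_inner]
    simp only [leftTranslation, LinearMap.comp_apply, LinearEquiv.coe_coe,
      LinearEquiv.symm_apply_apply, Finsupp.lmapDomain_apply, gnsForm]
    rw [Finsupp.sum_mapDomain_index_inj (mul_right_injective σ)]
    refine Finsupp.sum_congr fun τ _ => ?_
    rw [Finsupp.sum_mapDomain_index_inj (mul_right_injective σ)]
    refine Finsupp.sum_congr fun ρ _ => ?_
    have h' : (σ * τ)⁻¹ * (σ * ρ) = τ⁻¹ * ρ := by group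
    rw [h']
  rw [@norm_eq_sqrt_re_inner ℂ, @norm_eq_sqrt_re_inner ℂ _ _ _ _ x, h]

/-- The operator `U(σ)` on the GNS space: the continuous extension of left translation. -/
noncomputable def U {d : ℕ} (w : Weights d) (σ : SInf) : GNS w →L[ℂ] GNS w :=
  ((leftTranslation w σ).mkContinuous 1 fun x => by
    rw [norm_leftTranslation, one_mul]).completion

/-! The three properties that characterize the GNS representation. -/

theorem dense_span_hat {d : ℕ} (w : Weights d) :
    Dense (Submodule.span ℂ (Set.range (hat w)) : Set (GNS w)) := by
  refine (UniformSpace.Completion.denseRange_coe (α := PreGNS w)).mono ?_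
  rintro _ ⟨x, rfl⟩
  have hx : ∀ y : SInf →₀ ℂ, ((toPreGNS w y : PreGNS w) : GNS w) ∈
      Submodule.span ℂ (Set.range (hat w)) := by
    intro y
    induction y using Finsupp.induction_linear with
    | zero =>
      rw [map_zero, UniformSpace.Completion.coe_zero]
      exact Submodule.zero_mem _
    | add f g hf hg =>
      rw [map_add, UniformSpace.Completion.coe_add]
      exact Submodule.add_mem _ hf hg
    | single σ a =>
      have h : Finsupp.single σ a = a • Finsupp.single σ (1 : ℂ) := by simp
      rw [h, map_smul, UniformSpace.Completion.coe_smul]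
      exact Submodule.smul_mem _ _ (Submodule.subset_span ⟨σ, rfl⟩)
  exact hx ((toPreGNS w).symm x)

theorem inner_hat {d : ℕ} (w : Weights d) (σ τ : SInf) :
    inner ℂ (hat w σ) (hat w τ) = (character w (σ⁻¹ * τ) : ℂ) := by
  rw [hat, hat, UniformSpace.Completion.inner_coe, preGNS_inner]
  simp [gnsForm]

theorem U_hat {d : ℕ} (w : Weights d) (σ τ : SInf) : U w σ (hat w τ) = hat w (σ * τ) := by
  rw [hat, hat, U, ContinuousLinearMap.completion_apply_coe]
  simp [leftTranslation, Finsupp.mapDomain_single]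

/-! ### Noncommutative probability -/

/-- `(A, φ)` is a `*`-probability space: `φ` is a positive linear functional on the unital
`*`-algebra `A` with `φ(1) = 1`. -/
structure IsStarProbabilitySpace {A : Type*} [Ring A] [StarRing A] [Algebra ℂ A]
    (φ : A →ₗ[ℂ] ℂ) : Prop where
  map_one : φ 1 = 1
  nonneg : ∀ a : A, 0 ≤ φ (star a * a)

/-- The probability measure `μ` is the law of the (selfadjoint) element `a` with respect to the
linear functional `φ`: it has moments of all orders, `∫ tᵏ dμ(t) = φ(aᵏ)` for all `k`, and it is
the only probability measure on the real line for which this holds. -/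
structure IsLaw {A : Type*} [Ring A] [Algebra ℂ A] (φ : A →ₗ[ℂ] ℂ) (a : A)
    (μ : MeasureTheory.ProbabilityMeasure ℝ) : Prop where
  integrable : ∀ k : ℕ, MeasureTheory.Integrable (fun t : ℝ => t ^ k) (μ : MeasureTheory.Measure ℝ)
  moment : ∀ k : ℕ, φ (a ^ k) = ((∫ t : ℝ, t ^ k ∂(μ : MeasureTheory.Measure ℝ) : ℝ) : ℂ)
  unique : ∀ ν : MeasureTheory.ProbabilityMeasure ℝ,
    (∀ k : ℕ, MeasureTheory.Integrable (fun t : ℝ => t ^ k) (ν : MeasureTheory.Measure ℝ)) →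
    (∀ k : ℕ, φ (a ^ k) = ((∫ t : ℝ, t ^ k ∂(ν : MeasureTheory.Measure ℝ) : ℝ) : ℂ)) → ν = μ

/-! ### The limit law of the central limit theorem for the star transpositions -/

/-- The vector state `T ↦ ⟨T 1̂, 1̂⟩` of the vector that corresponds to the unit of `S_∞`. -/
noncomputable def vectorState {d : ℕ} (w : Weights d) : (GNS w →L[ℂ] GNS w) →ₗ[ℂ] ℂ where
  toFun T := inner ℂ (hat w 1) (T (hat w 1))
  map_add' S T := by simp [inner_add_right]
  map_smul' c T := by simp [inner_smul_right]

/-- `A₀` is the limit of the averages `(U(γ₁) + ⋯ + U(γ_n)) / n` in the strong operator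
topology. -/
def IsAverageLimit {d : ℕ} (w : Weights d) (A₀ : GNS w →L[ℂ] GNS w) : Prop :=
  ∀ x : GNS w, Filter.Tendsto
    (fun n : ℕ => ((1 / (n : ℝ) : ℝ) : ℂ) • ∑ i ∈ Finset.Icc 1 n, U w (starTransposition i) x)
    Filter.atTop (nhds (A₀ x))

/-- The rescaled sum `(1/√n) ∑_{i=1}^n (U(γ_i) - A₀)`. -/
noncomputable def rescaledSum {d : ℕ} (w : Weights d) (A₀ : GNS w →L[ℂ] GNS w) (n : ℕ) :
    GNS w →L[ℂ] GNS w :=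
  ((1 / Real.sqrt n : ℝ) : ℂ) • ∑ i ∈ Finset.Icc 1 n, (U w (starTransposition i) - A₀)

/-- `μ` is the limit law of the central limit theorem for the star transpositions: with `A₀` the
limit of the averages of the `U(γ_i)`, the laws `μ_n` of `(1/√n) ∑_{i=1}^n (U(γ_i) - A₀)` with
respect to the vector state of `1̂` exist and converge weakly to `μ`. -/
def IsCLTLimitLaw {d : ℕ} (w : Weights d) (μ : MeasureTheory.ProbabilityMeasure ℝ) : Prop :=
  ∃ A₀ : GNS w →L[ℂ] GNS w, IsAverageLimit w A₀ ∧
    ∃ μs : ℕ → MeasureTheory.ProbabilityMeasure ℝ,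
      (∀ n, 1 ≤ n → IsLaw (vectorState w) (rescaledSum w A₀ n) (μs n)) ∧
      Filter.Tendsto μs Filter.atTop (nhds μ)

/-! ### Traceless CCR-GUE matrices -/

/-- A family of unital `*`-subalgebras is commuting independent: elements of different
subalgebras commute, and `φ(x₁ ⋯ x_k) = φ(x₁) ⋯ φ(x_k)` for `x₁, …, x_k` taken from distinct
subalgebras. -/
structure IsCommutingIndependent {A : Type*} [Ring A] [StarRing A] [Algebra ℂ A] [StarModule ℂ A]
    {Λ : Type*} (φ : A →ₗ[ℂ] ℂ) (B : Λ → StarSubalgebra ℂ A) : Prop where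
  commute : ∀ l₁ l₂ : Λ, l₁ ≠ l₂ → ∀ x₁ ∈ B l₁, ∀ x₂ ∈ B l₂, x₁ * x₂ = x₂ * x₁
  factor : ∀ (k : ℕ) (l : Fin k → Λ), Function.Injective l →
    ∀ x : Fin k → A, (∀ i, x i ∈ B (l i)) → φ (List.ofFn x).prod = ∏ i, φ (x i)

/-- The element `a` is centred CCR-complex-Gaussian with parameters `ω₁ = ω_(1,*)` and
`ω₂ = ω_(*,1)`. -/
structure IsCCRComplexGaussian {A : Type*} [Ring A] [StarRing A] [Algebra ℂ A]
    (φ : A →ₗ[ℂ] ℂ) (a : A) (ω₁ ω₂ : ℝ) : Prop where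
  commutation : star a * a = a * star a + algebraMap ℂ A ((ω₂ - ω₁ : ℝ) : ℂ)
  moment : ∀ p q : ℕ, φ (a ^ p * star a ^ q) =
    if p = q then (((p.factorial : ℝ) * ω₁ ^ p : ℝ) : ℂ) else 0

/-- The pair-partitions of `{1, …, k}`, encoded as the fixed-point-free involutions: the pairs of
the partition are the sets `{p, ρ p}`. -/
def pairPartitions (k : ℕ) : Finset (Equiv.Perm (Fin k)) :=
  Finset.univ.filter fun ρ => ∀ p, ρ (ρ p) = p ∧ ρ p ≠ p

/-- `x₁, …, x_d` is a centred Gaussian family with covariance matrix `C`: its joint moments are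
given by the Wick formula, a sum over the pair-partitions `ρ` of the product of the covariances
over the pairs `{p, ρ p}` (each pair being listed once, with `p < ρ p`). -/
def IsCentredGaussianFamily {A : Type*} [Ring A] [Algebra ℂ A] {d : ℕ}
    (φ : A →ₗ[ℂ] ℂ) (x : Fin d → A) (C : Matrix (Fin d) (Fin d) ℝ) : Prop :=
  ∀ (k : ℕ) (i : Fin k → Fin d), φ (List.ofFn fun p => x (i p)).prod =
    ((∑ ρ ∈ pairPartitions k, ∏ p ∈ Finset.univ.filter (fun p => p < ρ p),
      C (i p) (i (ρ p)) : ℝ) : ℂ)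

/-- `M` is a traceless CCR-GUE matrix over `(A, φ)` with parameters `w₁, …, w_d`.  The subalgebras
are indexed by `Option`: `B none` contains the diagonal entries, and `B (some (i, j))` contains the
entries at the positions `(i, j)` and `(j, i)`, for `i < j`. -/
def IsTracelessCCRGUE {A : Type*} [Ring A] [StarRing A] [Algebra ℂ A] [StarModule ℂ A] {d : ℕ}
    (w : Weights d) (φ : A →ₗ[ℂ] ℂ) (M : Matrix (Fin d) (Fin d) A) : Prop :=
  ∃ B : Option {p : Fin d × Fin d // p.1 < p.2} → StarSubalgebra ℂ A,
    IsCommutingIndependent φ B ∧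
    (∀ (i j : Fin d) (h : i < j), M i j ∈ B (some ⟨(i, j), h⟩) ∧
      IsCCRComplexGaussian φ (M i j) (w.wt j) (w.wt i) ∧ M j i = star (M i j)) ∧
    (∀ x ∈ B none, ∀ y ∈ B none, x * y = y * x) ∧
    (∀ i, M i i ∈ B none ∧ star (M i i) = M i i) ∧
    IsCentredGaussianFamily φ (fun i => M i i)
      (Matrix.of fun i j => if i = j then w.wt i - w.wt i ^ 2 else -(w.wt i * w.wt j))

/-- The linear functional `φ_w(X) = ∑ i, w_i φ(x_ii)` on the matrices over `A`. -/
noncomputable def weightedTrace {A : Type*} [Ring A] [Algebra ℂ A] {d : ℕ} (w : Weights d)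
    (φ : A →ₗ[ℂ] ℂ) : Matrix (Fin d) (Fin d) A →ₗ[ℂ] ℂ where
  toFun X := ∑ i, (w.wt i : ℂ) * φ (X i i)
  map_add' X Y := by simp [mul_add, Finset.sum_add_distrib]
  map_smul' c X := by
    simp only [Matrix.smul_apply, map_smul, smul_eq_mul, RingHom.id_apply, Finset.mul_sum]
    exact Finset.sum_congr rfl fun i _ => by ring

end StarCLT

/-! Joint moments are treated as functionals on words, multiplied by the shuffle product. For two
families that commute with each other and are independent, the functional of the sum is the product
of the functionals (`WordFun.ofWord_add`). Prepending a letter is a derivation, so identities,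
bounds and limits follow by induction on the length of the word. A Gaussian law, commutative or not,
becomes the equation `∂ₓ f = letter (K x) * f` with `f [] = 1` (`WordFun.IsWick`). Its solution
exists and is unique for every covariance `K`, symmetric or not, and multiplying solutions adds
covariances. The central limit theorem then reads: if `ψ` is centred, the `n`-th power of `ψ`
rescaled by `1/√n` tends to the Wick functional whose covariance is given by the second moments of
`ψ` (`WordFun.tendsto_scale_pow`).

On the side of the permutations, `χ` counts weighted colourings that are constant on orbits. Hence
its values on words in star transpositions are computed in a product state on tensors of `d × d`
matrices, where `γ_{s+1}` is the flip of a base site and the site `s` (`character_starWord`). The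
operator `A₀` is the limit of averages of the `U(γ_j)`, and all but finitely many `j` are new to a
given word. Integrating out the flip with a new site leaves the multiplication by the weight at the
base site (`weightedTrace_mul_flipMat_mul`). So the centred sums have the moments of a matrix whose
entries are sums of `n` commuting independent copies of `E_ba - δ_ab w_a` (`vectorState_word`,
`ofWord_modelSum`). The covariance of one copy is `gueCov`, and the limit moments are closed-walk
sums of the Wick functional `W` of `gueCov`.

The entries of a traceless CCR-GUE matrix have the same functional `W`. The Gaussian diagonal is
Wick by the pairing recursion (`WordFun.isWick_pairingSum`), each pair of conjugate entries is Wick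
by normal ordering (`WordFun.isWick_ccr`), and by independence the covariances add up to `gueCov`.

The limit moments are at most `d ^ k * (k - 1)‼`, so they determine the measure. The laws `μ_n` are
spectral measures, and convergence of moments gives weak convergence by tightness
(`exists_tendsto_of_tendsto_moments`). -/

namespace StarCLT

/-! ### Functionals on words and the shuffle product -/

/-- Functionals on the words over the alphabet `α`. -/
structure WordFun (α : Type*) where
  toFun : List α → ℂ

namespace WordFun

variable {α : Type*}

instance : CoeFun (WordFun α) fun _ => List α → ℂ := ⟨toFun⟩

@[ext] theorem ext {f g : WordFun α} (h : ∀ l, f l = g l) : f = g := by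
  cases f
  cases g
  exact congrArg _ (funext h)

/-- Functionals on words as functions. -/
def equivFun : WordFun α ≃ (List α → ℂ) := ⟨toFun, mk, fun _ => rfl, fun _ => rfl⟩

noncomputable instance : AddCommGroup (WordFun α) := equivFun.addCommGroup

noncomputable instance : Module ℂ (WordFun α) := equivFun.module ℂ

@[simp] theorem add_apply (f g : WordFun α) (l : List α) : (f + g) l = f l + g l := rfl

@[simp] theorem zero_apply (l : List α) : (0 : WordFun α) l = 0 := rfl

@[simp] theorem smul_apply (c : ℂ) (f : WordFun α) (l : List α) : (c • f) l = c * f l := rfl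

/-- The derivation `∂ₓ`, which prepends the letter `x`. -/
def deriv (x : α) (f : WordFun α) : WordFun α := ⟨fun l => f (x :: l)⟩

theorem deriv_apply (x : α) (f : WordFun α) (l : List α) : deriv x f l = f (x :: l) := rfl

@[simp] theorem deriv_add (x : α) (f g : WordFun α) :
    deriv x (f + g) = deriv x f + deriv x g := rfl

@[simp] theorem deriv_smul (x : α) (c : ℂ) (f : WordFun α) :
    deriv x (c • f) = c • deriv x f := rfl

@[simp] theorem deriv_zero (x : α) : deriv x (0 : WordFun α) = 0 := rfl

/-- The shuffle product: the sum of `f l₁ * g l₂` over all the ways to split a word into two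
complementary subwords. -/
noncomputable def shuffle : List α → WordFun α → WordFun α → ℂ
  | [], f, g => f [] * g []
  | x :: l, f, g => shuffle l (deriv x f) g + shuffle l f (deriv x g)

/-- The structure `WordFun` keeps this product apart from the pointwise product of functions. The
unit is the indicator of the empty word. -/
noncomputable instance : Mul (WordFun α) := ⟨fun f g => ⟨fun l => shuffle l f g⟩⟩

noncomputable instance : One (WordFun α) := ⟨⟨fun l => l.casesOn 1 fun _ _ => 0⟩⟩

@[simp] theorem one_nil : (1 : WordFun α) [] = 1 := rfl

@[simp] theorem deriv_one (x : α) : deriv x (1 : WordFun α) = 0 := rfl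

@[simp] theorem mul_nil (f g : WordFun α) : (f * g) [] = f [] * g [] := rfl

theorem mul_cons (f g : WordFun α) (x : α) (l : List α) :
    (f * g) (x :: l) = (deriv x f * g) l + (f * deriv x g) l := rfl

/-- The Leibniz rule is the definition of the shuffle. A functional is determined by its value at
`[]` and its derivatives, which is how the ring axioms below are proved. -/
theorem deriv_mul (x : α) (f g : WordFun α) :
    deriv x (f * g) = deriv x f * g + f * deriv x g := rfl

theorem mul_comm' (f g : WordFun α) : f * g = g * f := by
  ext l
  induction l generalizing f g with
  | nil => exact mul_comm _ _
  | cons x l ih => rw [mul_cons, mul_cons, ih, ih f, add_comm]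

theorem zero_mul' (f : WordFun α) : 0 * f = 0 := by
  ext l
  induction l generalizing f with
  | nil => simp
  | cons x l ih => rw [mul_cons, deriv_zero, ih, ih]; simp

theorem add_mul' (f g h : WordFun α) : (f + g) * h = f * h + g * h := by
  ext l
  induction l generalizing f g h with
  | nil => simp [add_mul]
  | cons x l ih =>
    rw [mul_cons, deriv_add, ih, ih, add_apply, add_apply, add_apply, mul_cons, mul_cons]
    ring

theorem smul_mul' (c : ℂ) (f g : WordFun α) : (c • f) * g = c • (f * g) := by
  ext l
  induction l generalizing f g with
  | nil => simp [mul_assoc]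
  | cons x l ih =>
    rw [mul_cons, deriv_smul, ih, ih, smul_apply, smul_apply, smul_apply, mul_cons]
    ring

theorem one_mul' (f : WordFun α) : 1 * f = f := by
  ext l
  induction l generalizing f with
  | nil => simp
  | cons x l ih => rw [mul_cons, ih, deriv_one, zero_mul', zero_apply, zero_add]; rfl

theorem mul_assoc' (f g h : WordFun α) : f * g * h = f * (g * h) := by
  ext l
  induction l generalizing f g h with
  | nil => simp [mul_assoc]
  | cons x l ih =>
    have hl (u v v' : WordFun α) : u * (v + v') = u * v + u * v' := by
      rw [mul_comm', add_mul', mul_comm' v, mul_comm' v']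
    rw [mul_cons, deriv_mul, add_mul', add_apply, ih, ih, ih, mul_cons, deriv_mul, hl, add_apply]
    ring

noncomputable instance : CommRing (WordFun α) where
  __ := equivFun.addCommGroup
  mul_assoc := mul_assoc'
  one_mul := one_mul'
  mul_one f := by rw [mul_comm', one_mul']
  zero_mul := zero_mul'
  mul_zero f := by rw [mul_comm', zero_mul']
  left_distrib f g h := by rw [mul_comm', add_mul', mul_comm' g, mul_comm' h]
  right_distrib := add_mul'
  mul_comm := mul_comm'

noncomputable instance : Algebra ℂ (WordFun α) :=
  Algebra.ofModule smul_mul' fun c f g => by rw [mul_comm, smul_mul', mul_comm]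

theorem deriv_pow_succ (x : α) (f : WordFun α) (n : ℕ) :
    deriv x (f ^ (n + 1)) = ((n + 1 : ℕ) : ℂ) • (deriv x f * f ^ n) := by
  induction n with
  | zero => simp
  | succ n ih =>
    rw [pow_succ, deriv_mul, ih]
    rw [smul_mul_assoc, mul_assoc, ← pow_succ, mul_comm (f ^ (n + 1)), Nat.cast_succ (n + 1),
      add_smul, one_smul]

/-! ### Rescaling and one-letter functionals -/

/-- Multiplication by `t ^ n` on the words of length `n`. -/
noncomputable def scale (t : ℂ) (f : WordFun α) : WordFun α := ⟨fun l => t ^ l.length * f l⟩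

theorem deriv_scale (t : ℂ) (x : α) (f : WordFun α) :
    deriv x (scale t f) = t • scale t (deriv x f) := by
  ext l
  simp [deriv, scale, pow_succ]
  ring

theorem scale_mul (t : ℂ) (f g : WordFun α) : scale t (f * g) = scale t f * scale t g := by
  ext l
  induction l generalizing f g with
  | nil => simp [scale]
  | cons x l ih =>
    rw [mul_cons, deriv_scale, deriv_scale, smul_mul_assoc, mul_smul_comm, smul_apply, smul_apply,
      ← ih, ← ih]
    simp only [scale, mul_cons, List.length_cons, pow_succ]
    ring

theorem scale_pow (t : ℂ) (f : WordFun α) (n : ℕ) : scale t (f ^ n) = scale t f ^ n := by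
  induction n with
  | zero =>
    ext l
    rw [pow_zero, pow_zero]
    cases l with
    | nil => simp [scale]
    | cons x l => exact mul_zero _
  | succ n ih => rw [pow_succ, scale_mul, ih, pow_succ]

/-- The functional that is `c` on the one-letter words and `0` elsewhere. -/
noncomputable def letter (c : α → ℂ) : WordFun α where
  toFun
    | [y] => c y
    | _ => 0

@[simp] theorem letter_nil (c : α → ℂ) : letter c [] = 0 := rfl

@[simp] theorem letter_cons_cons (c : α → ℂ) (x y : α) (l : List α) :
    letter c (x :: y :: l) = 0 := rfl

@[simp] theorem letter_singleton (c : α → ℂ) (x : α) : letter c [x] = c x := rfl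

@[simp] theorem deriv_letter (c : α → ℂ) (x : α) : deriv x (letter c) = c x • 1 := by
  ext l
  rcases l with _ | ⟨y, l⟩
  · simp [deriv]
  · exact (mul_zero _).symm

theorem letter_add (c c' : α → ℂ) : letter (c + c') = letter c + letter c' := by
  ext l
  rcases l with _ | ⟨y, _ | ⟨z, l⟩⟩ <;> simp

theorem letter_mul_cons (c : α → ℂ) (f : WordFun α) (x : α) (l : List α) :
    (letter c * f) (x :: l) = c x * f l + (letter c * deriv x f) l := by
  rw [mul_cons, deriv_letter, smul_mul_assoc, one_mul, smul_apply]

/-- A shuffle with `letter c` removes exactly one letter from the word, so only shorter words matter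
for the other factor. This makes the Wick equation a recursion on length. -/
theorem letter_mul_congr (c : α → ℂ) {f g : WordFun α} (l : List α)
    (h : ∀ l', l'.length < l.length → f l' = g l') : (letter c * f) l = (letter c * g) l := by
  induction l generalizing f g with
  | nil => simp
  | cons x l ih =>
    rw [letter_mul_cons, letter_mul_cons, h l (by simp), ih (f := deriv x f) (g := deriv x g)]
    intro l' hl'
    exact h _ (by simpa using hl')

theorem norm_letter_mul_le {c : α → ℂ} (hc : ∀ x, ‖c x‖ ≤ 1) {f : WordFun α} (l : List α) {b : ℝ}
    (h : ∀ l', l'.length + 1 = l.length → ‖f l'‖ ≤ b) :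
    ‖(letter c * f) l‖ ≤ l.length * b := by
  induction l generalizing f with
  | nil => simp
  | cons x l ih =>
    rw [letter_mul_cons, List.length_cons]
    push_cast
    have h1 := ih (f := deriv x f) fun l' hl' => h _ (by simpa using hl')
    have h2 : ‖c x * f l‖ ≤ 1 * b := by
      rw [norm_mul]
      exact mul_le_mul (hc x) (h l rfl) (norm_nonneg _) zero_le_one
    exact (norm_add_le _ _).trans (by linarith)

/-! ### Wick functionals -/

/-- `f` is the Wick functional with covariance `K`. -/
structure IsWick (K : α → α → ℂ) (f : WordFun α) : Prop where
  nil : f [] = 1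
  deriv : ∀ x, deriv x f = letter (K x) * f

theorem IsWick.unique {K : α → α → ℂ} {f g : WordFun α} (hf : IsWick K f) (hg : IsWick K g) :
    f = g := by
  have key : ∀ n : ℕ, ∀ l : List α, l.length ≤ n → f l = g l := by
    intro n
    induction n with
    | zero =>
      intro l hl
      rw [List.length_eq_zero_iff.mp (Nat.le_zero.mp hl), hf.nil, hg.nil]
    | succ n ih =>
      rintro (_ | ⟨x, l⟩) hl
      · rw [hf.nil, hg.nil]
      · rw [← deriv_apply, ← deriv_apply, hf.deriv, hg.deriv]
        refine letter_mul_congr _ _ fun l' hl' => ih l' ?_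
        simp only [List.length_cons] at hl
        omega
  exact ext fun l => key _ l le_rfl

/-- The Wick equation is a logarithmic derivative: the logarithmic derivatives of a product add, and
`letter` is additive. -/
theorem IsWick.mul {K K' : α → α → ℂ} {f g : WordFun α} (hf : IsWick K f) (hg : IsWick K' g) :
    IsWick (K + K') (f * g) where
  nil := by simp [hf.nil, hg.nil]
  deriv x := by
    rw [deriv_mul, hf.deriv, hg.deriv, Pi.add_apply, letter_add]
    ring

theorem isWick_zero : IsWick (0 : α → α → ℂ) 1 where
  nil := rfl
  deriv x := by
    have : letter (0 : α → ℂ) = 0 := by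
      ext l
      rcases l with _ | ⟨y, _ | ⟨z, l⟩⟩ <;> simp
    simp [this]

theorem IsWick.prod {ι : Type*} (s : Finset ι) {K : ι → α → α → ℂ} {f : ι → WordFun α}
    (h : ∀ i ∈ s, IsWick (K i) (f i)) : IsWick (∑ i ∈ s, K i) (∏ i ∈ s, f i) := by
  classical
  induction s using Finset.induction_on with
  | empty => simpa using isWick_zero
  | insert a s ha ih =>
    rw [Finset.sum_insert ha, Finset.prod_insert ha]
    exact (h a (Finset.mem_insert_self a s)).mul
      (ih fun i hi => h i (Finset.mem_insert_of_mem hi))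

-- With covariances bounded by `1`, the equation bounds words of length `n` by `n - 1` times the
-- bound for length `n - 2`; this is the recursion of `(n - 1)‼`, the number of pairings when `n` is
-- even.
open scoped Nat in
theorem IsWick.norm_le {K : α → α → ℂ} (hK : ∀ x y, ‖K x y‖ ≤ 1) {f : WordFun α}
    (hf : IsWick K f) (l : List α) : ‖f l‖ ≤ ((l.length - 1)‼ : ℕ) := by
  have key : ∀ n : ℕ, ∀ l : List α, l.length = n → ‖f l‖ ≤ ((n - 1)‼ : ℕ) := by
    intro n
    induction n using Nat.strong_induction_on with
    | _ n ih =>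
      rintro (_ | ⟨x, l⟩) hl
      · subst hl
        simp [hf.nil]
      · rw [← deriv_apply, hf.deriv]
        simp only [List.length_cons] at hl
        refine (norm_letter_mul_le (hK x) l (b := ((n - 2 - 1)‼ : ℕ)) fun l' hl' =>
          ih (n - 2) (by omega) l' (by omega)).trans ?_
        -- With `m = l.length` this is `m * (m - 2)‼ ≤ m‼`; the cases `m ≤ 1` are separate because
        -- of truncated subtraction.
        have : l.length * (n - 2 - 1)‼ ≤ (n - 1)‼ := by
          obtain rfl : n = l.length + 1 := hl.symm
          rcases l with _ | ⟨y, _ | ⟨z, l⟩⟩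
          · simp
          · simp
          · simp
        exact_mod_cast this
  exact key _ l rfl

/-! ### The central limit theorem for functionals on words -/

open Filter Topology

theorem tendsto_mul {ι : Type*} {F : Filter ι} {f g : ι → WordFun α} {f' g' : WordFun α}
    (l : List α) (hf : ∀ l', l'.length ≤ l.length → Tendsto (fun n => f n l') F (𝓝 (f' l')))
    (hg : ∀ l', l'.length ≤ l.length → Tendsto (fun n => g n l') F (𝓝 (g' l'))) :
    Tendsto (fun n => (f n * g n) l) F (𝓝 ((f' * g') l)) := by
  induction l generalizing f g f' g' with
  | nil => exact (hf [] le_rfl).mul (hg [] le_rfl)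
  | cons x l ih =>
    simp only [mul_cons]
    have h1 : ∀ l' : List α, l'.length ≤ l.length → (x :: l').length ≤ (x :: l).length := by simp
    have h2 : ∀ l' : List α, l'.length ≤ l.length → l'.length ≤ (x :: l).length := by
      intro l' h
      simp only [List.length_cons]
      omega
    exact (ih (f := fun n => deriv x (f n)) (f' := deriv x f') (fun l' h => hf _ (h1 l' h))
      (fun l' h => hg _ (h2 l' h))).add
      (ih (g := fun n => deriv x (g n)) (g' := deriv x g') (fun l' h => hf _ (h2 l' h))
      (fun l' h => hg _ (h1 l' h)))

/-- The derivative of `(scale t ψ) ^ N` is `N t • scale t (∂ₓ ψ)` times the power `N - 1`. The first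
factor tends to `letter (K x)` and the second to `W`, by induction on the length, so the limit
satisfies the Wick equation. -/
theorem tendsto_scale_pow {K : α → α → ℂ} {ψ W : WordFun α} (hW : IsWick K W) (h0 : ψ [] = 1)
    (h1 : ∀ x, ψ [x] = 0) (h2 : ∀ x y, ψ [x, y] = K x y) {t : ℕ → ℂ}
    (ht : Tendsto t atTop (𝓝 0)) {N : ℕ → ℕ}
    (hN : Tendsto (fun n => (N n : ℂ) * t n ^ 2) atTop (𝓝 1)) (l : List α) :
    Tendsto (fun n => (scale (t n) ψ ^ N n) l) atTop (𝓝 (W l)) := by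
  -- The exponents `N` vary in the induction, since differentiation replaces `N` by `N - 1`; the
  -- hypothesis on `N t ^ 2` survives because `t ^ 2` tends to `0`.
  have key : ∀ k : ℕ, ∀ N : ℕ → ℕ, Tendsto (fun n => (N n : ℂ) * t n ^ 2) atTop (𝓝 1) →
      ∀ l : List α, l.length ≤ k →
      Tendsto (fun n => (scale (t n) ψ ^ N n) l) atTop (𝓝 (W l)) := by
    intro k
    induction k with
    | zero =>
      intro N _ l hl
      rw [List.length_eq_zero_iff.mp (Nat.le_zero.mp hl), hW.nil]
      have : ∀ n, (scale (t n) ψ ^ N n) [] = 1 := by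
        intro n
        induction N n with
        | zero => rfl
        | succ m ih => rw [pow_succ, mul_nil, ih]; simp [scale, h0]
      simp [this]
    | succ k ih =>
      rintro N hN (_ | ⟨x, l⟩) hl
      · exact ih N hN [] (by simp)
      · have hl' : l.length ≤ k := by simpa using hl
        rw [← deriv_apply, hW.deriv]
        have hN1 : ∀ᶠ n in atTop, N n ≠ 0 := by
          have := hN.eventually_ne (one_ne_zero)
          filter_upwards [this] with n hn h
          simp [h] at hn
        have hstep : Tendsto (fun n => ((((N n : ℂ) * t n) • scale (t n) (deriv x ψ)) *
            scale (t n) ψ ^ (N n - 1)) l) atTop (𝓝 ((letter (K x) * W) l)) := by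
          refine tendsto_mul l ?_ fun l' hl'' => ih (fun n => N n - 1) ?_ l' (hl''.trans hl')
          · intro l' _
            -- On the empty word the factor vanishes because `ψ` is centred; on one letter it is `N
            -- t ^ 2 * K x y`; each further letter contributes a factor `t`, which tends to `0`.
            rcases l' with _ | ⟨y, l'⟩
            · simp [scale, deriv, h1]
            · have e : ∀ n, (((N n : ℂ) * t n) • scale (t n) (deriv x ψ)) (y :: l') =
                  ((N n : ℂ) * t n ^ 2) * (t n ^ l'.length * ψ (x :: y :: l')) := by
                intro n
                simp only [smul_apply, scale, deriv, List.length_cons, pow_succ]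
                ring
              simp only [e]
              rcases l' with _ | ⟨z, l'⟩
              · simpa [h2] using hN.mul_const (K x y)
              · have := hN.mul ((ht.pow (z :: l').length).mul_const (ψ (x :: y :: z :: l')))
                simpa using this
          · have h3 : Tendsto (fun n => (N n : ℂ) * t n ^ 2 - t n ^ 2) atTop (𝓝 1) := by
              simpa using hN.sub (ht.pow 2)
            refine h3.congr' ?_
            filter_upwards [hN1] with n hn
            rw [Nat.cast_sub (Nat.one_le_iff_ne_zero.mpr hn)]
            push_cast
            ring
        refine hstep.congr' ?_
        filter_upwards [hN1] with n hn
        obtain ⟨m, hm⟩ := Nat.exists_eq_succ_of_ne_zero hn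
        rw [← deriv_apply, hm, Nat.succ_eq_add_one, deriv_pow_succ, deriv_scale]
        simp only [smul_mul_assoc, smul_apply, Nat.add_sub_cancel]
        push_cast
        ring
  exact key _ N hN l le_rfl

/-! ### Words in an algebra -/

section Word

variable {A : Type*} [Ring A] [Algebra ℂ A]

/-- The functional `x₁ ⋯ x_k ↦ φ(y(x₁) ⋯ y(x_k))`. -/
def ofWord (φ : A →ₗ[ℂ] ℂ) (y : α → A) : WordFun α := ⟨fun l => φ (l.map y).prod⟩

/-- Expanding `∏ (y + z)` assigns each letter to `y` or to `z`. Commutation collects the two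
subwords, and `hφ` factorizes the result: this is the shuffle. -/
theorem ofWord_add {φ : A →ₗ[ℂ] ℂ} {y z : α → A} (hc : ∀ a b, Commute (y a) (z b))
    (hφ : ∀ l l' : List α, φ ((l.map y).prod * (l'.map z).prod) =
      φ (l.map y).prod * φ (l'.map z).prod) :
    ofWord φ (y + z) = ofWord φ y * ofWord φ z := by
  -- The words `u` and `v` record the letters already assigned to `y` and to `z`.
  have key : ∀ l u v : List α, φ ((u.map y).prod * (v.map z).prod * (l.map (y + z)).prod) =
      ((⟨fun l' => ofWord φ y (u ++ l')⟩ : WordFun α) *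
        (⟨fun l' => ofWord φ z (v ++ l')⟩ : WordFun α)) l := by
    intro l
    induction l with
    | nil =>
      intro u v
      simp [ofWord, hφ]
    | cons x l ih =>
      intro u v
      rw [mul_cons]
      have h1 := ih (u ++ [x]) v
      have h2 := ih u (v ++ [x])
      simp only [List.append_assoc, List.singleton_append] at h1 h2
      change _ = ((⟨fun l' => ofWord φ y (u ++ x :: l')⟩ : WordFun α) * _) l +
        (_ * (⟨fun l' => ofWord φ z (v ++ x :: l')⟩ : WordFun α)) l
      rw [← h1, ← h2, ← map_add]
      congr 1
      simp only [List.map_append, List.prod_append, List.map_cons, List.map_nil, List.prod_cons,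
        List.prod_nil, mul_one, Pi.add_apply]
      have hcx : Commute (y x) (v.map z).prod := by
        refine Commute.list_prod_right _ _ fun b hb => ?_
        obtain ⟨b, _, rfl⟩ := List.mem_map.mp hb
        exact hc x b
      rw [mul_assoc (u.map y).prod (y x), hcx.eq]
      noncomm_ring
  ext l
  simpa [ofWord] using key l [] []

/-- The sum of `f` over the words that describe the closed walks, as for the entries of the `k`-th
power of a matrix. -/
noncomputable def walkSum {ι : Type*} [Fintype ι] [DecidableEq ι] :
    ℕ → WordFun (ι × ι) → ι → ι → ℂ
  | 0, f, i, j => if i = j then f [] else 0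
  | k + 1, f, i, j => ∑ m, walkSum k (deriv (i, m) f) m j

theorem walkSum_ofWord {ι : Type*} [Fintype ι] [DecidableEq ι] (φ : A →ₗ[ℂ] ℂ) (M : Matrix ι ι A)
    (k : ℕ) (i j : ι) : φ ((M ^ k) i j) = walkSum k (ofWord φ fun p => M p.1 p.2) i j := by
  induction k generalizing φ i with
  | zero =>
    rw [pow_zero, walkSum, Matrix.one_apply]
    split_ifs <;> simp [ofWord]
  | succ k ih =>
    rw [pow_succ', Matrix.mul_apply, map_sum, walkSum]
    refine Finset.sum_congr rfl fun m _ => ?_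
    -- Absorbing the first entry of the walk into the functional is the derivation by the letter
    -- `(i, m)`.
    have := ih (φ ∘ₗ LinearMap.mulLeft ℂ (M i m)) m
    rw [LinearMap.comp_apply, LinearMap.mulLeft_apply] at this
    rw [this]
    rfl

theorem tendsto_walkSum {ι κ : Type*} [Fintype ι] [DecidableEq ι] {F : Filter κ}
    {f : κ → WordFun (ι × ι)} {g : WordFun (ι × ι)}
    (h : ∀ l, Tendsto (fun n => f n l) F (𝓝 (g l))) (k : ℕ) (i j : ι) :
    Tendsto (fun n => walkSum k (f n) i j) F (𝓝 (walkSum k g i j)) := by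
  induction k generalizing f g i with
  | zero =>
    simp only [walkSum]
    split_ifs
    · exact h []
    · exact tendsto_const_nhds
  | succ k ih =>
    simp only [walkSum]
    exact tendsto_finsetSum _ fun m _ => ih (f := fun n => deriv (i, m) (f n)) (g := deriv (i, m) g) (fun l => h _) m

theorem walkSum_scale {ι : Type*} [Fintype ι] [DecidableEq ι] (t : ℂ) (f : WordFun (ι × ι))
    (k : ℕ) (i j : ι) : walkSum k (scale t f) i j = t ^ k * walkSum k f i j := by
  have hs : ∀ k : ℕ, ∀ (c : ℂ) (f : WordFun (ι × ι)) (i : ι),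
      walkSum k (c • f) i j = c * walkSum k f i j := by
    intro k
    induction k with
    | zero => intro c f i; simp [walkSum]
    | succ k ih => intro c f i; simp [walkSum, ih, Finset.mul_sum]
  induction k generalizing f i with
  | zero => simp [walkSum, scale]
  | succ k ih =>
    simp only [walkSum, deriv_scale, hs, ih, Finset.mul_sum, pow_succ]
    exact Finset.sum_congr rfl fun m _ => by ring

theorem norm_walkSum_le {ι : Type*} [Fintype ι] [DecidableEq ι] {f : WordFun (ι × ι)} {k : ℕ}
    {b : ℝ} (hb : 0 ≤ b) (h : ∀ l, l.length = k → ‖f l‖ ≤ b) (i j : ι) :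
    ‖walkSum k f i j‖ ≤ Fintype.card ι ^ k * b := by
  induction k generalizing f i with
  | zero =>
    simp only [walkSum]
    split_ifs
    · simpa using h [] rfl
    · simpa using hb
  | succ k ih =>
    simp only [walkSum]
    refine (norm_sum_le_of_le _ fun m _ =>
      ih (f := deriv (i, m) f) (fun l hl => h _ (by simp [hl])) m).trans ?_
    simp [pow_succ]
    exact le_of_eq (by ring)

end Word

end WordFun

/-! ### The recursion for the sum over the pair-partitions -/

/-- The embedding of `Fin k` in `Fin (k + 2)` that omits `0` and `q + 1`. -/
def omitPair {k : ℕ} (q : Fin (k + 1)) : Fin k ↪ Fin (k + 2) :=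
  q.succAboveEmb.trans (Fin.succEmb (k + 1))

theorem omitPair_apply {k : ℕ} (q : Fin (k + 1)) (p : Fin k) :
    omitPair q p = (q.succAbove p).succ := rfl

theorem omitPair_lt {k : ℕ} (q : Fin (k + 1)) (p p' : Fin k) :
    omitPair q p < omitPair q p' ↔ p < p' := by
  rw [omitPair_apply, omitPair_apply, Fin.succ_lt_succ_iff, Fin.succAbove_lt_succAbove_iff]

theorem zero_notMem_range_omitPair {k : ℕ} (q : Fin (k + 1)) :
    (0 : Fin (k + 2)) ∉ Set.range (omitPair q) := by
  rintro ⟨p, hp⟩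
  exact Fin.succ_ne_zero _ hp

theorem succ_notMem_range_omitPair {k : ℕ} (q : Fin (k + 1)) :
    q.succ ∉ Set.range (omitPair q) := by
  rintro ⟨p, hp⟩
  exact Fin.succAbove_ne q p (Fin.succ_injective _ hp)

theorem eq_or_mem_range_omitPair {k : ℕ} (q : Fin (k + 1)) (p : Fin (k + 2)) :
    p = 0 ∨ p = q.succ ∨ ∃ p', omitPair q p' = p := by
  induction p using Fin.cases with
  | zero => exact Or.inl rfl
  | succ p =>
    rcases eq_or_ne p q with rfl | h
    · exact Or.inr (Or.inl rfl)
    · obtain ⟨p', hp'⟩ := Fin.exists_succAbove_eq h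
      exact Or.inr (Or.inr ⟨p', by rw [omitPair_apply, hp']⟩)

/-- The pairing of `Fin (k + 2)` that pairs `0` with `q + 1` and is `ρ` on the other points. -/
def consPair {k : ℕ} (q : Fin (k + 1)) (ρ : Equiv.Perm (Fin k)) : Equiv.Perm (Fin (k + 2)) :=
  Equiv.swap 0 q.succ * ρ.viaFintypeEmbedding (omitPair q)

theorem consPair_zero {k : ℕ} (q : Fin (k + 1)) (ρ : Equiv.Perm (Fin k)) :
    consPair q ρ 0 = q.succ := by
  rw [consPair, Equiv.Perm.mul_apply,
    Equiv.Perm.viaFintypeEmbedding_apply_notMem_range _ _ (zero_notMem_range_omitPair q),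
    Equiv.swap_apply_left]

theorem consPair_succ {k : ℕ} (q : Fin (k + 1)) (ρ : Equiv.Perm (Fin k)) :
    consPair q ρ q.succ = 0 := by
  rw [consPair, Equiv.Perm.mul_apply,
    Equiv.Perm.viaFintypeEmbedding_apply_notMem_range _ _ (succ_notMem_range_omitPair q),
    Equiv.swap_apply_right]

theorem consPair_omitPair {k : ℕ} (q : Fin (k + 1)) (ρ : Equiv.Perm (Fin k)) (p : Fin k) :
    consPair q ρ (omitPair q p) = omitPair q (ρ p) := by
  rw [consPair, Equiv.Perm.mul_apply, Equiv.Perm.viaFintypeEmbedding_apply_image]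
  exact Equiv.swap_apply_of_ne_of_ne
    (fun h => zero_notMem_range_omitPair q ⟨_, h⟩) (fun h => succ_notMem_range_omitPair q ⟨_, h⟩)

theorem mem_pairPartitions {k : ℕ} {ρ : Equiv.Perm (Fin k)} :
    ρ ∈ pairPartitions k ↔ ∀ p, ρ (ρ p) = p ∧ ρ p ≠ p := by
  simp [pairPartitions]

theorem consPair_mem {k : ℕ} (q : Fin (k + 1)) {ρ : Equiv.Perm (Fin k)}
    (hρ : ρ ∈ pairPartitions k) : consPair q ρ ∈ pairPartitions (k + 2) := by
  rw [mem_pairPartitions] at hρ ⊢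
  intro p
  rcases eq_or_mem_range_omitPair q p with rfl | rfl | ⟨p, rfl⟩
  · rw [consPair_zero, consPair_succ]
    exact ⟨rfl, Fin.succ_ne_zero q⟩
  · rw [consPair_succ, consPair_zero]
    exact ⟨rfl, (Fin.succ_ne_zero q).symm⟩
  · rw [consPair_omitPair, consPair_omitPair, (hρ p).1]
    exact ⟨rfl, fun h => (hρ p).2 ((omitPair q).injective h)⟩

/-- The partner of `0` is some `q + 1`; as an involution, `ρ` then preserves the remaining points
and restricts to a pairing of them. -/
theorem exists_consPair_eq {k : ℕ} {ρ : Equiv.Perm (Fin (k + 2))}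
    (hρ : ρ ∈ pairPartitions (k + 2)) : ∃ q, ∃ ρ' ∈ pairPartitions k, consPair q ρ' = ρ := by
  rw [mem_pairPartitions] at hρ
  obtain ⟨q, hq⟩ := Fin.exists_succ_eq.mpr (hρ 0).2
  have hq' : ρ q.succ = 0 := by rw [hq, (hρ 0).1]
  have hex : ∀ p : Fin k, ∃ p', omitPair q p' = ρ (omitPair q p) := by
    intro p
    rcases eq_or_mem_range_omitPair q (ρ (omitPair q p)) with h | h | h
    · rw [← hq'] at h
      exact absurd ⟨p, ρ.injective h⟩ (succ_notMem_range_omitPair q)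
    · rw [hq] at h
      exact absurd ⟨p, ρ.injective h⟩ (zero_notMem_range_omitPair q)
    · exact h
  choose r hr using hex
  have hinv : Function.Involutive r := by
    intro p
    apply (omitPair q).injective
    rw [hr, hr, (hρ _).1]
  refine ⟨q, hinv.toPerm r, ?_, ?_⟩
  · rw [mem_pairPartitions]
    intro p
    rw [Function.Involutive.coe_toPerm]
    refine ⟨hinv p, fun h => (hρ (omitPair q p)).2 ?_⟩
    rw [← hr, h]
  · ext1 p
    rcases eq_or_mem_range_omitPair q p with rfl | rfl | ⟨p, rfl⟩
    · rw [consPair_zero, hq]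
    · rw [consPair_succ, hq']
    · rw [consPair_omitPair, Function.Involutive.coe_toPerm, hr]

/-- The sum over the pair-partitions of the products of the covariances. -/
noncomputable def pairingSum {α : Type*} (K : α → α → ℂ) {k : ℕ} (i : Fin k → α) : ℂ :=
  ∑ ρ ∈ pairPartitions k, ∏ p ∈ Finset.univ.filter (fun p => p < ρ p), K (i p) (i (ρ p))

theorem pairingSum_zero {α : Type*} (K : α → α → ℂ) (i : Fin 0 → α) : pairingSum K i = 1 := by
  have : pairPartitions 0 = {1} := by
    ext ρ
    simp [mem_pairPartitions, Subsingleton.elim ρ 1]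
  simp [pairingSum, this]

theorem pairingSum_one {α : Type*} (K : α → α → ℂ) (i : Fin 1 → α) : pairingSum K i = 0 := by
  have : pairPartitions 1 = ∅ := by
    ext ρ
    simp only [mem_pairPartitions, Finset.notMem_empty, iff_false]
    intro h
    exact (h 0).2 (Subsingleton.elim _ _)
  simp [pairingSum, this]

/-- The pairings are sorted by the partner `q + 1` of the point `0`. -/
theorem pairingSum_add_two {α : Type*} (K : α → α → ℂ) {k : ℕ} (i : Fin (k + 2) → α) :
    pairingSum K i = ∑ q : Fin (k + 1),
      K (i 0) (i q.succ) * pairingSum K (fun p => i (q.succAbove p).succ) := by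
  simp only [pairingSum, Finset.mul_sum]
  rw [Finset.sum_sigma' Finset.univ (fun _ => pairPartitions k)]
  symm
  refine Finset.sum_bij (fun x _ => consPair x.1 x.2) ?_ ?_ ?_ ?_
  · rintro ⟨q, ρ⟩ h
    exact consPair_mem q (Finset.mem_sigma.mp h).2
  · rintro ⟨q, ρ⟩ _ ⟨q', ρ'⟩ _ h
    have hq : q = q' := by
      apply Fin.succ_injective
      rw [← consPair_zero q ρ, ← consPair_zero q' ρ']
      exact congrArg (fun e : Equiv.Perm (Fin (k + 2)) => e 0) h
    subst hq
    congr 1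
    ext1 p
    apply (omitPair q).injective
    rw [← consPair_omitPair, ← consPair_omitPair]
    exact congrArg (fun e : Equiv.Perm (Fin (k + 2)) => e (omitPair q p)) h
  · intro ρ hρ
    obtain ⟨q, ρ', h, h'⟩ := exists_consPair_eq hρ
    exact ⟨⟨q, ρ'⟩, by simpa using h, h'⟩
  · rintro ⟨q, ρ⟩ _
    rw [Finset.prod_filter, Finset.prod_filter, Fin.prod_univ_succ, Fin.prod_univ_succAbove _ q]
    have h0 : consPair q ρ 0 = q.succ := consPair_zero q ρ
    -- The pair `{0, q + 1}` is listed at `0` and not at `q + 1`, so its covariance occurs once.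
    rw [h0, if_pos (Fin.succ_pos q), consPair_succ, if_neg (not_lt.mpr (Fin.zero_le _)), one_mul]
    congr 1
    refine Finset.prod_congr rfl fun p _ => ?_
    rw [← omitPair_apply, consPair_omitPair]
    simp only [omitPair_lt]
    rfl

/-! ### Pairing sums as Wick functionals -/

namespace WordFun

theorem letter_mul_ofFn {α : Type*} (c : α → ℂ) (f : WordFun α) {k : ℕ} (j : Fin (k + 1) → α) :
    (letter c * f) (List.ofFn j) =
      ∑ q, c (j q) * f (List.ofFn fun p : Fin k => j (q.succAbove p)) := by
  induction k generalizing f with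
  | zero => simp [letter_mul_cons]
  | succ k ih =>
    rw [Fin.sum_univ_succ, List.ofFn_succ, letter_mul_cons, ih]
    refine congrArg₂ (· + ·) ?_ (Finset.sum_congr rfl fun q _ => ?_)
    · simp only [Fin.succAbove_zero]
    rw [List.ofFn_succ, deriv_apply]
    simp

/-- The derivative by `x` puts `x` in front; summing over the partner of `x` is the same as
shuffling with `letter (K x)`. -/
theorem isWick_pairingSum {α : Type*} {K : α → α → ℂ} {f : WordFun α}
    (h : ∀ (k : ℕ) (i : Fin k → α), f (List.ofFn i) = pairingSum K i) : IsWick K f where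
  nil := by simpa [pairingSum_zero] using h 0 Fin.elim0
  deriv x := by
    ext l
    obtain ⟨k, i, rfl⟩ : ∃ (k : ℕ) (i : Fin k → α), l = List.ofFn i :=
      ⟨_, l.get, (List.ofFn_get l).symm⟩
    have hx : deriv x f (List.ofFn i) = pairingSum K (Fin.cons x i : Fin (k + 1) → α) := by
      rw [deriv_apply, ← h, List.ofFn_succ]
      simp
    rw [hx]
    cases k with
    | zero => simp [pairingSum_one]
    | succ k =>
      rw [pairingSum_add_two, letter_mul_ofFn]
      simp [h]

theorem exists_isWick {α : Type*} (K : α → α → ℂ) : ∃ f : WordFun α, IsWick K f := by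
  refine ⟨⟨fun l => pairingSum K l.get⟩, isWick_pairingSum fun k i => ?_⟩
  -- The length of `List.ofFn i` is only propositionally `k`; generalizing the list allows `k` to be
  -- eliminated.
  have : ∀ (l : List α) (hl : l.length = k), (∀ p : Fin k, l.get (Fin.cast hl.symm p) = i p) →
      pairingSum K l.get = pairingSum K i := by
    rintro l rfl h
    exact congrArg _ (funext h)
  exact this _ (List.length_ofFn) fun p => by simp

end WordFun

namespace WordFun

/-! ### Words in commuting independent subalgebras -/

section Independent

theorem map_eq_ofFn_get {α β : Type*} (l : List α) (f : α → β) :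
    l.map f = List.ofFn fun i => f (l.get i) := by
  conv_lhs => rw [← List.ofFn_get l]
  rw [List.map_ofFn]
  rfl

variable {A : Type*} [Ring A] [StarRing A] [Algebra ℂ A] [StarModule ℂ A] {Λ : Type*}
  {φ : A →ₗ[ℂ] ℂ} {B : Λ → StarSubalgebra ℂ A}

theorem _root_.StarCLT.IsCommutingIndependent.factor_list (h : IsCommutingIndependent φ B)
    {ps : List (Λ × A)} (hps : (ps.map Prod.fst).Nodup) (hB : ∀ p ∈ ps, p.2 ∈ B p.1) :
    φ (ps.map Prod.snd).prod = (ps.map fun p => φ p.2).prod := by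
  have hl : Function.Injective fun i => (ps.get i).1 := by
    rw [← List.nodup_ofFn]
    convert hps
    conv_rhs => rw [← List.ofFn_get ps]
    rw [List.map_ofFn]
    rfl
  rw [map_eq_ofFn_get ps Prod.snd, h.factor ps.length _ hl (fun i => (ps.get i).2)
    fun i => hB _ (List.get_mem _ _), ← List.prod_ofFn, map_eq_ofFn_get ps]

/-- The span of the products `x₁ ⋯ x_k` with `x_i` in the `i`-th subalgebra of the list `L`. -/
def productSpan (B : Λ → StarSubalgebra ℂ A) (L : List Λ) : Submodule ℂ A :=
  Submodule.span ℂ {a | ∃ ps : List (Λ × A), ps.map Prod.fst = L ∧ (∀ p ∈ ps, p.2 ∈ B p.1) ∧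
    a = (ps.map Prod.snd).prod}

theorem mul_mem_productSpan {c : Λ} {L : List Λ} {u v : A} (hu : u ∈ B c)
    (hv : v ∈ productSpan B L) : u * v ∈ productSpan B (c :: L) := by
  induction hv using Submodule.span_induction with
  | mem v hv =>
    obtain ⟨ps, rfl, hB, rfl⟩ := hv
    refine Submodule.subset_span ⟨(c, u) :: ps, rfl, ?_, by simp⟩
    rintro p hp
    rcases List.mem_cons.mp hp with rfl | hp
    · exact hu
    · exact hB p hp
  | zero => simp
  | add x y _ _ hx hy => rw [mul_add]; exact Submodule.add_mem _ hx hy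
  | smul a x _ hx => rw [mul_smul_comm]; exact Submodule.smul_mem _ _ hx

/-- Independence factorizes single products, whereas words in a sum over the other subalgebras are
linear combinations of such products; both sides are linear in `v`. -/
theorem map_mul_of_mem_productSpan (h : IsCommutingIndependent φ B) {c : Λ} {L : List Λ}
    (hL : (c :: L).Nodup) {u v : A} (hu : u ∈ B c) (hv : v ∈ productSpan B L) :
    φ (u * v) = φ u * φ v := by
  induction hv using Submodule.span_induction with
  | mem v hv =>
    obtain ⟨ps, rfl, hB, rfl⟩ := hv
    have h1 := h.factor_list (ps := ps) (List.nodup_cons.mp hL).2 hB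
    have h2 := h.factor_list (ps := (c, u) :: ps) hL (by
      rintro p hp
      rcases List.mem_cons.mp hp with rfl | hp
      · exact hu
      · exact hB p hp)
    simp only [List.map_cons, List.prod_cons] at h2
    rw [h2, h1]
  | zero => simp
  | add x y _ _ hx hy => rw [mul_add, map_add, hx, hy, map_add, mul_add]
  | smul a x _ hx => rw [mul_smul_comm, map_smul, hx, map_smul, smul_eq_mul, smul_eq_mul]; ring

variable {α : Type*} {y : Λ → α → A}

theorem word_mem (hy : ∀ c x, y c x ∈ B c) (c : Λ) (l : List α) : (l.map (y c)).prod ∈ B c := by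
  refine list_prod_mem fun a ha => ?_
  obtain ⟨x, _, rfl⟩ := List.mem_map.mp ha
  exact hy c x

theorem commute_of_ne (h : IsCommutingIndependent φ B) (hy : ∀ c x, y c x ∈ B c) {c : Λ}
    {L : List Λ} (hL : c ∉ L) (a b : α) : Commute (y c a) ((L.map y).sum b) := by
  induction L with
  | nil => simp
  | cons e L ih =>
    rw [List.mem_cons, not_or] at hL
    rw [List.map_cons, List.sum_cons, Pi.add_apply]
    exact Commute.add_right (h.commute c e hL.1 _ (hy c a) _ (hy e b)) (ih hL.2)

theorem word_sum_mem (h : IsCommutingIndependent φ B) (hy : ∀ c x, y c x ∈ B c) {L : List Λ}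
    (hL : L.Nodup) (l : List α) : (l.map (L.map y).sum).prod ∈ productSpan B L := by
  induction L generalizing l with
  | nil =>
    have h1 : (1 : A) ∈ productSpan B [] := Submodule.subset_span ⟨[], rfl, by simp, by simp⟩
    rcases l with _ | ⟨x, l⟩
    · simpa using h1
    -- The empty sum of families is `0`, so every nonempty word in it vanishes.
    · simp
  | cons c L ih =>
    have hL' := List.nodup_cons.mp hL
    rw [List.map_cons, List.sum_cons]
    have key : ∀ l u v : List α, (u.map (y c)).prod * (v.map (L.map y).sum).prod *
        (l.map (y c + (L.map y).sum)).prod ∈ productSpan B (c :: L) := by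
      intro l
      induction l with
      | nil =>
        intro u v
        simpa using mul_mem_productSpan (word_mem hy c u) (ih hL'.2 v)
      | cons x l ihl =>
        intro u v
        have hcx : Commute (y c x) (v.map (L.map y).sum).prod := by
          refine Commute.list_prod_right _ _ fun b hb => ?_
          obtain ⟨b, _, rfl⟩ := List.mem_map.mp hb
          exact commute_of_ne h hy hL'.1 x b
        have := Submodule.add_mem _ (ihl (u ++ [x]) v) (ihl u (v ++ [x]))
        convert this using 1
        simp only [List.map_append, List.prod_append, List.map_cons, List.map_nil, List.prod_cons,
          List.prod_nil, mul_one, Pi.add_apply]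
        rw [mul_assoc (u.map (y c)).prod (y c x), hcx.eq]
        noncomm_ring
    simpa using key l [] []

theorem ofWord_list_sum (h : IsCommutingIndependent φ B) (h1 : φ 1 = 1)
    (hy : ∀ c x, y c x ∈ B c) {L : List Λ} (hL : L.Nodup) :
    ofWord φ (L.map y).sum = (L.map fun c => ofWord φ (y c)).prod := by
  induction L with
  | nil =>
    ext l
    rcases l with _ | ⟨x, l⟩
    · simp [ofWord, h1]
    · have : (1 : WordFun α) (x :: l) = 0 := rfl
      simp [ofWord, this]
  | cons c L ih =>
    have hL' := List.nodup_cons.mp hL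
    rw [List.map_cons, List.sum_cons, List.map_cons, List.prod_cons, ← ih hL'.2]
    exact ofWord_add (fun a b => commute_of_ne h hy hL'.1 a b) fun l l' =>
      map_mul_of_mem_productSpan h hL (word_mem hy c l) (word_sum_mem h hy hL'.2 l')

theorem ofWord_sum [Fintype Λ] (h : IsCommutingIndependent φ B) (h1 : φ 1 = 1)
    (hy : ∀ c x, y c x ∈ B c) : ofWord φ (∑ c, y c) = ∏ c, ofWord φ (y c) := by
  have := ofWord_list_sum h h1 hy (Finset.nodup_toList Finset.univ)
  rwa [Finset.sum_map_toList, Finset.prod_map_toList] at this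

end Independent

/-! ### Words in creation and annihilation operators -/

section CCR

/-- Wick's theorem in abstract form. By `hε` the first operator `L z` may be replaced by `D z`;
moving `D z` to the right, where it kills `v₀`, leaves one term `K z z'` for each letter `z'` that
it passes. -/
theorem isWick_of_commutator {α V : Type*} [AddCommGroup V] [Module ℂ V] {K : α → α → ℂ}
    {v₀ : V} {ε : V →ₗ[ℂ] ℂ} {L D : α → Module.End ℂ V} (h0 : ε v₀ = 1) (hD : ∀ z, D z v₀ = 0)
    (hc : ∀ z z' v, D z (L z' v) = L z' (D z v) + K z z' • v)
    (hε : ∀ z v, ε (L z v) = ε (D z v)) :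
    IsWick K ⟨fun l => ε ((l.map L).prod v₀)⟩ where
  nil := h0
  deriv z := by
    have key : ∀ (l : List α) (q : Module.End ℂ V),
        (letter (K z) * (⟨fun l => ε (q ((l.map L).prod v₀))⟩ : WordFun α)) l =
          ε (q (D z ((l.map L).prod v₀))) := by
      intro l
      induction l with
      | nil => intro q; simp [hD]
      | cons z' l ih =>
        intro q
        rw [letter_mul_cons]
        refine (congrArg _ (ih (q * L z'))).trans ?_
        simp only [List.map_cons, List.prod_cons, Module.End.mul_apply, hc, map_add, map_smul,
          smul_eq_mul]
        ring
    ext l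
    refine Eq.trans ?_ (key l 1).symm
    simp [deriv, hε]

open MvPolynomial

variable {A : Type*} [Ring A] [Algebra ℂ A]

/-- The linear map that sends `X₀ ^ p * X₁ ^ q` to `a ^ p * b ^ q`. -/
noncomputable def normalOrder (a b : A) : MvPolynomial Bool ℂ →ₗ[ℂ] A :=
  (basisMonomials Bool ℂ).constr ℂ fun m => a ^ m false * b ^ m true

theorem normalOrder_monomial (a b : A) (m : Bool →₀ ℕ) (r : ℂ) :
    normalOrder a b (monomial m r) = r • (a ^ m false * b ^ m true) := by
  have : monomial m r = r • basisMonomials Bool ℂ m := by simp [smul_monomial]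
  rw [this, map_smul, normalOrder, Module.Basis.constr_basis]

theorem normalOrder_X_false (a b : A) (p : MvPolynomial Bool ℂ) :
    normalOrder a b (X false * p) = a * normalOrder a b p := by
  induction p using MvPolynomial.induction_on' with
  | monomial m r =>
    rw [X, monomial_mul, normalOrder_monomial, normalOrder_monomial]
    simp [pow_add, mul_assoc]
  | add p q hp hq => rw [mul_add, map_add, hp, hq, map_add, mul_add]

theorem mul_pow_of_commutator {a b : A} {c : ℂ} (h : b * a = a * b + algebraMap ℂ A c) (n : ℕ) :
    b * a ^ n = a ^ n * b + (c * n) • a ^ (n - 1) := by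
  induction n with
  | zero => simp
  | succ n ih =>
    rw [pow_succ, ← mul_assoc, ih, add_mul, mul_assoc, h, mul_add, ← mul_assoc, smul_mul_assoc,
      ← pow_succ, Algebra.algebraMap_eq_smul_one, mul_smul_comm, mul_one, add_assoc, ← pow_succ]
    rcases n with _ | n
    · simp
    · rw [Nat.add_sub_cancel, Nat.add_sub_cancel, ← add_smul]
      push_cast
      congr 2
      ring

/-- Moving `b` past the powers of `a` produces the commutator `c` once for each factor `a`: in
normal order, left multiplication by `b` is `X₁ + c ∂₀`. -/
theorem normalOrder_X_true {a b : A} {c : ℂ} (h : b * a = a * b + algebraMap ℂ A c)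
    (p : MvPolynomial Bool ℂ) :
    normalOrder a b (X true * p + c • pderiv false p) = b * normalOrder a b p := by
  induction p using MvPolynomial.induction_on' with
  | monomial m r =>
    rw [X, monomial_mul, pderiv_monomial, map_add, map_smul, normalOrder_monomial,
      normalOrder_monomial, normalOrder_monomial, mul_smul_comm, ← mul_assoc b,
      mul_pow_of_commutator h, add_mul, smul_add]
    congr 1
    · simp [pow_add, mul_assoc]
    · simp [smul_smul]
      congr 1
      ring
  | add p q hp hq =>
    rw [mul_add, map_add (pderiv (R := ℂ) false), smul_add, add_add_add_comm, map_add, hp, hq, map_add, mul_add]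

theorem pderiv_pderiv_comm {σ : Type*} (i j : σ) (p : MvPolynomial σ ℂ) :
    pderiv i (pderiv j p) = pderiv j (pderiv i p) := by
  classical
  have : ⁅pderiv (R := ℂ) i, pderiv (R := ℂ) j⁆ = 0 := by
    refine MvPolynomial.derivation_ext fun k => ?_
    rw [Derivation.commutator_apply, pderiv_X, pderiv_X]
    simp [Pi.single_apply, apply_ite]
  have h := congrArg (fun D => D p) this
  rwa [Derivation.commutator_apply, Derivation.zero_apply, sub_eq_zero] at h

variable {φ : A →ₗ[ℂ] ℂ} {a b : A} {ω : ℂ}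

/-- On monomials both sides vanish unless the degrees match, and then the identity is `(p + 1)! = (p
+ 1) * p!`. The companion lemma does the same for the other variable. -/
theorem normalOrder_contract_false
    (hm : ∀ p q : ℕ, φ (a ^ p * b ^ q) = if p = q then (p.factorial : ℂ) * ω ^ p else 0)
    (p : MvPolynomial Bool ℂ) :
    φ (normalOrder a b (X false * p)) = ω * φ (normalOrder a b (pderiv true p)) := by
  induction p using MvPolynomial.induction_on' with
  | monomial m r =>
    rw [X, monomial_mul, pderiv_monomial, normalOrder_monomial, normalOrder_monomial, map_smul,
      map_smul, hm, hm]
    simp only [Finsupp.add_apply, Finsupp.single_apply, Finsupp.tsub_apply]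
    simp only [reduceCtorEq, if_true, if_false, zero_add, Nat.sub_zero, smul_eq_mul, one_mul]
    rcases hq : m true with _ | q
    · simp
    · simp only [Nat.add_sub_cancel]
      by_cases hpq : m false = q
      · subst hpq
        rw [if_pos (add_comm _ _), if_pos rfl, add_comm 1, Nat.factorial_succ]
        push_cast
        ring
      · rw [if_neg (by omega), if_neg hpq]
        simp
  | add p q hp hq =>
    rw [mul_add, map_add, map_add, hp, hq, map_add, map_add, map_add, mul_add]

theorem normalOrder_contract_true
    (hm : ∀ p q : ℕ, φ (a ^ p * b ^ q) = if p = q then (p.factorial : ℂ) * ω ^ p else 0)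
    (p : MvPolynomial Bool ℂ) :
    φ (normalOrder a b (X true * p)) = ω * φ (normalOrder a b (pderiv false p)) := by
  induction p using MvPolynomial.induction_on' with
  | monomial m r =>
    rw [X, monomial_mul, pderiv_monomial, normalOrder_monomial, normalOrder_monomial, map_smul,
      map_smul, hm, hm]
    simp only [Finsupp.add_apply, Finsupp.single_apply, Finsupp.tsub_apply]
    simp only [reduceCtorEq, if_true, if_false, zero_add, Nat.sub_zero, smul_eq_mul, one_mul]
    rcases hq : m false with _ | q
    · rw [if_neg (by omega)]
      simp
    · simp only [Nat.add_sub_cancel]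
      by_cases hpq : m true = q
      · subst hpq
        rw [if_pos (add_comm _ _), if_pos rfl, Nat.factorial_succ]
        push_cast
        ring
      · rw [if_neg (by omega), if_neg (Ne.symm hpq)]
        simp
  | add p q hp hq =>
    rw [mul_add, map_add, map_add, hp, hq, map_add, map_add, map_add, mul_add]

/-- The covariance of the letters `x` and `x'`, with the order of the factors taken into account. -/
noncomputable def ccrCov {α : Type*} [DecidableEq α] (x x' : α) (ω₁ ω₂ : ℂ) (z z' : α) : ℂ :=
  if z = x ∧ z' = x' then ω₁ else if z = x' ∧ z' = x then ω₂ else 0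

/-- The algebra generated by `a` and `b` is replaced by polynomials in two commuting variables
through normal ordering. There the commutators of `D` with `L` are scalars, so
`isWick_of_commutator` applies. -/
theorem isWick_ccr {α : Type*} [DecidableEq α] {x x' : α} (hx : x ≠ x') {c : ℂ} (h1 : φ 1 = 1)
    (hc : b * a = a * b + algebraMap ℂ A c)
    (hm : ∀ p q : ℕ, φ (a ^ p * b ^ q) = if p = q then (p.factorial : ℂ) * ω ^ p else 0) :
    IsWick (ccrCov x x' ω (ω + c)) (ofWord φ fun z => if z = x then a else if z = x' then b else 0)
    := by
  let L : α → Module.End ℂ (MvPolynomial Bool ℂ) := fun z =>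
    if z = x then LinearMap.mulLeft ℂ (X false) else
    if z = x' then LinearMap.mulLeft ℂ (X true) + c • (pderiv false).toLinearMap else 0
  -- `D z` contracts `z` with a later letter. The coefficients are `φ(ab) = ω` and `φ(ba) = ω + c`;
  -- the extra `c` comes from the derivative in `L x'`.
  let D : α → Module.End ℂ (MvPolynomial Bool ℂ) := fun z =>
    if z = x then ω • (pderiv true).toLinearMap else
    if z = x' then (ω + c) • (pderiv false).toLinearMap else 0
  have hη : ∀ z p, normalOrder a b (L z p) =
      (if z = x then a else if z = x' then b else 0) * normalOrder a b p := by
    intro z p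
    simp only [L]
    split_ifs
    · exact normalOrder_X_false a b p
    · exact normalOrder_X_true hc p
    · simp
  have hw := isWick_of_commutator (K := ccrCov x x' ω (ω + c)) (v₀ := (1 : MvPolynomial Bool ℂ))
    (ε := φ ∘ₗ normalOrder a b) (L := L) (D := D) ?_ ?_ ?_ ?_
  · convert hw using 1
    ext l
    change _ = φ (normalOrder a b _)
    have : ∀ l : List α, normalOrder a b ((l.map L).prod 1) =
        (l.map fun z => if z = x then a else if z = x' then b else 0).prod := by
      intro l
      induction l with
      | nil => simpa using normalOrder_monomial a b 0 1
      | cons z l ih =>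
        rw [List.map_cons, List.prod_cons, Module.End.mul_apply, hη, ih, List.map_cons,
          List.prod_cons]
    rw [this]
    rfl
  · have : normalOrder a b 1 = 1 := by simpa using normalOrder_monomial a b 0 1
    simp [this, h1]
  · intro z
    simp only [D]
    split_ifs <;> simp
  · intro z z' v
    have hx' := hx.symm
    simp only [D, L, ccrCov]
    by_cases hz : z = x
    · subst hz
      by_cases hz' : z' = z
      · subst hz'
        simp [hx, pderiv_X]
      · by_cases hz'' : z' = x'
        · subst hz''
          simp [hz', pderiv_X, pderiv_pderiv_comm true false v]
          abel
        · simp [hz', hz'']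
    · by_cases hz2 : z = x'
      · subst hz2
        by_cases hz' : z' = x
        · subst hz'
          simp [hx', pderiv_X]
        · by_cases hz'' : z' = z
          · subst hz''
            simp [hz', pderiv_X, smul_smul]
          · simp [hz', hz'', hz]
      · simp [hz, hz2]
  · intro z p
    simp only [D, L, LinearMap.comp_apply]
    split_ifs
    · simpa using normalOrder_contract_false hm p
    · have := normalOrder_contract_true hm p
      simp [this]
      ring
    · simp

end CCR

/-! ### Words in the entries of a traceless CCR-GUE matrix -/

/-- The covariance of the entries at the positions `x` and `y` of a traceless CCR-GUE matrix. -/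
noncomputable def gueCov {d : ℕ} (w : Weights d) (x y : Fin d × Fin d) : ℂ :=
  (if x.1 = y.2 ∧ x.2 = y.1 then (w.wt x.2 : ℂ) else 0) -
    (if x.1 = x.2 ∧ y.1 = y.2 then (w.wt x.1 : ℂ) * w.wt y.1 else 0)

/-- The covariance of the diagonal entries of a traceless CCR-GUE matrix. -/
noncomputable def diagCov {d : ℕ} (w : Weights d) (x y : Fin d × Fin d) : ℂ :=
  if x.1 = x.2 ∧ y.1 = y.2 then
    (if x.1 = y.1 then (w.wt x.1 : ℂ) else 0) - (w.wt x.1 : ℂ) * w.wt y.1 else 0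

/-- An off-diagonal position belongs to exactly one of the subalgebras indexed by `i < j`, either as
`(i, j)` or as `(j, i)`; a diagonal one belongs to none. -/
theorem sum_of_lt {d : ℕ} {β : Type*} [AddCommMonoid β] (p : Fin d × Fin d)
    (f : Fin d × Fin d → β) (h1 : ∀ q, q.1 < q.2 → q ≠ p → q ≠ p.swap → f q = 0) :
    ∑ q : {q : Fin d × Fin d // q.1 < q.2}, f q =
      if p.1 < p.2 then f p else if p.2 < p.1 then f p.swap else 0 := by
  split_ifs with h h'
  · refine Finset.sum_eq_single (⟨p, h⟩ : {q : Fin d × Fin d // q.1 < q.2})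
      (fun q _ hq => h1 q q.2 (fun e => hq (Subtype.ext e)) fun e => ?_) (by simp)
    have := q.2
    rw [e] at this
    exact lt_asymm h this
  · refine Finset.sum_eq_single (⟨p.swap, h'⟩ : {q : Fin d × Fin d // q.1 < q.2})
      (fun q _ hq => h1 q q.2 (fun e => ?_) (fun e => hq (Subtype.ext e))) (by simp)
    have := q.2
    rw [e] at this
    exact h this
  · refine Finset.sum_eq_zero fun q _ => h1 q q.2 (fun e => ?_) (fun e => ?_)
    · have := q.2
      rw [e] at this
      exact h this
    · have := q.2
      rw [e] at this
      exact h' this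

theorem gueCov_eq {d : ℕ} (w : Weights d) : gueCov w = diagCov w +
    ∑ q : {q : Fin d × Fin d // q.1 < q.2},
      ccrCov q.1 q.1.swap (w.wt q.1.2 : ℂ) (w.wt q.1.1 : ℂ) := by
  ext x y
  rw [Pi.add_apply, Pi.add_apply, Finset.sum_apply, Finset.sum_apply]
  rw [sum_of_lt x (fun q => ccrCov q q.swap (w.wt q.2 : ℂ) (w.wt q.1 : ℂ) x y)]
  · obtain ⟨i, j⟩ := x
    obtain ⟨k, l⟩ := y
    simp only [gueCov, diagCov, ccrCov, Prod.swap_prod_mk, Prod.mk.injEq]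
    rcases lt_trichotomy i j with h | rfl | h
    · have h' := h.ne
      simp [h, h', h'.symm, eq_comm, and_comm]
    · by_cases hk : k = l
      · subst hk
        by_cases hik : i = k <;> simp [hik]
      · simp [hk]
        rintro rfl
        exact fun h => absurd h.symm hk
    · have h' := h.ne
      simp [h, h', h'.symm, h.not_gt, eq_comm, and_comm]
  · intro q _ h1 h2
    have h3 : x ≠ q.swap := fun e => h2 (by rw [e, Prod.swap_swap])
    simp [ccrCov, h1.symm, h3]

theorem isWick_ofWord_of_isTracelessCCRGUE {A : Type*} [Ring A] [StarRing A] [Algebra ℂ A]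
    [StarModule ℂ A] {d : ℕ} {w : Weights d} {φ : A →ₗ[ℂ] ℂ} (h1 : φ 1 = 1)
    {M : Matrix (Fin d) (Fin d) A} (hM : IsTracelessCCRGUE w φ M) :
    IsWick (gueCov w) (ofWord φ fun p => M p.1 p.2) := by
  obtain ⟨B, hB, hoff, -, hdiag, hgauss⟩ := hM
  -- `y c` is the part of `M` that lies in the subalgebra `c`, with zeros at the other positions, so
  -- that `M` is a sum of independent commuting families over the same alphabet.
  let y : Option {p : Fin d × Fin d // p.1 < p.2} → Fin d × Fin d → A := fun c =>
    c.casesOn (fun x => if x.1 = x.2 then M x.1 x.2 else 0) fun q x =>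
      if x = q.1 then M q.1.1 q.1.2 else if x = q.1.swap then star (M q.1.1 q.1.2) else 0
  have hy : ∀ c x, y c x ∈ B c := by
    rintro (_ | q) x
    · simp only [y]
      split_ifs with h
      · rw [← h]
        exact (hdiag x.1).1
      · exact zero_mem _
    · simp only [y]
      split_ifs
      · exact (hoff q.1.1 q.1.2 q.2).1
      · exact star_mem (hoff q.1.1 q.1.2 q.2).1
      · exact zero_mem _
  have hsum : ∑ c, y c = fun p => M p.1 p.2 := by
    ext x
    rw [Finset.sum_apply, Fintype.sum_option]
    have := sum_of_lt x (fun q => if x = q then M q.1 q.2 else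
      if x = q.swap then star (M q.1 q.2) else 0) (by
        intro q _ h1 h2
        have h3 : x ≠ q.swap := fun e => h2 (by rw [e, Prod.swap_swap])
        simp [h1.symm, h3])
    refine (congrArg _ this).trans ?_
    simp only [y]
    rcases lt_trichotomy x.1 x.2 with h | h | h
    · simp [h, h.ne]
    · simp [h]
    · have hne : x ≠ x.swap := fun e => h.ne' (congrArg Prod.fst e)
      simp [h, h.ne', h.not_gt, hne, (hoff x.2 x.1 h).2.2]
  have hcov : gueCov w = ∑ c : Option {p : Fin d × Fin d // p.1 < p.2}, (c.casesOn (diagCov w)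
      fun q => ccrCov q.1 q.1.swap (w.wt q.1.2 : ℂ) (w.wt q.1.1 : ℂ) :
        Fin d × Fin d → Fin d × Fin d → ℂ) := by
    rw [gueCov_eq, Fintype.sum_option]
  rw [← hsum, ofWord_sum hB h1 hy, hcov]
  refine IsWick.prod _ ?_
  rintro (_ | q) -
  · refine isWick_pairingSum fun k i => ?_
    by_cases hi : ∀ p, (i p).1 = (i p).2
    · have := hgauss k fun p => (i p).1
      have e : (List.ofFn i).map (y none) = List.ofFn fun p => M (i p).1 (i p).1 := by
        rw [List.map_ofFn]
        congr 1
        ext p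
        simp [y, hi p]
      change φ ((List.ofFn i).map (y none)).prod = _
      rw [e, this, pairingSum]
      push_cast
      refine Finset.sum_congr rfl fun ρ _ => Finset.prod_congr rfl fun p _ => ?_
      simp only [Matrix.of_apply, diagCov, hi]
      split_ifs with h <;> simp_all
      ring
    · push Not at hi
      obtain ⟨p, hp⟩ := hi
      have e : ((List.ofFn i).map (y none)).prod = 0 := by
        refine List.prod_eq_zero ?_
        rw [List.map_ofFn, List.mem_ofFn]
        exact ⟨p, by simp [y, hp]⟩
      change φ ((List.ofFn i).map (y none)).prod = _
      rw [e, map_zero, pairingSum]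
      -- The pair that contains the off-diagonal letter `p` has covariance `0`; it is listed at the
      -- smaller of `p` and `ρ p`.
      refine (Finset.sum_eq_zero fun ρ hρ => ?_).symm
      rw [mem_pairPartitions] at hρ
      rcases lt_or_gt_of_ne (hρ p).2 with h | h
      · exact Finset.prod_eq_zero (i := ρ p) (by simp [(hρ p).1, h])
          (by simp [diagCov, (hρ p).1, hp])
      · exact Finset.prod_eq_zero (i := p) (by simp [h]) (by simp [diagCov, hp])
  · obtain ⟨⟨i, j⟩, hij⟩ := q
    obtain ⟨-, hc, -⟩ := hoff i j hij
    have hne : ((i, j) : Fin d × Fin d) ≠ (j, i) := fun e => hij.ne (congrArg Prod.fst e)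
    have := isWick_ccr (φ := φ) (ω := (w.wt j : ℂ)) hne h1 hc.commutation (fun p q => by
      rw [hc.moment]
      split_ifs <;> simp)
    have e : (w.wt j : ℂ) + ((w.wt i - w.wt j : ℝ) : ℂ) = w.wt i := by
      push_cast
      ring
    rw [e] at this
    exact this

end WordFun

/-! ### The representation and the averages of the star transpositions -/

section Representation

open Filter Topology

variable {d : ℕ} (w : Weights d)

theorem GNS.ext_inner {x y : GNS w} (h : ∀ σ, inner ℂ (hat w σ) x = inner ℂ (hat w σ) y) :
    x = y := by
  refine (dense_span_hat w).eq_of_inner_right ℂ fun v hv => ?_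
  induction hv using Submodule.span_induction with
  | mem v hv =>
    obtain ⟨σ, rfl⟩ := hv
    exact h σ
  | zero => simp
  | add u v _ _ hu hv => rw [inner_add_left, inner_add_left, hu, hv]
  | smul a v _ hv => rw [inner_smul_left, inner_smul_left, hv]

theorem GNS.ext_hat {S T : GNS w →L[ℂ] GNS w} (h : ∀ σ, S (hat w σ) = T (hat w σ)) : S = T := by
  refine ContinuousLinearMap.ext_on (dense_span_hat w) ?_
  rintro _ ⟨σ, rfl⟩
  exact h σ

theorem U_mul (σ τ : SInf) : U w (σ * τ) = U w σ * U w τ :=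
  GNS.ext_hat w fun ρ => by
    rw [mul_apply_eq_comp, U_hat, U_hat, U_hat, mul_assoc]

theorem U_one : U w 1 = 1 :=
  GNS.ext_hat w fun ρ => by rw [U_hat, one_mul, one_apply_eq_self]

theorem adjoint_U (σ : SInf) : ContinuousLinearMap.adjoint (U w σ) = U w σ⁻¹ :=
  GNS.ext_hat w fun τ => GNS.ext_inner w fun ρ => by
    rw [ContinuousLinearMap.adjoint_inner_right, U_hat, U_hat, inner_hat, inner_hat, mul_inv_rev,
      mul_assoc]

theorem norm_U_apply (σ : SInf) (x : GNS w) : ‖U w σ x‖ = ‖x‖ := by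
  have h : inner ℂ (U w σ x) (U w σ x) = inner ℂ x x := by
    rw [← ContinuousLinearMap.adjoint_inner_right, adjoint_U, ← mul_apply_eq_comp,
      ← U_mul, inv_mul_cancel, U_one, one_apply_eq_self]
  rw [@norm_eq_sqrt_re_inner ℂ, h, ← @norm_eq_sqrt_re_inner ℂ]

theorem starTransposition_inv (n : ℕ) : (starTransposition n)⁻¹ = starTransposition n :=
  Subtype.ext (Equiv.swap_inv 0 n)

theorem starTransposition_mul_self (n : ℕ) : starTransposition n * starTransposition n = 1 :=
  Subtype.ext (Equiv.swap_mul_self 0 n)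

theorem character_one : character w 1 = 1 := by
  have : nontrivialOrbits ((1 : SInf) : Equiv.Perm ℕ) = ∅ := by
    ext V
    simp only [nontrivialOrbits, Set.mem_ofPred_eq, Set.mem_empty_iff_false, iff_false, not_and,
      not_le]
    rintro ⟨x, rfl⟩
    have : {y | Equiv.Perm.SameCycle ((1 : SInf) : Equiv.Perm ℕ) x y} = {x} := by
      ext y
      simp [eq_comm]
    rw [this, Set.ncard_singleton]
    norm_num
  rw [character, this, finprod_mem_empty]

/-- Conjugation by `τ` carries the orbits of `σ` to their images under `τ`, of the same size. The
reverse inclusion is the first one applied to `τ⁻¹`. -/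
theorem character_conj (σ τ : SInf) : character w (τ * σ * τ⁻¹) = character w σ := by
  have himg : ∀ σ τ : SInf, nontrivialOrbits ((τ * σ * τ⁻¹ : SInf) : Equiv.Perm ℕ) =
      (fun V => (τ : Equiv.Perm ℕ) '' V) '' nontrivialOrbits (σ : Equiv.Perm ℕ) := by
    have hsub : ∀ σ τ : SInf, (fun V => (τ : Equiv.Perm ℕ) '' V) ''
        nontrivialOrbits (σ : Equiv.Perm ℕ) ⊆
        nontrivialOrbits ((τ * σ * τ⁻¹ : SInf) : Equiv.Perm ℕ) := by
      rintro σ τ _ ⟨_, ⟨⟨x, rfl⟩, h2⟩, rfl⟩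
      refine ⟨⟨(τ : Equiv.Perm ℕ) x, ?_⟩, ?_⟩
      · ext y
        have hτ : (τ : Equiv.Perm ℕ)⁻¹ ((τ : Equiv.Perm ℕ) x) = x := Equiv.symm_apply_apply _ _
        simp only [Subgroup.coe_mul, Subgroup.coe_inv, Equiv.Perm.sameCycle_conj, Set.mem_image,
          Set.mem_ofPred_eq, hτ]
        constructor
        · rintro ⟨z, hz, rfl⟩
          rwa [show (τ : Equiv.Perm ℕ)⁻¹ ((τ : Equiv.Perm ℕ) z) = z from Equiv.symm_apply_apply _ _]
        · intro h
          exact ⟨_, h, Equiv.apply_symm_apply _ _⟩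
      · rwa [Set.ncard_image_of_injective _ (τ : Equiv.Perm ℕ).injective]
    intro σ τ
    refine Set.Subset.antisymm ?_ (hsub σ τ)
    intro V hV
    have := hsub (τ * σ * τ⁻¹) τ⁻¹ ⟨V, hV, rfl⟩
    refine ⟨_, by simpa [mul_assoc] using this, ?_⟩
    change (τ : Equiv.Perm ℕ) '' ((τ : Equiv.Perm ℕ).symm '' V) = V
    rw [Set.image_image]
    simp
  rw [character, himg, finprod_mem_image]
  · refine finprod_mem_congr rfl fun V _ => ?_
    rw [Set.ncard_image_of_injective _ (τ : Equiv.Perm ℕ).injective]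
  · exact (Set.image_injective.mpr (τ : Equiv.Perm ℕ).injective).injOn

theorem starTransposition_conj (τ : SInf) (h0 : (τ : Equiv.Perm ℕ) 0 = 0) (n : ℕ) :
    τ * starTransposition n * τ⁻¹ = starTransposition ((τ : Equiv.Perm ℕ) n) := by
  apply Subtype.ext
  have := Equiv.swap_apply_apply (τ : Equiv.Perm ℕ) 0 n
  rw [h0] at this
  exact this.symm

theorem exists_perm_moving {i j : ℕ} (hi : 1 ≤ i) (hj : 1 ≤ j) (hij : i ≠ j) :
    ∃ τ : SInf, (τ : Equiv.Perm ℕ) 0 = 0 ∧ (τ : Equiv.Perm ℕ) 1 = i ∧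
      (τ : Equiv.Perm ℕ) 2 = j := by
  have hfin : ∀ a b : ℕ, Equiv.swap a b ∈ SInf := by
    intro a b
    refine (Set.toFinite {a, b}).subset ?_
    intro x hx
    by_contra h
    simp only [Set.mem_insert_iff, Set.mem_singleton_iff, not_or] at h
    exact hx (Equiv.swap_apply_of_ne_of_ne h.1 h.2)
  -- After `1` has been sent to `i`, the point `2` sits at `k`; swapping `k` with `j` then corrects
  -- it without moving `0` or `i`.
  set k := Equiv.swap 1 i 2 with hk
  have hk0 : k ≠ 0 := by
    intro h
    rw [hk, Equiv.swap_apply_eq_iff, Equiv.swap_apply_of_ne_of_ne (by omega) (by omega)] at h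
    omega
  have hki : k ≠ i := by
    intro h
    rw [hk, Equiv.swap_apply_eq_iff, Equiv.swap_apply_right] at h
    omega
  refine ⟨⟨Equiv.swap k j, hfin _ _⟩ * ⟨Equiv.swap 1 i, hfin _ _⟩, ?_, ?_, ?_⟩
  · simp only [Subgroup.coe_mul, Equiv.Perm.mul_apply]
    rw [Equiv.swap_apply_of_ne_of_ne (a := 1) (by omega) (by omega),
      Equiv.swap_apply_of_ne_of_ne (by omega) (by omega)]
  · simp only [Subgroup.coe_mul, Equiv.Perm.mul_apply]
    rw [Equiv.swap_apply_left, Equiv.swap_apply_of_ne_of_ne hki.symm hij]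
  · simp only [Subgroup.coe_mul, Equiv.Perm.mul_apply]
    rw [← hk, Equiv.swap_apply_left]

/-- All products of two distinct star transpositions are conjugate, so the Gram matrix of the
vectors `U(γ_i) σ̂` is constant off the diagonal. -/
theorem character_conj_star_mul_star (σ : SInf) {i j : ℕ} (hi : 1 ≤ i) (hj : 1 ≤ j)
    (hij : i ≠ j) : character w (σ⁻¹ * (starTransposition i * starTransposition j) * σ) =
      character w (starTransposition 1 * starTransposition 2) := by
  obtain ⟨τ, h0, h1, h2⟩ := exists_perm_moving hi hj hij
  have := character_conj w (starTransposition 1 * starTransposition 2) (σ⁻¹ * τ)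
  rw [← this]
  congr 1
  rw [← h1, ← h2, ← starTransposition_conj τ h0, ← starTransposition_conj τ h0]
  group

/-- The averages `(U(γ₁) + ⋯ + U(γ_n)) / n`. -/
noncomputable def starAverage (n : ℕ) : GNS w →L[ℂ] GNS w :=
  ((1 / (n : ℝ) : ℝ) : ℂ) • ∑ i ∈ Finset.Icc 1 n, U w (starTransposition i)

theorem starAverage_apply (n : ℕ) (x : GNS w) : starAverage w n x =
    ((1 / (n : ℝ) : ℝ) : ℂ) • ∑ i ∈ Finset.Icc 1 n, U w (starTransposition i) x := by
  simp [starAverage]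

theorem norm_starAverage_apply_le (n : ℕ) (x : GNS w) : ‖starAverage w n x‖ ≤ ‖x‖ := by
  rw [starAverage_apply, norm_smul]
  have h : ‖∑ i ∈ Finset.Icc 1 n, U w (starTransposition i) x‖ ≤ n * ‖x‖ := by
    refine (norm_sum_le_of_le _ fun i _ => (norm_U_apply w _ x).le).trans ?_
    simp
  rcases Nat.eq_zero_or_pos n with rfl | hn
  · simp
  · have hn' : (0 : ℝ) < n := by exact_mod_cast hn
    rw [Complex.norm_real, Real.norm_of_nonneg (by positivity)]
    calc 1 / (n : ℝ) * _ ≤ 1 / (n : ℝ) * (n * ‖x‖) := by gcongr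
      _ = ‖x‖ := by field_simp

theorem inner_starAverage_hat (σ : SInf) {n m : ℕ} (hn : 0 < n) (hnm : n ≤ m) :
    inner ℂ (starAverage w n (hat w σ)) (starAverage w m (hat w σ)) =
      ((character w (starTransposition 1 * starTransposition 2) +
        (1 - character w (starTransposition 1 * starTransposition 2)) / m : ℝ) : ℂ) := by
  -- The inner products are `1` on the diagonal and `c` off it; as `n ≤ m`, each `i` meets exactly
  -- one `j = i`.
  set c := character w (starTransposition 1 * starTransposition 2) with hc
  have hterm : ∀ i ∈ Finset.Icc 1 n, ∑ j ∈ Finset.Icc 1 m,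
      inner ℂ (U w (starTransposition i) (hat w σ)) (U w (starTransposition j) (hat w σ)) =
        ((m * c + (1 - c) : ℝ) : ℂ) := by
    intro i hi
    rw [Finset.mem_Icc] at hi
    have : ∀ j ∈ Finset.Icc 1 m,
        inner ℂ (U w (starTransposition i) (hat w σ)) (U w (starTransposition j) (hat w σ)) =
          ((c + if i = j then 1 - c else 0 : ℝ) : ℂ) := by
      intro j hj
      rw [Finset.mem_Icc] at hj
      rw [U_hat, U_hat, inner_hat, mul_inv_rev, starTransposition_inv]
      congr 1
      by_cases hij : i = j
      · subst hij
        have : σ⁻¹ * starTransposition i * (starTransposition i * σ) = 1 := by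
          rw [mul_assoc, ← mul_assoc (starTransposition i), starTransposition_mul_self, one_mul,
            inv_mul_cancel]
        rw [this, character_one, if_pos rfl]
        ring
      · have := character_conj_star_mul_star w σ hi.1 hj.1 hij
        rw [if_neg hij, add_zero, hc, ← this]
        simp only [mul_assoc]
    rw [Finset.sum_congr rfl this, ← Complex.ofReal_sum, Finset.sum_add_distrib,
      Finset.sum_ite_eq, if_pos (Finset.mem_Icc.mpr ⟨hi.1, hi.2.trans hnm⟩)]
    simp
  rw [starAverage_apply, starAverage_apply, inner_smul_left, inner_smul_right, sum_inner]
  simp only [inner_sum]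
  rw [Finset.sum_congr rfl hterm]
  have hn' : (n : ℂ) ≠ 0 := by exact_mod_cast hn.ne'
  have hm' : (m : ℂ) ≠ 0 := by exact_mod_cast (hn.trans_le hnm).ne'
  simp only [Finset.sum_const, Nat.card_Icc, Nat.add_sub_cancel, nsmul_eq_mul,
    Complex.conj_ofReal]
  push_cast
  field_simp

theorem norm_starAverage_sub_sq (σ : SInf) {n m : ℕ} (hn : 0 < n) (hnm : n ≤ m) :
    ‖starAverage w n (hat w σ) - starAverage w m (hat w σ)‖ ^ 2 =
      (1 - character w (starTransposition 1 * starTransposition 2)) * (1 / n - 1 / m) := by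
  have hm := hn.trans_le hnm
  rw [@norm_sub_sq ℂ, @norm_sq_eq_re_inner ℂ, @norm_sq_eq_re_inner ℂ,
    inner_starAverage_hat w σ hn le_rfl, inner_starAverage_hat w σ hn hnm,
    inner_starAverage_hat w σ hm le_rfl]
  simp only [RCLike.re_to_complex, Complex.ofReal_re]
  ring

theorem cauchySeq_starAverage_hat (σ : SInf) :
    CauchySeq fun n => starAverage w n (hat w σ) := by
  set C := |1 - character w (starTransposition 1 * starTransposition 2)|
  have hb : ∀ N n m : ℕ, 0 < N → N ≤ n → n ≤ m →
      ‖starAverage w n (hat w σ) - starAverage w m (hat w σ)‖ ^ 2 ≤ C * (1 / N) := by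
    intro N n m hN hn hm
    rw [norm_starAverage_sub_sq w σ (hN.trans_le hn) hm]
    have hN' : (0 : ℝ) < N := by exact_mod_cast hN
    have h1 : (1 : ℝ) / n ≤ 1 / N := one_div_le_one_div_of_le hN' (by exact_mod_cast hn)
    have h2 : (1 : ℝ) / m ≤ 1 / n := one_div_le_one_div_of_le
      (by exact_mod_cast hN.trans_le hn) (by exact_mod_cast hm)
    have h3 : (0 : ℝ) ≤ 1 / m := by positivity
    exact mul_le_mul (le_abs_self _) (by linarith) (by linarith) (abs_nonneg _)
  have hlim : Tendsto (fun N : ℕ => √(C * (1 / (N : ℝ)))) atTop (𝓝 0) := by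
    have := (tendsto_one_div_atTop_nhds_zero_nat (𝕜 := ℝ)).const_mul C
    rw [mul_zero] at this
    have h0 := (Real.continuous_sqrt.tendsto 0).comp this
    rwa [Real.sqrt_zero] at h0
  rw [Metric.cauchySeq_iff]
  intro ε hε
  obtain ⟨N, hN, hN0⟩ := ((hlim.eventually_lt_const hε).and (eventually_gt_atTop 0)).exists
  refine ⟨N, fun n hn m hm => lt_of_le_of_lt ?_ hN⟩
  refine Real.le_sqrt_of_sq_le ?_
  rcases le_total n m with h | h
  · rw [dist_eq_norm]
    exact hb N n m hN0 hn h
  · rw [dist_comm, dist_eq_norm]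
    exact hb N m n hN0 hm h

/-- The averages are contractions, so the Cauchy property passes from the dense span of the `σ̂` to
all vectors. -/
theorem cauchySeq_starAverage (x : GNS w) : CauchySeq fun n => starAverage w n x := by
  have hspan : ∀ y ∈ Submodule.span ℂ (Set.range (hat w)), CauchySeq fun n => starAverage w n y := by
    intro y hy
    induction hy using Submodule.span_induction with
    | mem v hv =>
      obtain ⟨σ, rfl⟩ := hv
      exact cauchySeq_starAverage_hat w σ
    | zero => simpa using cauchySeq_const (0 : GNS w)
    | add u v _ _ hu hv =>
      simp only [map_add]
      exact hu.add hv
    | smul a v _ hv =>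
      simp only [map_smul]
      exact (uniformContinuous_const_smul a).comp_cauchySeq hv
  rw [Metric.cauchySeq_iff]
  intro ε hε
  obtain ⟨y, hy, hxy⟩ := Metric.dense_iff.mp (dense_span_hat w) x (ε / 3) (by positivity)
  rw [Metric.mem_ball, dist_comm] at hy
  obtain ⟨N, hN⟩ := Metric.cauchySeq_iff.mp (hspan y hxy) (ε / 3) (by positivity)
  refine ⟨N, fun n hn m hm => ?_⟩
  have hb : ∀ k, dist (starAverage w k x) (starAverage w k y) ≤ dist x y := by
    intro k
    rw [dist_eq_norm, ← map_sub, dist_eq_norm]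
    exact norm_starAverage_apply_le w k _
  have h1 := dist_triangle4_right (starAverage w n x) (starAverage w m x) (starAverage w n y)
    (starAverage w m y)
  linarith [hb n, hb m, hN n hn m hm]

theorem exists_isAverageLimit : ∃ A₀, IsAverageLimit w A₀ := by
  choose f hf using fun x => cauchySeq_tendsto_of_complete (cauchySeq_starAverage w x)
  -- Banach–Steinhaus: a pointwise limit of bounded operators is bounded.
  refine ⟨continuousLinearMapOfTendsto (starAverage w) (tendsto_pi_nhds.mpr hf), fun x => ?_⟩
  simp only [← starAverage_apply]
  exact hf x

variable {w}

theorem IsAverageLimit.tendsto {A₀ : GNS w →L[ℂ] GNS w} (h : IsAverageLimit w A₀) (x : GNS w) :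
    Tendsto (fun n => starAverage w n x) atTop (𝓝 (A₀ x)) := by
  simpa only [starAverage_apply] using h x

theorem IsAverageLimit.unique {A₀ A₁ : GNS w →L[ℂ] GNS w} (h : IsAverageLimit w A₀)
    (h' : IsAverageLimit w A₁) : A₀ = A₁ :=
  ContinuousLinearMap.ext fun x => tendsto_nhds_unique (h x) (h' x)

theorem isSelfAdjoint_U_starTransposition (n : ℕ) : IsSelfAdjoint (U w (starTransposition n)) := by
  rw [ContinuousLinearMap.isSelfAdjoint_iff', adjoint_U, starTransposition_inv]

theorem isSelfAdjoint_starAverage (n : ℕ) : IsSelfAdjoint (starAverage w n) := by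
  refine IsSelfAdjoint.smul (by simp [isSelfAdjoint_iff]) ?_
  exact isSelfAdjoint_sum _ fun i _ => isSelfAdjoint_U_starTransposition i

theorem IsAverageLimit.isSelfAdjoint {A₀ : GNS w →L[ℂ] GNS w} (h : IsAverageLimit w A₀) :
    IsSelfAdjoint A₀ := by
  rw [ContinuousLinearMap.isSelfAdjoint_iff_isSymmetric]
  intro x y
  refine tendsto_nhds_unique ((h.tendsto x).inner tendsto_const_nhds)
    ((tendsto_const_nhds.inner (h.tendsto y)).congr fun n => ?_)
  have := (isSelfAdjoint_starAverage (w := w) n)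
  rw [ContinuousLinearMap.isSelfAdjoint_iff_isSymmetric] at this
  exact (this x y).symm

theorem IsAverageLimit.isSelfAdjoint_rescaledSum {A₀ : GNS w →L[ℂ] GNS w}
    (h : IsAverageLimit w A₀) (n : ℕ) : IsSelfAdjoint (rescaledSum w A₀ n) := by
  refine IsSelfAdjoint.smul (by simp [isSelfAdjoint_iff]) ?_
  exact isSelfAdjoint_sum _ fun i _ => (isSelfAdjoint_U_starTransposition i).sub h.isSelfAdjoint

theorem norm_hat_one : ‖hat w 1‖ = 1 := by
  rw [@norm_eq_sqrt_re_inner ℂ, inner_hat, inv_one, mul_one, character_one]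
  simp

end Representation

/-! ### A tensor product model -/

section Model

open Filter Topology

variable {d : ℕ} (w : Weights d)

theorem weightedTrace_apply {A : Type*} [Ring A] [Algebra ℂ A] (φ : A →ₗ[ℂ] ℂ)
    (X : Matrix (Fin d) (Fin d) A) : weightedTrace w φ X = ∑ i, (w.wt i : ℂ) * φ (X i i) := rfl

/-- The state `E ↦ ∑ w_c E_cc` on the matrices. -/
noncomputable abbrev siteState : Matrix (Fin d) (Fin d) ℂ →ₗ[ℂ] ℂ := weightedTrace w LinearMap.id

theorem siteState_apply (E : Matrix (Fin d) (Fin d) ℂ) :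
    siteState w E = ∑ c, (w.wt c : ℂ) * E c c := rfl

theorem siteState_one : siteState w 1 = 1 := by
  simp only [siteState_apply, Matrix.one_apply_eq, mul_one]
  exact_mod_cast w.sum_eq_one

/-- Formal linear combinations of pure tensors of matrices, with a factor for each site in `ℕ`. -/
abbrev TensorAlg (d : ℕ) : Type := MonoidAlgebra ℂ (ℕ → Matrix (Fin d) (Fin d) ℂ)

/-- The pure tensor with the factors `y s`. -/
noncomputable def pureTensor (y : ℕ → Matrix (Fin d) (Fin d) ℂ) : TensorAlg d :=
  MonoidAlgebra.of ℂ _ y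

theorem pureTensor_mul (y z : ℕ → Matrix (Fin d) (Fin d) ℂ) :
    pureTensor (y * z) = pureTensor y * pureTensor z := map_mul _ _ _

theorem pureTensor_one : pureTensor (1 : ℕ → Matrix (Fin d) (Fin d) ℂ) = 1 := map_one _

/-- The linear map on `TensorAlg d` with given values at the pure tensors. -/
noncomputable def tensorLift (f : (ℕ → Matrix (Fin d) (Fin d) ℂ) → ℂ) : TensorAlg d →ₗ[ℂ] ℂ :=
  Finsupp.linearCombination ℂ f ∘ₗ (MonoidAlgebra.coeffLinearEquiv ℂ).toLinearMap

theorem tensorLift_pureTensor (f : (ℕ → Matrix (Fin d) (Fin d) ℂ) → ℂ)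
    (y : ℕ → Matrix (Fin d) (Fin d) ℂ) : tensorLift f (pureTensor y) = f y := by
  simp [tensorLift, pureTensor]

theorem tensorAlg_linearMap_ext {V : Type*} [AddCommMonoid V] [Module ℂ V]
    {f g : TensorAlg d →ₗ[ℂ] V} (h : ∀ y, f (pureTensor y) = g (pureTensor y)) : f = g := by
  refine MonoidAlgebra.lhom_ext' fun y => LinearMap.ext_ring ?_
  exact h y

/-- The product state. -/
noncomputable def tensorState : TensorAlg d →ₗ[ℂ] ℂ :=
  tensorLift fun y => ∏ᶠ s, siteState w (y s)

theorem tensorState_pureTensor (y : ℕ → Matrix (Fin d) (Fin d) ℂ) :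
    tensorState w (pureTensor y) = ∏ᶠ s, siteState w (y s) := tensorLift_pureTensor _ _

/-- The pure tensors that are trivial outside of a finite subset of `S`. -/
def localTensors (d : ℕ) (S : Set ℕ) : Submonoid (ℕ → Matrix (Fin d) (Fin d) ℂ) where
  carrier := {y | (Function.mulSupport y).Finite ∧ Function.mulSupport y ⊆ S}
  one_mem' := by simp [Function.mulSupport_one]
  mul_mem' := by
    rintro y z ⟨hy, hy'⟩ ⟨hz, hz'⟩
    have := Function.mulSupport_mul y z
    exact ⟨(hy.union hz).subset this, this.trans (Set.union_subset hy' hz')⟩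

theorem mulSingle_mem_localTensors {S : Set ℕ} {s : ℕ} (hs : s ∈ S)
    (E : Matrix (Fin d) (Fin d) ℂ) : Pi.mulSingle s E ∈ localTensors d S :=
  ⟨(Set.finite_singleton s).subset Pi.mulSupport_mulSingle_subset,
    Pi.mulSupport_mulSingle_subset.trans (Set.singleton_subset_iff.mpr hs)⟩

theorem eq_one_of_mem_localTensors {S : Set ℕ} {y : ℕ → Matrix (Fin d) (Fin d) ℂ}
    (hy : y ∈ localTensors d S) {s : ℕ} (hs : s ∉ S) : y s = 1 := by
  by_contra h
  exact hs (hy.2 h)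

/-- The subalgebra that is spanned by the pure tensors localized in `S`. -/
noncomputable def localAlg (d : ℕ) (S : Set ℕ) : Subalgebra ℂ (TensorAlg d) :=
  (Submodule.span ℂ (pureTensor '' (localTensors d S : Set _))).toSubalgebra
    (Submodule.subset_span ⟨1, one_mem _, pureTensor_one⟩) (by
      intro x z hx hz
      have h := Submodule.mul_mem_mul hx hz
      rw [Submodule.span_mul_span] at h
      refine Submodule.span_mono ?_ h
      rintro _ ⟨_, ⟨y, hy, rfl⟩, _, ⟨y', hy', rfl⟩, rfl⟩
      exact ⟨y * y', mul_mem hy hy', pureTensor_mul y y'⟩)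

theorem localAlg_induction {S : Set ℕ} {p : TensorAlg d → Prop} {x : TensorAlg d}
    (hx : x ∈ localAlg d S) (hp : ∀ y ∈ localTensors d S, p (pureTensor y)) (h0 : p 0)
    (hadd : ∀ x z, p x → p z → p (x + z)) (hsmul : ∀ (c : ℂ) x, p x → p (c • x)) : p x := by
  rw [localAlg, Submodule.mem_toSubalgebra] at hx
  refine Submodule.span_induction (p := fun x _ => p x) ?_ h0 (fun x z _ _ => hadd x z)
    (fun c x _ => hsmul c x) hx
  rintro _ ⟨y, hy, rfl⟩
  exact hp y hy

theorem pureTensor_mem {S : Set ℕ} {y : ℕ → Matrix (Fin d) (Fin d) ℂ}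
    (hy : y ∈ localTensors d S) : pureTensor y ∈ localAlg d S :=
  Submodule.subset_span ⟨y, hy, rfl⟩

theorem commute_of_disjoint {S T : Set ℕ} (h : Disjoint S T) {x z : TensorAlg d}
    (hx : x ∈ localAlg d S) (hz : z ∈ localAlg d T) : Commute x z := by
  refine localAlg_induction (p := fun x => Commute x z) hx (fun y hy => ?_) (Commute.zero_left z)
    (fun _ _ => Commute.add_left) fun c _ hx => hx.smul_left c
  refine localAlg_induction (p := fun z => Commute _ z) hz (fun y' hy' => ?_) (Commute.zero_right _)
    (fun _ _ => Commute.add_right) fun c _ hx => hx.smul_right c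
  rw [commute_iff_eq, ← pureTensor_mul, ← pureTensor_mul]
  congr 1
  ext1 s
  rw [Pi.mul_apply, Pi.mul_apply]
  by_cases hs : s ∈ S
  · rw [eq_one_of_mem_localTensors hy' (Set.disjoint_left.mp h hs), mul_one, one_mul]
  · rw [eq_one_of_mem_localTensors hy hs, mul_one, one_mul]

theorem finite_mulSupport_siteState {S : Set ℕ} {y : ℕ → Matrix (Fin d) (Fin d) ℂ}
    (hy : y ∈ localTensors d S) : (Function.mulSupport fun s => siteState w (y s)).Finite := by
  refine hy.1.subset fun s hs h => hs ?_
  simp only [h, siteState_one]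

/-- On pure tensors at most one of the two factors is nontrivial at each site, and `siteState` is
`1` at the trivial ones. -/
theorem tensorState_mul_of_disjoint {S T : Set ℕ} (h : Disjoint S T) {x z : TensorAlg d}
    (hx : x ∈ localAlg d S) (hz : z ∈ localAlg d T) :
    tensorState w (x * z) = tensorState w x * tensorState w z := by
  refine localAlg_induction (p := fun x => tensorState w (x * z) = _ * _) hx (fun y hy => ?_)
    (by simp) (fun x x' hx hx' => by rw [add_mul, map_add, map_add, hx, hx', add_mul])
    fun c x hx => by rw [smul_mul_assoc, map_smul, map_smul, hx, smul_mul_assoc]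
  refine localAlg_induction (p := fun z => tensorState w (_ * z) = _ * tensorState w z) hz
    (fun y' hy' => ?_)
    (by simp) (fun x x' hx hx' => by rw [mul_add, map_add, map_add, hx, hx', mul_add])
    fun c x hx => by rw [mul_smul_comm, map_smul, map_smul, hx, mul_smul_comm]
  rw [← pureTensor_mul, tensorState_pureTensor, tensorState_pureTensor, tensorState_pureTensor,
    ← finprod_mul_distrib (finite_mulSupport_siteState w hy) (finite_mulSupport_siteState w hy')]
  refine finprod_congr fun s => ?_
  rw [Pi.mul_apply]
  by_cases hs : s ∈ S
  · rw [eq_one_of_mem_localTensors hy' (Set.disjoint_left.mp h hs), siteState_one, mul_one, mul_one]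
  · rw [eq_one_of_mem_localTensors hy hs, siteState_one, one_mul, one_mul]

theorem tensorState_mulSingle (s : ℕ) (E : Matrix (Fin d) (Fin d) ℂ) :
    tensorState w (pureTensor (Pi.mulSingle s E)) = siteState w E := by
  rw [tensorState_pureTensor, finprod_eq_single _ s, Pi.mulSingle_eq_same]
  intro t ht
  rw [Pi.mulSingle_eq_of_ne ht, siteState_one]

theorem tensorState_mul_mulSingle_mul {s : ℕ} {x z : TensorAlg d} (hx : x ∈ localAlg d {s}ᶜ)
    (hz : z ∈ localAlg d {s}ᶜ) (E : Matrix (Fin d) (Fin d) ℂ) :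
    tensorState w (x * pureTensor (Pi.mulSingle s E) * z) =
      siteState w E * tensorState w (x * z) := by
  have hE : pureTensor (Pi.mulSingle s E) ∈ localAlg d {s} :=
    pureTensor_mem (mulSingle_mem_localTensors (Set.mem_singleton s) E)
  have hd : Disjoint ({s} : Set ℕ) {s}ᶜ := disjoint_compl_right
  rw [mul_assoc, (commute_of_disjoint hd hE hz).eq, ← mul_assoc,
    tensorState_mul_of_disjoint w hd.symm (mul_mem hx hz) hE, tensorState_mulSingle, mul_comm]

/-- The model of `U(γ_{s+1})`: the flip of the base site and the site `s`. -/
noncomputable def flipMat (d s : ℕ) : Matrix (Fin d) (Fin d) (TensorAlg d) :=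
  Matrix.of fun a b => pureTensor (Pi.mulSingle s (Matrix.single b a 1))

/-- The model of the limit of the averages: the multiplication by the weight at the base site. -/
noncomputable def weightMat : Matrix (Fin d) (Fin d) (TensorAlg d) :=
  Matrix.diagonal fun a => algebraMap ℂ _ (w.wt a : ℂ)

theorem flipMat_mem {S : Set ℕ} {s : ℕ} (hs : s ∈ S) : flipMat d s ∈ (localAlg d S).matrix :=
  fun _ _ => pureTensor_mem (mulSingle_mem_localTensors hs _)

theorem weightMat_mem (S : Set ℕ) : weightMat w ∈ (localAlg d S).matrix := by
  intro a b
  rw [weightMat, Matrix.diagonal_apply]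
  split_ifs
  · exact Subalgebra.algebraMap_mem _ _
  · exact zero_mem _

theorem siteState_single (a b : Fin d) :
    siteState w (Matrix.single b a 1) = if a = b then (w.wt a : ℂ) else 0 := by
  rw [siteState_apply]
  by_cases h : a = b
  · subst h
    simp [Matrix.single_apply]
  · rw [if_neg h]
    refine Finset.sum_eq_zero fun c _ => ?_
    rw [Matrix.single_apply, if_neg (fun hc => h (hc.2.trans hc.1.symm)), mul_zero]

/-- Since `s` occurs nowhere else, its state can be applied first. It sends the entry `E_ba` to
`δ_ab w_a`, which is the entry of `weightMat`; this is why `weightMat` models `A₀`. -/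
theorem weightedTrace_mul_flipMat_mul {s : ℕ} {X Z : Matrix (Fin d) (Fin d) (TensorAlg d)}
    (hX : X ∈ (localAlg d {s}ᶜ).matrix) (hZ : Z ∈ (localAlg d {s}ᶜ).matrix) :
    weightedTrace w (tensorState w) (X * flipMat d s * Z) =
      weightedTrace w (tensorState w) (X * weightMat w * Z) := by
  rw [weightedTrace_apply, weightedTrace_apply]
  refine Finset.sum_congr rfl fun c _ => congrArg _ ?_
  rw [Matrix.mul_apply, Matrix.mul_apply, map_sum, map_sum]
  refine Finset.sum_congr rfl fun b _ => ?_
  rw [weightMat, Matrix.mul_diagonal, Matrix.mul_apply, Finset.sum_mul, map_sum]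
  have : ∀ a, tensorState w (X c a * flipMat d s a b * Z b c) =
      if a = b then (w.wt b : ℂ) * tensorState w (X c b * Z b c) else 0 := by
    intro a
    rw [flipMat, Matrix.of_apply, tensorState_mul_mulSingle_mul w (hX c a) (hZ b c),
      siteState_single]
    split_ifs with h
    · rw [h]
    · rw [zero_mul]
  simp only [this, Finset.sum_ite_eq', Finset.mem_univ, if_true]
  rw [← Algebra.commutes, mul_assoc, ← Algebra.smul_def, map_smul, smul_eq_mul]

/-! ### The character in the model -/

/-- The matrix coefficient of a tensor at the colorings `F` and `G` of the sites. -/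
noncomputable def tensorCoeff (n : ℕ) (F G : ℕ → Fin d) : TensorAlg d →ₗ[ℂ] ℂ :=
  tensorLift fun y => ∏ s ∈ Finset.range n, y s (F (s + 1)) (G (s + 1))

theorem tensorCoeff_pureTensor (n : ℕ) (F G : ℕ → Fin d) (y : ℕ → Matrix (Fin d) (Fin d) ℂ) :
    tensorCoeff n F G (pureTensor y) = ∏ s ∈ Finset.range n, y s (F (s + 1)) (G (s + 1)) :=
  tensorLift_pureTensor _ _

theorem tensorCoeff_congr {n : ℕ} {F F' G : ℕ → Fin d} (h : ∀ s < n, F (s + 1) = F' (s + 1)) :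
    tensorCoeff n F G = tensorCoeff n F' G := by
  refine tensorAlg_linearMap_ext fun y => ?_
  rw [tensorCoeff_pureTensor, tensorCoeff_pureTensor]
  exact Finset.prod_congr rfl fun s hs => by rw [h s (Finset.mem_range.mp hs)]

/-- A matrix unit on the left requires the row colour `b` at its site and replaces it by `a`. -/
theorem tensorCoeff_single_mul {n s : ℕ} (hs : s < n) (F G : ℕ → Fin d) (a b : Fin d)
    (x : TensorAlg d) :
    tensorCoeff n F G (pureTensor (Pi.mulSingle s (Matrix.single b a 1)) * x) =
      if b = F (s + 1) then tensorCoeff n (Function.update F (s + 1) a) G x else 0 := by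
  have : tensorCoeff n F G ∘ₗ
      LinearMap.mulLeft ℂ (pureTensor (Pi.mulSingle s (Matrix.single b a 1))) =
      if b = F (s + 1) then tensorCoeff n (Function.update F (s + 1) a) G else 0 := by
    refine tensorAlg_linearMap_ext fun y => ?_
    rw [LinearMap.comp_apply, LinearMap.mulLeft_apply, ← pureTensor_mul, tensorCoeff_pureTensor]
    have hs' : s ∈ Finset.range n := Finset.mem_range.mpr hs
    rw [← Finset.mul_prod_erase _ _ hs', Pi.mul_apply, Pi.mulSingle_eq_same]
    split_ifs with h
    · rw [tensorCoeff_pureTensor, ← Finset.mul_prod_erase _ _ hs', ← h]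
      congr 1
      · simp
      · refine Finset.prod_congr rfl fun t ht => ?_
        have hts := Finset.ne_of_mem_erase ht
        rw [Pi.mul_apply, Pi.mulSingle_eq_of_ne hts, one_mul,
          Function.update_of_ne (by simpa using hts)]
    · rw [Matrix.single_mul_apply_of_ne _ _ _ _ _ (Ne.symm h), zero_mul, LinearMap.zero_apply]
  have h := congrArg (fun f => f x) this
  simp only [LinearMap.comp_apply, LinearMap.mulLeft_apply] at h
  rw [h]
  split_ifs <;> rfl

/-- The product of the star transpositions `γ_{s+1}` along a list. -/
def starWord (L : List ℕ) : SInf := (L.map fun s => starTransposition (s + 1)).prod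

/-- Each flip exchanges the colours of the base point and of its site, so a word in flips acts on
colourings as the corresponding permutation. Site `s` carries the colour of the point `s + 1`. -/
theorem tensorCoeff_flip_word {n : ℕ} (L : List ℕ) (hL : ∀ s ∈ L, s < n) (F G : ℕ → Fin d) :
    tensorCoeff n F G ((L.map (flipMat d)).prod (F 0) (G 0)) =
      if ∀ x ≤ n, G x = F ((starWord L : Equiv.Perm ℕ) x) then 1 else 0 := by
  induction L generalizing F with
  | nil =>
    rw [List.map_nil, List.prod_nil, Matrix.one_apply]
    have h1 : tensorCoeff n F G 1 = if ∀ s ∈ Finset.range n, F (s + 1) = G (s + 1) then 1 else 0 := by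
      rw [← pureTensor_one, tensorCoeff_pureTensor]
      simp only [Pi.one_apply, Matrix.one_apply]
      rw [Finset.prod_ite_zero]
      simp
    rw [apply_ite (tensorCoeff n F G), h1, map_zero, ← ite_and]
    congr 1
    simp only [starWord, List.map_nil, List.prod_nil, Subgroup.coe_one, Equiv.Perm.one_apply,
      Finset.mem_range, eq_iff_iff]
    constructor
    · rintro ⟨h0, h⟩ (_ | x) hx
      · exact h0.symm
      · exact (h x hx).symm
    · intro h
      exact ⟨(h 0 (Nat.zero_le n)).symm, fun s hs => (h (s + 1) hs).symm⟩
  | cons s L ih =>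
    have hs : s < n := hL s (by simp)
    rw [List.map_cons, List.prod_cons, Matrix.mul_apply, map_sum]
    simp only [flipMat, Matrix.of_apply]
    simp only [tensorCoeff_single_mul hs, Finset.sum_ite_eq', Finset.mem_univ, if_true]
    have h := ih (fun t ht => hL t (by simp [ht]))
      (fun x => F (Equiv.swap 0 (s + 1) x))
    simp only [Equiv.swap_apply_left] at h
    rw [tensorCoeff_congr (F' := fun x => F (Equiv.swap 0 (s + 1) x)), h]
    · rfl
    · intro t _
      by_cases hts : t = s
      · subst hts
        simp
      · rw [Function.update_of_ne (by simpa using hts),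
          Equiv.swap_apply_of_ne_of_ne (by simp) (by simpa using hts)]

/-- Expanding the product of the site states gives a weighted sum of diagonal coefficients. The
colour `e` of the base point is free because `tensorCoeff` does not read it; `Fin.ofNat` only
extends the colouring to `ℕ`. -/
theorem tensorState_eq_sum {n : ℕ} {x : TensorAlg d} (hx : x ∈ localAlg d (Set.Iio n))
    (e : Fin d) : tensorState w x = ∑ f : Fin n → Fin d, (∏ s, (w.wt (f s) : ℂ)) *
      tensorCoeff n (fun k => (Fin.cons e f : Fin (n + 1) → Fin d) (Fin.ofNat (n + 1) k))
        (fun k => (Fin.cons e f : Fin (n + 1) → Fin d) (Fin.ofNat (n + 1) k)) x := by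
  let T : TensorAlg d →ₗ[ℂ] ℂ := ∑ f : Fin n → Fin d, (∏ s, (w.wt (f s) : ℂ)) •
    tensorCoeff n (fun k => (Fin.cons e f : Fin (n + 1) → Fin d) (Fin.ofNat (n + 1) k))
      (fun k => (Fin.cons e f : Fin (n + 1) → Fin d) (Fin.ofNat (n + 1) k))
  suffices tensorState w x = T x by
    rw [this]
    simp [T]
  refine localAlg_induction (p := fun x => tensorState w x = T x) hx ?_
    (by simp) (fun x z h h' => by rw [map_add, map_add, h, h'])
    (fun c x h => by rw [map_smul, map_smul, h])
  intro y hy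
  have hsub : Function.mulSupport (fun s => siteState w (y s)) ⊆ (Finset.range n : Set ℕ) := by
    intro s hs
    by_contra hsn
    refine hs ?_
    have : y s = 1 := eq_one_of_mem_localTensors hy (by simpa using hsn)
    simp only [this, siteState_one]
  rw [tensorState_pureTensor, finprod_eq_prod_of_mulSupport_subset _ hsub, Finset.prod_range]
  simp only [siteState_apply, T, LinearMap.sum_apply, LinearMap.smul_apply, smul_eq_mul,
    tensorCoeff_pureTensor]
  rw [Finset.prod_univ_sum, Fintype.piFinset_univ]
  refine Finset.sum_congr rfl fun f _ => ?_
  rw [Finset.prod_range, ← Finset.prod_mul_distrib]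
  refine Finset.prod_congr rfl fun s _ => ?_
  have : Fin.ofNat (n + 1) ((s : ℕ) + 1) = s.succ := by
    ext
    simp
  rw [this, Fin.cons_succ]

theorem starWord_apply_of_lt {n : ℕ} (L : List ℕ) (hL : ∀ s ∈ L, s < n) (x : ℕ) (hx : n < x) :
    (starWord L : Equiv.Perm ℕ) x = x := by
  induction L with
  | nil => rfl
  | cons s L ih =>
    have hs := hL s (by simp)
    change (starTransposition (s + 1) : Equiv.Perm ℕ) ((starWord L : Equiv.Perm ℕ) x) = x
    rw [ih fun t ht => hL t (by simp [ht])]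
    exact Equiv.swap_apply_of_ne_of_ne (by omega) (by omega)

theorem forall_sameCycle_iff {n : ℕ} {σ : SInf} (hσ : ∀ x, n < x → (σ : Equiv.Perm ℕ) x = x)
    (f : Fin (n + 1) → Fin d) :
    (∀ a b : Fin (n + 1), (σ : Equiv.Perm ℕ).SameCycle a b → f a = f b) ↔
      ∀ x ≤ n, f (Fin.ofNat (n + 1) x) = f (Fin.ofNat (n + 1) ((σ : Equiv.Perm ℕ) x)) := by
  have hle : ∀ x ≤ n, (σ : Equiv.Perm ℕ) x ≤ n := by
    intro x hx
    by_contra h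
    have h1 := (σ : Equiv.Perm ℕ).injective (hσ _ (not_le.mp h))
    omega
  have hval : ∀ x ≤ n, ((Fin.ofNat (n + 1) x : Fin (n + 1)) : ℕ) = x := fun x hx =>
    Nat.mod_eq_of_lt (by omega)
  constructor
  · intro h x hx
    apply h
    rw [hval x hx, hval _ (hle x hx)]
    exact ⟨1, by simp⟩
  · intro h
    have h' : ∀ x, f (Fin.ofNat (n + 1) ((σ : Equiv.Perm ℕ) x)) = f (Fin.ofNat (n + 1) x) := by
      intro x
      rcases le_or_gt x n with hx | hx
      · exact (h x hx).symm
      · rw [hσ x hx]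
    have hz : ∀ (k : ℤ) (x : ℕ), f (Fin.ofNat (n + 1) (((σ : Equiv.Perm ℕ) ^ k) x)) =
        f (Fin.ofNat (n + 1) x) := by
      intro k
      induction k using Int.induction_on with
      | zero => intro x; simp
      | succ k ih =>
        intro x
        rw [zpow_add, Equiv.Perm.mul_apply, ih, zpow_one, h']
      | pred k ih =>
        intro x
        rw [zpow_sub, Equiv.Perm.mul_apply, ih, zpow_one]
        have := h' ((σ : Equiv.Perm ℕ)⁻¹ x)
        rw [show (σ : Equiv.Perm ℕ) ((σ : Equiv.Perm ℕ)⁻¹ x) = x from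
          Equiv.apply_symm_apply _ _] at this
        exact this.symm
    rintro a b ⟨k, hk⟩
    have := hz k a
    rw [hk] at this
    simpa using this.symm

/-- Both sides are weighted counts of the colourings of `{0, …, n}` that are invariant under the
permutation; the trace supplies the colour of the base point. -/
theorem character_starWord (L : List ℕ) : (character w (starWord L) : ℂ) =
    weightedTrace w (tensorState w) (L.map (flipMat d)).prod := by
  obtain ⟨n, hn⟩ : ∃ n, ∀ s ∈ L, s < n := by
    refine ⟨L.sum + 1, fun s hs => ?_⟩
    have := List.single_le_sum (by simp) s hs
    omega
  have hfix := starWord_apply_of_lt L hn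
  have hmem : (L.map (flipMat d)).prod ∈ (localAlg d (Set.Iio n)).matrix := by
    refine list_prod_mem fun X hX => ?_
    obtain ⟨s, hs, rfl⟩ := List.mem_map.mp hX
    exact flipMat_mem (hn s hs)
  rw [character_eq_sum (N := n + 1) w _ fun x hx => hfix x hx]
  simp only [forall_sameCycle_iff hfix]
  rw [← (Fin.consEquiv fun _ => Fin d).sum_comp, Fintype.sum_prod_type]
  push_cast
  refine Finset.sum_congr rfl fun e _ => ?_
  -- The free base colour is taken to be the diagonal index `e`, so that the coefficient matches the
  -- matrix entry.
  rw [tensorState_eq_sum w (hmem e e) e, Finset.mul_sum]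
  refine Finset.sum_congr rfl fun f _ => ?_
  have h := tensorCoeff_flip_word L hn
    (fun k => (Fin.cons e f : Fin (n + 1) → Fin d) (Fin.ofNat (n + 1) k))
    (fun k => (Fin.cons e f : Fin (n + 1) → Fin d) (Fin.ofNat (n + 1) k))
  have h0 : (Fin.ofNat (n + 1) 0 : Fin (n + 1)) = 0 := rfl
  simp only [h0, Fin.cons_zero] at h
  have hc : (Fin.consEquiv fun _ => Fin d) (e, f) = Fin.cons e f := rfl
  rw [h, hc, Fin.prod_univ_succ, apply_ite Complex.ofReal]
  simp only [Fin.cons_zero, Fin.cons_succ]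
  split_ifs <;> simp

end Model

/-! ### Joint moments of the star transpositions and the limit of their averages -/

section JointMoments

open Filter Topology WordFun

variable {d : ℕ} {w : Weights d}

/-- The operators `U(γ_{s+1})`, for the letters `some s`, and `A₀`, for the letter `none`. -/
noncomputable def gnsOp (A₀ : GNS w →L[ℂ] GNS w) : Option ℕ → GNS w →L[ℂ] GNS w
  | some s => U w (starTransposition (s + 1))
  | none => A₀

/-- The models of the operators `gnsOp`. -/
noncomputable def modelOp (w : Weights d) : Option ℕ → Matrix (Fin d) (Fin d) (TensorAlg d)
  | some s => flipMat d s
  | none => weightMat w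

theorem gnsOp_word_some (A₀ : GNS w →L[ℂ] GNS w) (L : List ℕ) :
    ((L.map some).map (gnsOp A₀)).prod = U w (starWord L) := by
  induction L with
  | nil => exact (U_one w).symm
  | cons s L ih =>
    rw [List.map_cons, List.map_cons, List.prod_cons, ih]
    exact (U_mul w _ _).symm

theorem modelOp_word_mem {S : Set ℕ} {l : List (Option ℕ)} (hl : ∀ s, some s ∈ l → s ∈ S) :
    (l.map (modelOp w)).prod ∈ (localAlg d S).matrix := by
  refine list_prod_mem fun X hX => ?_
  obtain ⟨_ | s, hs, rfl⟩ := List.mem_map.mp hX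
  · exact weightMat_mem w S
  · exact flipMat_mem (hl s hs)

theorem tendsto_vectorState_mul_starAverage_mul {A₀ : GNS w →L[ℂ] GNS w}
    (h : IsAverageLimit w A₀) (S T : GNS w →L[ℂ] GNS w) :
    Tendsto (fun n : ℕ => (n : ℝ)⁻¹ • ∑ j ∈ Finset.range n,
      vectorState w (S * U w (starTransposition (j + 1)) * T)) atTop
      (𝓝 (vectorState w (S * A₀ * T))) := by
  have h1 : Tendsto (fun n => vectorState w (S * starAverage w n * T)) atTop
      (𝓝 (vectorState w (S * A₀ * T))) :=
    tendsto_const_nhds.inner ((S.continuous.tendsto _).comp (h.tendsto (T (hat w 1))))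
  refine h1.congr fun n => ?_
  rw [starAverage, Finset.range_eq_Ico, Finset.sum_Ico_add'
    (fun j => vectorState w (S * U w (starTransposition j) * T)) 0 n 1]
  simp only [mul_smul_comm, smul_mul_assoc, map_smul, Finset.mul_sum, Finset.sum_mul, map_sum]
  rw [Complex.real_smul, smul_eq_mul, one_div]
  rfl

/-- Induction on the number of letters `A₀`. Without them this is the character formula; otherwise
one `A₀` is a limit of averages of `U(γ_{j+1})`, and the model value is the same for all `j` that do
not occur in the word. -/
theorem vectorState_word {A₀ : GNS w →L[ℂ] GNS w} (h : IsAverageLimit w A₀)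
    (l : List (Option ℕ)) : vectorState w (l.map (gnsOp A₀)).prod =
      weightedTrace w (tensorState w) (l.map (modelOp w)).prod := by
  induction hm : l.count none generalizing l with
  | zero =>
    obtain ⟨L, rfl⟩ : ∃ L : List ℕ, l = L.map some := by
      have h0 : none ∉ l := List.count_eq_zero.mp hm
      refine ⟨l.reduceOption, ?_⟩
      clear hm
      induction l with
      | nil => rfl
      | cons x l ih =>
        rw [List.mem_cons, not_or] at h0
        cases x with
        | none => exact absurd rfl h0.1
        | some s => rw [List.reduceOption_cons_of_some, List.map_cons, ← ih h0.2]
    rw [gnsOp_word_some]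
    have h2 : (L.map some).map (modelOp w) = L.map (flipMat d) := by
      rw [List.map_map]
      rfl
    rw [h2, ← character_starWord]
    change inner ℂ (hat w 1) (U w (starWord L) (hat w 1)) = _
    rw [U_hat, inner_hat, inv_one, one_mul, mul_one]
  | succ m ih =>
    obtain ⟨u, v, rfl⟩ := List.append_of_mem
      (List.count_pos_iff.mp (by rw [hm]; exact Nat.succ_pos m) : none ∈ l)
    have hcount : ∀ s, (u ++ some s :: v).count none = m := by
      intro s
      simp only [List.count_append, List.count_cons] at hm ⊢
      simp at hm ⊢
      omega
    have hlim := tendsto_vectorState_mul_starAverage_mul h (u.map (gnsOp A₀)).prod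
      (v.map (gnsOp A₀)).prod
    have hword : ∀ (x : Option ℕ), ((u ++ x :: v).map (gnsOp A₀)).prod =
        (u.map (gnsOp A₀)).prod * gnsOp A₀ x * (v.map (gnsOp A₀)).prod := by
      intro x
      simp [mul_assoc]
    have hword' : ∀ (x : Option ℕ), ((u ++ x :: v).map (modelOp w)).prod =
        (u.map (modelOp w)).prod * modelOp w x * (v.map (modelOp w)).prod := by
      intro x
      simp [mul_assoc]
    rw [hword, hword']
    -- The averaged sequence is eventually constant, so its Cesàro means tend to that constant.
    refine tendsto_nhds_unique hlim (Tendsto.cesaro_smul ?_)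
    have hfresh : ∀ᶠ j : ℕ in atTop, some j ∉ u ++ v := by
      have hfin : {j : ℕ | some j ∈ u ++ v}.Finite :=
        (List.finite_toSet (u ++ v)).preimage (Option.some_injective ℕ).injOn
      have := hfin.compl_mem_cofinite
      rw [Nat.cofinite_eq_atTop] at this
      exact this
    refine tendsto_const_nhds.congr' ?_
    filter_upwards [hfresh] with j hj
    rw [List.mem_append, not_or] at hj
    have h1 := ih (u ++ some j :: v) (hcount j)
    rw [hword, hword'] at h1
    refine Eq.trans ?_ h1.symm
    exact (weightedTrace_mul_flipMat_mul w (s := j)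
      (modelOp_word_mem fun s hs hsj => hj.1 ((Set.mem_singleton_iff.mp hsj) ▸ hs))
      (modelOp_word_mem fun s hs hsj => hj.2 ((Set.mem_singleton_iff.mp hsj) ▸ hs))).symm

/-- The sum of the models of `U(γ_{s+1}) - A₀` over the first `n` sites. -/
noncomputable def modelSum (w : Weights d) (n : ℕ) : Matrix (Fin d) (Fin d) (TensorAlg d) :=
  ∑ s ∈ Finset.range n, (flipMat d s - weightMat w)

theorem vectorState_sum_pow {A₀ : GNS w →L[ℂ] GNS w} (h : IsAverageLimit w A₀) (n k : ℕ) :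
    vectorState w ((∑ i ∈ Finset.Icc 1 n, (U w (starTransposition i) - A₀)) ^ k) =
      weightedTrace w (tensorState w) (modelSum w n ^ k) := by
  -- Agreement on words extends by linearity to noncommutative polynomials, in particular to powers
  -- of sums.
  let f : MonoidAlgebra ℂ (FreeMonoid (Option ℕ)) →ₐ[ℂ] (GNS w →L[ℂ] GNS w) :=
    MonoidAlgebra.lift ℂ _ _ (FreeMonoid.lift (gnsOp A₀))
  let g : MonoidAlgebra ℂ (FreeMonoid (Option ℕ)) →ₐ[ℂ] Matrix (Fin d) (Fin d) (TensorAlg d) :=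
    MonoidAlgebra.lift ℂ _ _ (FreeMonoid.lift (modelOp w))
  have hfg : vectorState w ∘ₗ f.toLinearMap =
      weightedTrace w (tensorState w) ∘ₗ g.toLinearMap := by
    refine MonoidAlgebra.lhom_ext' fun l => LinearMap.ext_ring ?_
    have := vectorState_word h l.toList
    simpa [f, g, FreeMonoid.lift_apply] using this
  let x : Option ℕ → MonoidAlgebra ℂ (FreeMonoid (Option ℕ)) := fun t =>
    MonoidAlgebra.of ℂ _ (FreeMonoid.of t)
  have hf : ∀ t, f (x t) = gnsOp A₀ t := fun t => by simp [f, x]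
  have hg : ∀ t, g (x t) = modelOp w t := fun t => by simp [g, x]
  have hF : ∑ i ∈ Finset.Icc 1 n, (U w (starTransposition i) - A₀) =
      f (∑ s ∈ Finset.range n, (x (some s) - x none)) := by
    simp only [map_sum, map_sub, hf]
    rw [Finset.range_eq_Ico]
    exact (Finset.sum_Ico_add' (fun i => U w (starTransposition i) - A₀) 0 n 1).symm
  have hG : modelSum w n = g (∑ s ∈ Finset.range n, (x (some s) - x none)) := by
    simp only [map_sum, map_sub, hg]
    rfl
  rw [hF, hG, ← map_pow, ← map_pow]
  exact congrArg (fun e => e ((∑ s ∈ Finset.range n, (x (some s) - x none)) ^ k)) hfg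

/-! ### The law of a single site -/

/-- The matrices `E_ba - δ_ab w_a` of a single site. -/
noncomputable def siteMat (w : Weights d) (p : Fin d × Fin d) : Matrix (Fin d) (Fin d) ℂ :=
  Matrix.single p.2 p.1 1 - if p.1 = p.2 then (w.wt p.1 : ℂ) • 1 else 0

/-- The joint moments of the matrices of a single site. -/
noncomputable def siteFun (w : Weights d) : WordFun (Fin d × Fin d) :=
  ofWord (siteState w) (siteMat w)

theorem siteFun_nil (w : Weights d) : siteFun w [] = 1 := siteState_one w

theorem siteFun_singleton (w : Weights d) (x : Fin d × Fin d) : siteFun w [x] = 0 := by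
  change siteState w ([siteMat w x].prod) = 0
  rw [List.prod_singleton, siteMat, map_sub, siteState_single]
  split_ifs
  · rw [map_smul, siteState_one, smul_eq_mul, mul_one, sub_self]
  · rw [map_zero, sub_zero]

theorem siteFun_pair (w : Weights d) (x y : Fin d × Fin d) : siteFun w [x, y] = gueCov w x y := by
  obtain ⟨i, j⟩ := x
  obtain ⟨k, l⟩ := y
  change siteState w ([siteMat w (i, j), siteMat w (k, l)].prod) = _
  have h1 : siteState w (Matrix.single j i 1 * Matrix.single l k 1) =
      if i = l ∧ j = k then (w.wt j : ℂ) else 0 := by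
    by_cases hil : i = l
    · subst hil
      rw [Matrix.single_mul_single_same, mul_one, siteState_single]
      by_cases hjk : j = k
      · subst hjk
        simp
      · simp [hjk, Ne.symm hjk]
    · rw [Matrix.single_mul_single_of_ne _ _ _ _ hil, map_zero, if_neg (fun h => hil h.1)]
  simp only [List.prod_cons, List.prod_nil, mul_one, siteMat, gueCov, sub_mul, mul_sub, map_sub, h1]
  by_cases hij : i = j <;> by_cases hkl : k = l
  · subst hij hkl
    simp only [if_true, and_self, smul_mul_assoc, mul_smul_comm, one_mul, mul_one, map_smul,
      siteState_single, siteState_one, smul_eq_mul]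
    ring
  · subst hij
    simp [-Matrix.smul_single, hkl, siteState_single]
  · subst hkl
    simp [-Matrix.smul_single, hij, siteState_single]
  · simp [hij, hkl]

theorem modelSum_apply_mem (n : ℕ) (a b : Fin d) : modelSum w n a b ∈ localAlg d (Set.Iio n) := by
  rw [modelSum, Matrix.sum_apply]
  refine sum_mem fun s hs => ?_
  have : flipMat d s - weightMat w ∈ (localAlg d (Set.Iio n)).matrix :=
    sub_mem (flipMat_mem (by simpa using hs)) (weightMat_mem w _)
  exact this a b

theorem word_mem_localAlg {S : Set ℕ} {α : Type*} {y : α → TensorAlg d}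
    (hy : ∀ x, y x ∈ localAlg d S) (l : List α) : (l.map y).prod ∈ localAlg d S := by
  refine list_prod_mem fun a ha => ?_
  obtain ⟨x, _, rfl⟩ := List.mem_map.mp ha
  exact hy x

/-- Evaluation at `s` is an algebra homomorphism under which the product state becomes the state of
one site; hence all sites have the same joint moments. -/
theorem tensorState_eq_siteState {s : ℕ} {x : TensorAlg d} (hx : x ∈ localAlg d {s}) :
    tensorState w x = siteState w (MonoidAlgebra.lift ℂ _ _ (Pi.evalMonoidHom _ s) x) := by
  refine localAlg_induction (p := fun x => tensorState w x = siteState w _) hx ?_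
    (by simp) (fun x z h h' => by rw [map_add, map_add, map_add, h, h'])
    (fun c x h => by rw [map_smul, map_smul, map_smul, h])
  intro y hy
  have : y = Pi.mulSingle s (y s) := by
    ext1 t
    by_cases h : t = s
    · subst h
      rw [Pi.mulSingle_eq_same]
    · rw [Pi.mulSingle_eq_of_ne h]
      exact eq_one_of_mem_localTensors hy h
  have h2 : MonoidAlgebra.lift ℂ _ _
      (Pi.evalMonoidHom (fun _ : ℕ => Matrix (Fin d) (Fin d) ℂ) s) (pureTensor y) = y s := by
    rw [pureTensor, MonoidAlgebra.lift_of]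
    rfl
  rw [h2]
  conv_lhs => rw [this]
  rw [tensorState_mulSingle]

theorem ofWord_site (s : ℕ) :
    ofWord (tensorState w) (fun p => (flipMat d s - weightMat w) p.1 p.2) = siteFun w := by
  ext l
  have hmem : ∀ p : Fin d × Fin d, (flipMat d s - weightMat w) p.1 p.2 ∈ localAlg d {s} := by
    intro p
    have : flipMat d s - weightMat w ∈ (localAlg d {s}).matrix :=
      sub_mem (flipMat_mem (Set.mem_singleton s)) (weightMat_mem w _)
    exact this p.1 p.2
  change tensorState w (l.map _).prod = siteState w (l.map _).prod
  rw [tensorState_eq_siteState (word_mem_localAlg hmem l), map_list_prod, List.map_map]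
  congr 3
  ext1 p
  rw [Function.comp_apply, Matrix.sub_apply, map_sub, siteMat, weightMat, Matrix.diagonal_apply,
    flipMat, Matrix.of_apply, pureTensor, MonoidAlgebra.lift_of]
  congr 1
  · exact Pi.mulSingle_eq_same s _
  · rw [apply_ite (MonoidAlgebra.lift ℂ _ _ _), map_zero, AlgHom.commutes,
      Algebra.algebraMap_eq_smul_one]

/-- The sites commute, are independent and have the same law, so each new one contributes a shuffle
factor `siteFun w`. -/
theorem ofWord_modelSum (n : ℕ) :
    ofWord (tensorState w) (fun p => modelSum w n p.1 p.2) = siteFun w ^ n := by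
  induction n with
  | zero =>
    ext l
    rcases l with _ | ⟨x, l⟩
    · change tensorState w 1 = 1
      rw [← pureTensor_one, tensorState_pureTensor]
      simp only [Pi.one_apply, siteState_one, finprod_one]
    · have : (1 : WordFun (Fin d × Fin d)) (x :: l) = 0 := rfl
      simp [ofWord, modelSum, this]
  | succ n ih =>
    have hsplit : (fun p : Fin d × Fin d => modelSum w (n + 1) p.1 p.2) =
        (fun p => modelSum w n p.1 p.2) + fun p => (flipMat d n - weightMat w) p.1 p.2 := by
      ext1 p
      rw [modelSum, Finset.sum_range_succ]
      rfl
    have hmem : ∀ p : Fin d × Fin d, (flipMat d n - weightMat w) p.1 p.2 ∈ localAlg d {n} := by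
      intro p
      have : flipMat d n - weightMat w ∈ (localAlg d {n}).matrix :=
        sub_mem (flipMat_mem (Set.mem_singleton n)) (weightMat_mem w _)
      exact this p.1 p.2
    have hdis : Disjoint (Set.Iio n) {n} := by simp
    rw [hsplit, ofWord_add, ih, ofWord_site, pow_succ]
    · exact fun a b => commute_of_disjoint hdis (modelSum_apply_mem n _ _) (hmem b)
    · exact fun l l' => tensorState_mul_of_disjoint w hdis
        (word_mem_localAlg (fun p => modelSum_apply_mem n _ _) l) (word_mem_localAlg hmem l')

theorem vectorState_rescaledSum_pow {A₀ : GNS w →L[ℂ] GNS w} (h : IsAverageLimit w A₀) (n k : ℕ) :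
    vectorState w (rescaledSum w A₀ n ^ k) = ∑ i, (w.wt i : ℂ) *
      walkSum k (scale ((1 / √n : ℝ) : ℂ) (siteFun w) ^ n) i i := by
  rw [rescaledSum, smul_pow, map_smul, vectorState_sum_pow h, weightedTrace_apply,
    smul_eq_mul, Finset.mul_sum]
  refine Finset.sum_congr rfl fun i _ => ?_
  rw [walkSum_ofWord, ofWord_modelSum, ← scale_pow, walkSum_scale]
  ring

/-- The moments of the limit law, in terms of the Wick functional `W`. -/
noncomputable def limitMoment (w : Weights d) (W : WordFun (Fin d × Fin d)) (k : ℕ) : ℂ :=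
  ∑ i, (w.wt i : ℂ) * walkSum k W i i

theorem tendsto_vectorState_rescaledSum_pow {A₀ : GNS w →L[ℂ] GNS w} (h : IsAverageLimit w A₀)
    {W : WordFun (Fin d × Fin d)} (hW : IsWick (gueCov w) W) (k : ℕ) :
    Tendsto (fun n => vectorState w (rescaledSum w A₀ n ^ k)) atTop (𝓝 (limitMoment w W k)) := by
  simp only [vectorState_rescaledSum_pow h]
  refine tendsto_finsetSum _ fun i _ => Tendsto.const_mul _ (tendsto_walkSum (fun l => ?_) k i i)
  refine tendsto_scale_pow hW (siteFun_nil w) (siteFun_singleton w) (siteFun_pair w)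
    (N := fun n => n) ?_ ?_ l
  · rw [← Complex.ofReal_zero]
    refine (Complex.continuous_ofReal.tendsto 0).comp ?_
    simp only [one_div]
    exact tendsto_inv_atTop_zero.comp
      (Real.tendsto_sqrt_atTop.comp tendsto_natCast_atTop_atTop)
  · refine tendsto_const_nhds.congr' ?_
    filter_upwards [eventually_gt_atTop 0] with n hn
    have hn' : (0 : ℝ) < n := by exact_mod_cast hn
    have : (n : ℝ) * (1 / √n) ^ 2 = 1 := by
      rw [div_pow, Real.sq_sqrt hn'.le, one_pow, mul_one_div_cancel hn'.ne']
    exact_mod_cast this.symm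

theorem weightedTrace_pow_of_isTracelessCCRGUE {A : Type*} [Ring A] [StarRing A] [Algebra ℂ A]
    [StarModule ℂ A] {φ : A →ₗ[ℂ] ℂ} (h1 : φ 1 = 1)
    {M : Matrix (Fin d) (Fin d) A} (hM : IsTracelessCCRGUE w φ M)
    {W : WordFun (Fin d × Fin d)} (hW : IsWick (gueCov w) W) (k : ℕ) :
    weightedTrace w φ (M ^ k) = limitMoment w W k := by
  rw [weightedTrace_apply, limitMoment]
  refine Finset.sum_congr rfl fun i _ => ?_
  rw [walkSum_ofWord, (isWick_ofWord_of_isTracelessCCRGUE h1 hM).unique hW]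

theorem Weights.wt_le_one (w : Weights d) (i : Fin d) : w.wt i ≤ 1 := by
  rw [← w.sum_eq_one]
  exact Finset.single_le_sum (fun j _ => (w.pos j).le) (Finset.mem_univ i)

theorem norm_gueCov_le (w : Weights d) (x y : Fin d × Fin d) : ‖gueCov w x y‖ ≤ 1 := by
  obtain ⟨i, j⟩ := x
  obtain ⟨k, l⟩ := y
  have hi := w.pos i
  have hj := w.pos j
  have hk := w.pos k
  have hi1 := w.wt_le_one i
  have hj1 := w.wt_le_one j
  have hk1 := w.wt_le_one k
  have : gueCov w (i, j) (k, l) = (((if i = l ∧ j = k then w.wt j else 0) -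
      (if i = j ∧ k = l then w.wt i * w.wt k else 0) : ℝ) : ℂ) := by
    simp only [gueCov]
    split_ifs <;> simp
  rw [this, Complex.norm_real, Real.norm_eq_abs, abs_le]
  have hik : w.wt i * w.wt k ≤ 1 := mul_le_one₀ hi1 hk.le hk1
  have hik' : 0 < w.wt i * w.wt k := mul_pos hi hk
  split_ifs <;> constructor <;> linarith

open scoped Nat in
theorem norm_limitMoment_le {W : WordFun (Fin d × Fin d)} (hW : IsWick (gueCov w) W) (k : ℕ) :
    ‖limitMoment w W k‖ ≤ d ^ k * ((k - 1)‼ : ℕ) := by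
  have hb : ∀ i, ‖(w.wt i : ℂ) * walkSum k W i i‖ ≤ w.wt i * (d ^ k * ((k - 1)‼ : ℕ)) := by
    intro i
    rw [norm_mul, Complex.norm_real, Real.norm_of_nonneg (w.pos i).le]
    refine mul_le_mul_of_nonneg_left ?_ (w.pos i).le
    have := norm_walkSum_le (f := W) (k := k) (b := ((k - 1)‼ : ℕ)) (by positivity)
      (fun l hl => by simpa [hl] using hW.norm_le (norm_gueCov_le w) l) i i
    simpa using this
  refine (norm_sum_le_of_le _ fun i _ => hb i).trans ?_
  rw [← Finset.sum_mul, w.sum_eq_one, one_mul]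

end JointMoments

/-! ### Moments and weak convergence -/

section Moments

open Filter Topology MeasureTheory
open scoped Nat

theorem hasDerivAt_expRemainder (K : ℕ) (x : ℝ) :
    HasDerivAt (fun x : ℝ => Complex.exp (x * Complex.I) -
      ∑ k ∈ Finset.range (K + 1), (x * Complex.I) ^ k / (k ! : ℂ))
      (Complex.I * (Complex.exp (x * Complex.I) -
        ∑ k ∈ Finset.range K, (x * Complex.I) ^ k / (k ! : ℂ))) x := by
  have h0 : HasDerivAt (fun x : ℝ => (x : ℂ) * Complex.I) Complex.I x := by
    simpa using (Complex.ofRealCLM.hasDerivAt (x := x)).mul_const Complex.I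
  have h1 : HasDerivAt (fun x : ℝ => ∑ k ∈ Finset.range K,
      ((x : ℂ) * Complex.I) ^ (k + 1) / ((k + 1)! : ℂ))
      (∑ k ∈ Finset.range K, Complex.I * ((x * Complex.I) ^ k / (k ! : ℂ))) x := by
    refine HasDerivAt.fun_sum fun k _ => ?_
    refine ((h0.pow (k + 1)).div_const ((k + 1)! : ℂ)).congr_deriv ?_
    have hk : (k ! : ℂ) ≠ 0 := by exact_mod_cast Nat.factorial_ne_zero k
    have hk' : (k : ℂ) + 1 ≠ 0 := by exact_mod_cast Nat.succ_ne_zero k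
    rw [Nat.factorial_succ, Nat.add_sub_cancel]
    push_cast
    field_simp
  have h2 := h0.cexp.sub (h1.add_const (1 : ℂ))
  have heq : (fun x : ℝ => Complex.exp (x * Complex.I) -
      ∑ k ∈ Finset.range (K + 1), (x * Complex.I) ^ k / (k ! : ℂ)) =
      fun x : ℝ => Complex.exp (x * Complex.I) - ((∑ k ∈ Finset.range K,
        ((x : ℂ) * Complex.I) ^ (k + 1) / ((k + 1)! : ℂ)) + 1) := by
    ext y
    rw [Finset.sum_range_succ']
    simp
  rw [heq]
  refine HasDerivAt.congr_deriv h2 ?_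
  rw [← Finset.mul_sum]
  ring

/-- Each Taylor remainder has derivative `I` times the previous one, so the bound integrates up from
the trivial case `K = 0`. -/
theorem norm_expRemainder_le (K : ℕ) (x : ℝ) :
    ‖Complex.exp (x * Complex.I) - ∑ k ∈ Finset.range K, (x * Complex.I) ^ k / (k ! : ℂ)‖ ≤
      |x| ^ K / K ! := by
  have hpos : ∀ x : ℝ, 0 ≤ x →
      ‖Complex.exp (x * Complex.I) - ∑ k ∈ Finset.range K, (x * Complex.I) ^ k / (k ! : ℂ)‖ ≤
        x ^ K / K ! := by
    induction K with
    | zero =>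
      intro x _
      simp [Complex.norm_exp_ofReal_mul_I]
    | succ K ih =>
      intro x hx
      have hB : ∀ y : ℝ, HasDerivAt (fun y : ℝ => y ^ (K + 1) / ((K + 1)! : ℝ)) (y ^ K / K !) y := by
        intro y
        refine ((hasDerivAt_pow (K + 1) y).div_const ((K + 1)! : ℝ)).congr_deriv ?_
        have hk : (K ! : ℝ) ≠ 0 := by exact_mod_cast Nat.factorial_ne_zero K
        have hk' : (K : ℝ) + 1 ≠ 0 := by exact_mod_cast Nat.succ_ne_zero K
        rw [Nat.factorial_succ, Nat.add_sub_cancel]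
        push_cast
        field_simp
      refine image_norm_le_of_norm_deriv_right_le_deriv_boundary (a := 0) (b := x)
        (fun y _ => (hasDerivAt_expRemainder K y).continuousAt.continuousWithinAt)
        (fun y _ => (hasDerivAt_expRemainder K y).hasDerivWithinAt) ?_ hB ?_
        (Set.right_mem_Icc.mpr hx)
      · rw [Finset.sum_range_succ']
        simp
      · intro y hy
        rw [norm_mul, Complex.norm_I, one_mul]
        exact ih y hy.1
  rcases le_total 0 x with hx | hx
  · rw [abs_of_nonneg hx]
    exact hpos x hx
  · have h := hpos (-x) (by linarith)
    rw [abs_of_nonpos hx]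
    refine le_of_eq_of_le ?_ h
    -- Complex conjugation exchanges `x` and `-x`.
    rw [← RCLike.norm_conj]
    congr 1
    simp only [map_sub, map_sum, map_div₀, map_pow, map_mul, Complex.conj_ofReal, Complex.conj_I,
      map_natCast, ← Complex.exp_conj]
    push_cast
    simp only [mul_neg, neg_mul]

/-- All the moments of `μ` exist and `m` is the sequence of the moments. -/
structure HasMoments (μ : ProbabilityMeasure ℝ) (m : ℕ → ℝ) : Prop where
  integrable : ∀ k : ℕ, Integrable (fun t : ℝ => t ^ k) (μ : Measure ℝ)
  moment : ∀ k : ℕ, ∫ t : ℝ, t ^ k ∂(μ : Measure ℝ) = m k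

/-- A growth condition on the moments, under which they determine the measure. -/
def SlowGrowth (m : ℕ → ℝ) : Prop :=
  ∀ t : ℝ, Tendsto (fun K : ℕ => t ^ (2 * K) * m (2 * K) / ((2 * K)! : ℝ)) atTop (𝓝 0)

/-- The Taylor bound is integrated against `μ`. The order `2 * K` is even, so the bound involves a
moment and not an absolute moment. -/
theorem HasMoments.norm_charFun_sub_le {μ : ProbabilityMeasure ℝ} {m : ℕ → ℝ} (h : HasMoments μ m)
    (t : ℝ) (K : ℕ) : ‖charFun (μ : Measure ℝ) t -
      ∑ k ∈ Finset.range (2 * K), (t * Complex.I) ^ k / (k ! : ℂ) * (m k : ℂ)‖ ≤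
        t ^ (2 * K) * m (2 * K) / ((2 * K)! : ℝ) := by
  have hint : ∀ k : ℕ, Integrable (fun x : ℝ => ((t * x : ℝ) * Complex.I) ^ k / (k ! : ℂ))
      (μ : Measure ℝ) := by
    intro k
    have := ((h.integrable k).ofReal (𝕜 := ℂ)).const_mul ((t * Complex.I) ^ k / (k ! : ℂ))
    refine this.congr (Eventually.of_forall fun x => ?_)
    simp only [mul_pow, Complex.coe_algebraMap]
    push_cast
    ring
  have hval : ∀ k : ℕ, ∫ x : ℝ, ((t * x : ℝ) * Complex.I) ^ k / (k ! : ℂ) ∂(μ : Measure ℝ) =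
      (t * Complex.I) ^ k / (k ! : ℂ) * (m k : ℂ) := by
    intro k
    rw [← h.moment k, ← integral_complex_ofReal, ← integral_const_mul]
    congr 1
    ext x
    push_cast
    ring
  have hexp : Integrable (fun x : ℝ => Complex.exp ((t * x : ℝ) * Complex.I)) (μ : Measure ℝ) := by
    refine (integrable_const (1 : ℝ)).mono' (by fun_prop) (Eventually.of_forall fun x => ?_)
    rw [Complex.norm_exp_ofReal_mul_I]
  have hchar : charFun (μ : Measure ℝ) t =
      ∫ x : ℝ, Complex.exp ((t * x : ℝ) * Complex.I) ∂(μ : Measure ℝ) := by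
    rw [charFun_apply_real]
    push_cast
    rfl
  simp only [← hval]
  rw [hchar, ← integral_finsetSum _ fun k _ => hint k, ← integral_sub hexp
    (integrable_finsetSum _ fun k _ => hint k)]
  have hb := (h.integrable (2 * K)).const_mul (t ^ (2 * K) / ((2 * K)! : ℝ))
  refine (norm_integral_le_of_norm_le hb (Eventually.of_forall fun x => ?_)).trans ?_
  · refine (norm_expRemainder_le (2 * K) (t * x)).trans (le_of_eq ?_)
    rw [Even.pow_abs (even_two_mul K), mul_pow]
    ring
  · rw [integral_const_mul, h.moment]
    exact le_of_eq (by ring)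

/-- The Taylor sums depend only on `m` and converge to the characteristic function of any measure
with these moments. -/
theorem HasMoments.unique {μ ν : ProbabilityMeasure ℝ} {m : ℕ → ℝ} (hm : SlowGrowth m)
    (hμ : HasMoments μ m) (hν : HasMoments ν m) : μ = ν := by
  have key : ∀ (ρ : ProbabilityMeasure ℝ), HasMoments ρ m → ∀ t : ℝ,
      Tendsto (fun K : ℕ => ∑ k ∈ Finset.range (2 * K),
        (t * Complex.I) ^ k / (k ! : ℂ) * (m k : ℂ)) atTop (𝓝 (charFun (ρ : Measure ℝ) t)) := by
    intro ρ hρ t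
    rw [tendsto_iff_norm_sub_tendsto_zero]
    refine squeeze_zero (fun _ => norm_nonneg _) (fun K => ?_) (hm t)
    rw [norm_sub_rev]
    exact hρ.norm_charFun_sub_le t K
  have heq : (μ : Measure ℝ) = (ν : Measure ℝ) := Measure.ext_of_charFun (funext fun t =>
    tendsto_nhds_unique (key μ hμ t) (key ν hν t))
  exact Subtype.ext heq

theorem abs_sub_clamp_le (s : ℝ) {R : ℝ} (hR : 0 < R) : |s - max (-R) (min s R)| ≤ s ^ 2 / R := by
  have hs : 0 ≤ s ^ 2 / R := by positivity
  rw [le_div_iff₀ hR]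
  rcases le_total s R with h | h
  · rw [min_eq_left h]
    rcases le_total (-R) s with h' | h'
    · rw [max_eq_right h', sub_self, abs_zero, zero_mul]
      positivity
    · rw [max_eq_left h', abs_of_nonpos (by linarith)]
      nlinarith
  · rw [min_eq_right h, max_eq_right (by linarith), abs_of_nonneg (by linarith)]
    nlinarith

/-- The truncation of `t ^ k` to the interval `[-R, R]`. -/
noncomputable def truncPow (k : ℕ) (R : ℝ) (hR : 0 ≤ R) : BoundedContinuousFunction ℝ ℝ :=
  BoundedContinuousFunction.ofNormedAddCommGroup (fun t => max (-R) (min (t ^ k) R))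
    (by fun_prop) R fun t => by
      rw [Real.norm_eq_abs, abs_le]
      exact ⟨le_max_left _ _, max_le (by linarith) (min_le_right _ _)⟩

theorem truncPow_apply (k : ℕ) (R : ℝ) (hR : 0 ≤ R) (t : ℝ) :
    truncPow k R hR t = max (-R) (min (t ^ k) R) := rfl

/-- Fatou's inequality for weak convergence: truncations of `t ^ k` are bounded and continuous, and
monotone convergence removes the truncation. -/
theorem lintegral_pow_le {ι : Type*} {l : Filter ι} [l.NeBot] {μs : ι → ProbabilityMeasure ℝ}
    {μ : ProbabilityMeasure ℝ} (hμ : Tendsto μs l (𝓝 μ)) {k : ℕ} (hk : Even k) {c : ℝ}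
    (hint : ∀ n, Integrable (fun t : ℝ => t ^ k) (μs n : Measure ℝ))
    (hc : Tendsto (fun n => ∫ t : ℝ, t ^ k ∂(μs n : Measure ℝ)) l (𝓝 c)) :
    ∫⁻ t : ℝ, ENNReal.ofReal (t ^ k) ∂(μ : Measure ℝ) ≤ ENNReal.ofReal c := by
  have htrunc : ∀ R : ℕ, ∫⁻ t : ℝ, ENNReal.ofReal (min (t ^ k) R) ∂(μ : Measure ℝ) ≤
      ENNReal.ofReal c := by
    intro R
    have hR : (0 : ℝ) ≤ R := Nat.cast_nonneg R
    have heq : ∀ t : ℝ, truncPow k R hR t = min (t ^ k) R := by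
      intro t
      rw [truncPow_apply, max_eq_right]
      have : 0 ≤ t ^ k := hk.pow_nonneg t
      exact (neg_nonpos.mpr hR).trans (le_min this hR)
    have h1 := (ProbabilityMeasure.tendsto_iff_forall_integral_tendsto.mp hμ) (truncPow k R hR)
    have h2 : ∫ t, truncPow k R hR t ∂(μ : Measure ℝ) ≤ c := by
      refine le_of_tendsto_of_tendsto' h1 hc fun n => ?_
      refine integral_mono ((truncPow k R hR).integrable _) (hint n) fun t => ?_
      simp only [heq]
      exact min_le_left _ _
    rw [← ofReal_integral_eq_lintegral_ofReal]
    · refine ENNReal.ofReal_le_ofReal ?_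
      simpa only [heq] using h2
    · exact ((truncPow k R hR).integrable (μ : Measure ℝ)).congr (Eventually.of_forall heq)
    · exact Eventually.of_forall fun t => le_min (hk.pow_nonneg t) hR
  have hsup : ∀ t : ℝ, ENNReal.ofReal (t ^ k) = ⨆ R : ℕ, ENNReal.ofReal (min (t ^ k) R) := by
    intro t
    refine le_antisymm ?_ (iSup_le fun R => ENNReal.ofReal_le_ofReal (min_le_left _ _))
    obtain ⟨R, hR⟩ := exists_nat_ge (t ^ k)
    refine le_iSup_of_le R ?_
    rw [min_eq_left hR]
  simp only [hsup]
  rw [lintegral_iSup]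
  · exact iSup_le htrunc
  · intro R
    fun_prop
  · intro R R' hRR' t
    exact ENNReal.ofReal_le_ofReal (min_le_min_left _ (by exact_mod_cast hRR'))

/-- Truncating `t ^ k` at height `R` costs at most the `2k`-th moment divided by `R`, uniformly
along the filter; hence the moments pass to the limit. General filters are allowed so that
ultrafilters can be used below. -/
theorem hasMoments_of_tendsto {ι : Type*} {l : Filter ι} [l.NeBot]
    {μs : ι → ProbabilityMeasure ℝ} {μ : ProbabilityMeasure ℝ} (hμ : Tendsto μs l (𝓝 μ))
    {ms : ι → ℕ → ℝ} {m : ℕ → ℝ} (hms : ∀ n, HasMoments (μs n) (ms n))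
    (hm : ∀ k, Tendsto (fun n => ms n k) l (𝓝 (m k))) : HasMoments μ m := by
  have heven : ∀ k, Even k → Integrable (fun t : ℝ => t ^ k) (μ : Measure ℝ) ∧
      ∫ t : ℝ, t ^ k ∂(μ : Measure ℝ) ≤ m k := by
    intro k hk
    have hnn : 0 ≤ᵐ[(μ : Measure ℝ)] fun t : ℝ => t ^ k :=
      Eventually.of_forall fun t => hk.pow_nonneg t
    have hle := lintegral_pow_le hμ hk (fun n => (hms n).integrable k)
      ((hm k).congr fun n => ((hms n).moment k).symm)
    have hm0 : 0 ≤ m k := ge_of_tendsto' (hm k) fun n => by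
      rw [← (hms n).moment k]
      exact integral_nonneg fun t => hk.pow_nonneg t
    constructor
    · refine ⟨by fun_prop, ?_⟩
      rw [hasFiniteIntegral_iff_ofReal hnn]
      exact hle.trans_lt ENNReal.ofReal_lt_top
    · rw [integral_eq_lintegral_of_nonneg_ae hnn (by fun_prop)]
      exact ENNReal.toReal_le_of_le_ofReal hm0 hle
  have hint : ∀ k : ℕ, Integrable (fun t : ℝ => t ^ k) (μ : Measure ℝ) := by
    intro k
    refine ((heven (2 * k) (even_two_mul k)).1.add (integrable_const (1 : ℝ))).mono'
      (by fun_prop) (Eventually.of_forall fun t => ?_)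
    simp only [Pi.add_apply]
    rw [Real.norm_eq_abs, abs_le, mul_comm 2 k, pow_mul]
    -- This is `|t ^ k| ≤ t ^ (2 * k) + 1`.
    constructor <;> nlinarith [sq_nonneg (t ^ k - 1), sq_nonneg (t ^ k + 1)]
  refine ⟨hint, fun k => ?_⟩
  have hclamp : ∀ (ρ : ProbabilityMeasure ℝ), (∀ j : ℕ, Integrable (fun t : ℝ => t ^ j)
      (ρ : Measure ℝ)) → ∀ (R : ℝ) (hR : 0 < R), |∫ t : ℝ, t ^ k ∂(ρ : Measure ℝ) -
        ∫ t, truncPow k R hR.le t ∂(ρ : Measure ℝ)| ≤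
          (∫ t : ℝ, t ^ (2 * k) ∂(ρ : Measure ℝ)) / R := by
    intro ρ hρ R hR
    rw [← integral_sub (hρ k) ((truncPow k R hR.le).integrable _), ← integral_div,
      ← Real.norm_eq_abs]
    refine norm_integral_le_of_norm_le ((hρ (2 * k)).div_const R)
      (Eventually.of_forall fun t => ?_)
    rw [Real.norm_eq_abs, truncPow_apply, mul_comm 2 k, pow_mul]
    exact abs_sub_clamp_le _ hR
  have hR : ∀ R : ℝ, 0 < R → |∫ t : ℝ, t ^ k ∂(μ : Measure ℝ) - m k| ≤ 2 * m (2 * k) / R := by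
    intro R hR
    have h1 : |∫ t : ℝ, t ^ k ∂(μ : Measure ℝ) - ∫ t, truncPow k R hR.le t ∂(μ : Measure ℝ)| ≤
        m (2 * k) / R :=
      (hclamp μ hint R hR).trans (by gcongr; exact (heven _ (even_two_mul k)).2)
    have h2 : |m k - ∫ t, truncPow k R hR.le t ∂(μ : Measure ℝ)| ≤ m (2 * k) / R := by
      have ha := ((hm k).sub ((ProbabilityMeasure.tendsto_iff_forall_integral_tendsto.mp hμ)
        (truncPow k R hR.le))).abs
      refine le_of_tendsto_of_tendsto' ha ((hm (2 * k)).div_const R) fun n => ?_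
      rw [← (hms n).moment, ← (hms n).moment]
      exact hclamp (μs n) (hms n).integrable R hR
    have h3 := abs_sub_le (∫ t : ℝ, t ^ k ∂(μ : Measure ℝ))
      (∫ t, truncPow k R hR.le t ∂(μ : Measure ℝ)) (m k)
    rw [abs_sub_comm (∫ t, truncPow k R hR.le t ∂(μ : Measure ℝ)) (m k)] at h3
    have h4 : 2 * m (2 * k) / R = m (2 * k) / R + m (2 * k) / R := by ring
    linarith
  have hlim : Tendsto (fun R : ℝ => 2 * m (2 * k) / R) atTop (𝓝 0) :=
    tendsto_const_nhds.div_atTop tendsto_id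
  have : |∫ t : ℝ, t ^ k ∂(μ : Measure ℝ) - m k| ≤ 0 :=
    ge_of_tendsto hlim ((eventually_gt_atTop 0).mono hR)
  exact sub_eq_zero.mp (abs_nonpos_iff.mp this)

theorem isTight_of_hasMoments {μs : ℕ → ProbabilityMeasure ℝ} {ms : ℕ → ℕ → ℝ} {c : ℝ}
    (hms : ∀ n, HasMoments (μs n) (ms n)) (hm : Tendsto (fun n => ms n 2) atTop (𝓝 c)) :
    IsTightMeasureSet {((μ : ProbabilityMeasure ℝ) : Measure ℝ) | μ ∈ Set.range μs} := by
  obtain ⟨C, hC⟩ := hm.bddAbove_range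
  refine isTightMeasureSet_of_tendsto_measure_norm_gt ?_
  have hlim : Tendsto (fun r : ℝ => ENNReal.ofReal (C / r ^ 2)) atTop (𝓝 0) := by
    rw [← ENNReal.ofReal_zero]
    refine (ENNReal.continuous_ofReal.tendsto 0).comp ?_
    exact tendsto_const_nhds.div_atTop (tendsto_pow_atTop two_ne_zero)
  refine tendsto_of_tendsto_of_tendsto_of_le_of_le' tendsto_const_nhds hlim
    (Eventually.of_forall fun _ => zero_le) ?_
  filter_upwards [eventually_gt_atTop 0] with r hr
  refine iSup₂_le ?_
  rintro _ ⟨_, ⟨n, rfl⟩, rfl⟩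
  have h1 := mul_meas_ge_le_integral_of_nonneg (μ := (μs n : Measure ℝ)) (f := fun t : ℝ => t ^ 2)
    (Eventually.of_forall fun t => sq_nonneg t) ((hms n).integrable 2) (r ^ 2)
  rw [(hms n).moment] at h1
  have h2 : (μs n : Measure ℝ).real {x | r ^ 2 ≤ x ^ 2} ≤ C / r ^ 2 := by
    rw [le_div_iff₀ (by positivity), mul_comm]
    exact h1.trans (hC ⟨n, rfl⟩)
  calc (μs n : Measure ℝ) {x | r < ‖x‖} ≤ (μs n : Measure ℝ) {x | r ^ 2 ≤ x ^ 2} := by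
        refine measure_mono fun x hx => ?_
        have hx' : r < |x| := hx
        have := pow_le_pow_left₀ hr.le hx'.le 2
        rwa [sq_abs] at this
    _ = ENNReal.ofReal ((μs n : Measure ℝ).real {x | r ^ 2 ≤ x ^ 2}) :=
        (ENNReal.ofReal_toReal (measure_ne_top _ _)).symm
    _ ≤ ENNReal.ofReal (C / r ^ 2) := ENNReal.ofReal_le_ofReal h2

/-- Chebyshev's inequality gives tightness, so the closure of the sequence is compact by Prokhorov's
theorem. Every cluster point has the moments `m`, hence there is only one, and the sequence
converges to it. -/
theorem exists_tendsto_of_tendsto_moments {μs : ℕ → ProbabilityMeasure ℝ} {ms : ℕ → ℕ → ℝ}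
    {m : ℕ → ℝ} (hm : SlowGrowth m) (hms : ∀ n, HasMoments (μs n) (ms n))
    (hlim : ∀ k, Tendsto (fun n => ms n k) atTop (𝓝 (m k))) :
    ∃ μ, Tendsto μs atTop (𝓝 μ) ∧ HasMoments μ m := by
  have hcomp := isCompact_closure_of_isTightMeasureSet (isTight_of_hasMoments hms (hlim 2))
  have hmem : ∀ n, μs n ∈ closure (Set.range μs) := fun n => subset_closure ⟨n, rfl⟩
  have hcluster : ∀ ν, MapClusterPt ν atTop μs → HasMoments ν m := by
    intro ν hν
    obtain ⟨𝓤, h𝓤, hν'⟩ := mapClusterPt_iff_ultrafilter.mp hν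
    exact hasMoments_of_tendsto hν' hms fun k => (hlim k).mono_left h𝓤
  obtain ⟨μ, -, hμ⟩ := hcomp.exists_mapClusterPt (f := atTop) (u := μs)
    (tendsto_principal.mpr (Eventually.of_forall hmem))
  refine ⟨μ, hcomp.tendsto_nhds_of_unique_mapClusterPt (Eventually.of_forall hmem)
    fun ν _ hν => (hcluster ν hν).unique hm (hcluster μ hμ), hcluster μ hμ⟩

/-! ### The law of a bounded selfadjoint operator -/

/-- The measure is the spectral measure of `T` at `v`, obtained by Riesz–Markov from `f ↦ ⟨v, f(T)
v⟩` on the compact spectrum. Its moments are bounded by `‖T‖ ^ k`, so they grow slowly. -/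
theorem exists_hasMoments_of_isSelfAdjoint {H : Type*} [NormedAddCommGroup H]
    [InnerProductSpace ℂ H] [CompleteSpace H] {T : H →L[ℂ] H} (hT : IsSelfAdjoint T) {v : H}
    (hv : ‖v‖ = 1) : ∃ (μ : ProbabilityMeasure ℝ) (m : ℕ → ℝ), HasMoments μ m ∧ SlowGrowth m ∧
      ∀ k : ℕ, inner ℂ v ((T ^ k) v) = (m k : ℂ) := by
  have : CompactSpace (spectrum ℝ T) := isCompact_iff_compactSpace.mp (spectrum.isCompact T)
  let Φ : C(spectrum ℝ T, ℝ) →⋆ₐ[ℝ] (H →L[ℂ] H) := cfcHom hT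
  have hsym : ∀ (f : C(spectrum ℝ T, ℝ)) (x y : H), inner ℂ (Φ f x) y = inner ℂ x (Φ f y) := by
    intro f
    have : IsSelfAdjoint (Φ f) := cfcHom_predicate hT f
    rw [ContinuousLinearMap.isSelfAdjoint_iff_isSymmetric] at this
    exact this
  let Λ₀ : CompactlySupportedContinuousMap (spectrum ℝ T) ℝ →ₗ[ℝ] ℝ :=
    { toFun := fun f => (inner ℂ v (Φ (f : C(spectrum ℝ T, ℝ)) v)).re
      map_add' := fun f g => by
        have : ((f + g : CompactlySupportedContinuousMap (spectrum ℝ T) ℝ) :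
          C(spectrum ℝ T, ℝ)) = (f : C(spectrum ℝ T, ℝ)) + (g : C(spectrum ℝ T, ℝ)) := rfl
        rw [this, map_add, add_apply, inner_add_right, Complex.add_re]
      map_smul' := fun c f => by
        have : ((c • f : CompactlySupportedContinuousMap (spectrum ℝ T) ℝ) :
          C(spectrum ℝ T, ℝ)) = c • (f : C(spectrum ℝ T, ℝ)) := rfl
        rw [this, map_smul, smul_apply, inner_smul_right_eq_smul]
        simp }
  let Λ : CompactlySupportedContinuousMap (spectrum ℝ T) ℝ →ₚ[ℝ] ℝ :=
    PositiveLinearMap.mk₀ Λ₀ fun f hf => by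
      -- Positivity: for `f = g ^ 2` the functional is `‖g(T) v‖ ^ 2`.
      let g : C(spectrum ℝ T, ℝ) := ⟨fun x => √(f x), by fun_prop⟩
      have hg : (f : C(spectrum ℝ T, ℝ)) = g * g := by
        ext x
        exact (Real.mul_self_sqrt (hf x)).symm
      change 0 ≤ (inner ℂ v (Φ (f : C(spectrum ℝ T, ℝ)) v)).re
      rw [hg, map_mul, mul_apply_eq_comp, ← hsym]
      exact inner_self_nonneg (𝕜 := ℂ)
  have hint : ∀ f : C(spectrum ℝ T, ℝ), ∫ x, f x ∂(RealRMK.rieszMeasure Λ) =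
      (inner ℂ v (Φ f v)).re := by
    intro f
    exact RealRMK.integral_rieszMeasure Λ (CompactlySupportedContinuousMap.continuousMapEquiv f)
  set μ₀ := RealRMK.rieszMeasure Λ with hμ₀
  have hfin : IsFiniteMeasure μ₀ := ⟨isCompact_univ.measure_lt_top⟩
  have hprob : IsProbabilityMeasure μ₀ := by
    have h1 := hint 1
    rw [map_one] at h1
    simp only [ContinuousMap.one_apply, integral_const, smul_eq_mul, mul_one,
      one_apply_eq_self] at h1
    rw [inner_self_eq_norm_sq_to_K, hv] at h1
    refine ⟨?_⟩
    rw [← ENNReal.toReal_eq_one_iff]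
    simpa [Measure.real] using h1
  have hpow : ∀ k : ℕ, Φ (((ContinuousMap.id ℝ).restrict (spectrum ℝ T)) ^ k) = T ^ k := by
    intro k
    rw [map_pow]
    exact congrArg (· ^ k) (cfcHom_id hT)
  have hmap : ∀ k : ℕ, Integrable (fun t : ℝ => t ^ k) (μ₀.map Subtype.val) ∧
      ∫ t : ℝ, t ^ k ∂(μ₀.map Subtype.val) = (inner ℂ v ((T ^ k) v)).re := by
    intro k
    have hmeas : AEMeasurable (Subtype.val : spectrum ℝ T → ℝ) μ₀ := by fun_prop
    rw [integrable_map_measure (by fun_prop) hmeas, integral_map hmeas (by fun_prop), ← hpow k,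
      ← hint]
    refine ⟨?_, rfl⟩
    have hc : Continuous ((fun t : ℝ => t ^ k) ∘ (Subtype.val : spectrum ℝ T → ℝ)) := by fun_prop
    exact hc.integrable_of_hasCompactSupport (HasCompactSupport.of_compactSpace _)
  have hreal : ∀ k : ℕ, inner ℂ v ((T ^ k) v) = ((inner ℂ v ((T ^ k) v)).re : ℂ) := by
    intro k
    refine (Complex.conj_eq_iff_re.mp ?_).symm
    rw [inner_conj_symm, ← hpow k, hsym]
  refine ⟨⟨μ₀.map Subtype.val, Measure.isProbabilityMeasure_map (by fun_prop)⟩,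
    fun k => (inner ℂ v ((T ^ k) v)).re, ⟨fun k => (hmap k).1, fun k => (hmap k).2⟩, ?_, hreal⟩
  intro t
  have hb : ∀ k : ℕ, |(inner ℂ v ((T ^ k) v)).re| ≤ ‖T‖ ^ k := by
    intro k
    refine (Complex.abs_re_le_norm _).trans ((norm_inner_le_norm _ _).trans ?_)
    rw [hv, one_mul]
    refine ((T ^ k).le_opNorm v).trans ?_
    rw [hv, mul_one]
    rcases Nat.eq_zero_or_pos k with rfl | hk
    · rw [pow_zero, pow_zero]
      exact ContinuousLinearMap.norm_id_le
    · exact norm_pow_le' T hk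
  have hlim : Tendsto (fun K : ℕ => (|t| * ‖T‖) ^ (2 * K) / ((2 * K)! : ℝ)) atTop (𝓝 0) :=
    (FloorSemiring.tendsto_pow_div_factorial_atTop (|t| * ‖T‖)).comp
      (tendsto_id.const_mul_atTop' two_pos)
  refine squeeze_zero_norm (fun K => ?_) hlim
  rw [norm_div, norm_mul, Real.norm_eq_abs, Real.norm_eq_abs, Real.norm_natCast, abs_pow, mul_pow]
  gcongr
  exact hb _

end Moments

/-! ### Existence and uniqueness of the limit law -/

section Final

open Filter Topology MeasureTheory
open scoped Nat

theorem HasMoments.isLaw {A : Type*} [Ring A] [Algebra ℂ A] {ψ : A →ₗ[ℂ] ℂ} {a : A}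
    {μ : ProbabilityMeasure ℝ} {m : ℕ → ℝ} (h : HasMoments μ m) (hm : SlowGrowth m)
    (ha : ∀ k : ℕ, ψ (a ^ k) = (m k : ℂ)) : IsLaw ψ a μ where
  integrable := h.integrable
  moment k := by rw [ha, h.moment]
  unique ν hi hν := by
    refine HasMoments.unique hm ⟨hi, fun k => ?_⟩ h
    have := hν k
    rw [ha] at this
    exact (Complex.ofReal_injective this).symm

theorem IsLaw.eq {A : Type*} [Ring A] [Algebra ℂ A] {ψ : A →ₗ[ℂ] ℂ} {a : A}
    {μ ν : ProbabilityMeasure ℝ} (hμ : IsLaw ψ a μ) (hν : IsLaw ψ a ν) : μ = ν :=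
  hν.unique μ hμ.integrable hμ.moment

/-- Since `(2K)! = 2 ^ K * K! * (2K - 1)‼`, the double factorial cancels and the general term of an
exponential series remains. -/
theorem slowGrowth_of_le_doubleFactorial {m : ℕ → ℝ} {c : ℝ}
    (h : ∀ k, |m k| ≤ c ^ k * ((k - 1)‼ : ℕ)) : SlowGrowth m := by
  intro t
  have hlim := FloorSemiring.tendsto_pow_div_factorial_atTop ((|t| * c) ^ 2 / 2)
  refine squeeze_zero_norm (fun K => ?_) hlim
  rw [norm_div, norm_mul, Real.norm_eq_abs, Real.norm_eq_abs, Real.norm_natCast, abs_pow]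
  have hfac : ((2 * K)! : ℝ) = 2 ^ K * (K ! : ℝ) * ((2 * K - 1)‼ : ℕ) := by
    rcases Nat.eq_zero_or_pos K with rfl | hK
    · simp
    · have h1 := Nat.factorial_eq_mul_doubleFactorial (2 * K - 1)
      rw [Nat.sub_add_cancel (by omega), Nat.doubleFactorial_two_mul] at h1
      exact_mod_cast h1
  have hpos : (0 : ℝ) < ((2 * K - 1)‼ : ℕ) := by exact_mod_cast Nat.doubleFactorial_pos _
  have hK : (0 : ℝ) < (K ! : ℝ) := by exact_mod_cast Nat.factorial_pos K
  rw [hfac]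
  calc |t| ^ (2 * K) * |m (2 * K)| / (2 ^ K * (K ! : ℝ) * ((2 * K - 1)‼ : ℕ))
      ≤ |t| ^ (2 * K) * (c ^ (2 * K) * ((2 * K - 1)‼ : ℕ)) /
          (2 ^ K * (K ! : ℝ) * ((2 * K - 1)‼ : ℕ)) := by
        gcongr
        exact h _
    _ = ((|t| * c) ^ 2 / 2) ^ K / (K ! : ℝ) := by
        rw [div_pow, ← pow_mul, mul_pow]
        field_simp

variable {d : ℕ} (w : Weights d)

theorem exists_limitLaw {A₀ : GNS w →L[ℂ] GNS w} (hA₀ : IsAverageLimit w A₀)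
    {W : WordFun (Fin d × Fin d)} (hW : WordFun.IsWick (WordFun.gueCov w) W) :
    ∃ (μ : ProbabilityMeasure ℝ) (μs : ℕ → ProbabilityMeasure ℝ) (m : ℕ → ℝ),
      (∀ n, IsLaw (vectorState w) (rescaledSum w A₀ n) (μs n)) ∧ Tendsto μs atTop (𝓝 μ) ∧
        HasMoments μ m ∧ SlowGrowth m ∧ ∀ k, limitMoment w W k = (m k : ℂ) := by
  choose μs ms hms hslow hval using fun n =>
    exists_hasMoments_of_isSelfAdjoint (hA₀.isSelfAdjoint_rescaledSum n) norm_hat_one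
  have hlim : ∀ k, Tendsto (fun n => (ms n k : ℂ)) atTop (𝓝 (limitMoment w W k)) := fun k =>
    (tendsto_vectorState_rescaledSum_pow hA₀ hW k).congr fun n => hval n k
  have hre : ∀ k, Tendsto (fun n => ms n k) atTop (𝓝 (limitMoment w W k).re) := fun k =>
    (Complex.continuous_re.tendsto _).comp (hlim k)
  -- The limit moments are real because they are limits of real moments.
  have hreal : ∀ k, limitMoment w W k = ((limitMoment w W k).re : ℂ) := fun k =>
    tendsto_nhds_unique (hlim k) ((Complex.continuous_ofReal.tendsto _).comp (hre k))
  have hm : SlowGrowth fun k => (limitMoment w W k).re :=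
    slowGrowth_of_le_doubleFactorial (c := d) fun k =>
      (Complex.abs_re_le_norm _).trans (norm_limitMoment_le hW k)
  obtain ⟨μ, hμ, hμm⟩ := exists_tendsto_of_tendsto_moments hm hms hre
  exact ⟨μ, μs, _, fun n => (hms n).isLaw (hslow n) (hval n), hμ, hμm, hm, hreal⟩

variable {w}

theorem IsCLTLimitLaw.eq {μ ν : ProbabilityMeasure ℝ} (hμ : IsCLTLimitLaw w μ)
    (hν : IsCLTLimitLaw w ν) : μ = ν := by
  obtain ⟨A₀, hA₀, μs, hμs, hμ⟩ := hμ
  obtain ⟨B₀, hB₀, νs, hνs, hν⟩ := hν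
  obtain rfl := hA₀.unique hB₀
  refine tendsto_nhds_unique hμ (hν.congr' ?_)
  -- Only the laws with `n ≥ 1` are prescribed; the value at `n = 0` is arbitrary and does not
  -- affect the limit.
  filter_upwards [eventually_ge_atTop 1] with n hn
  exact (hνs n hn).eq (hμs n hn)

end Final

end StarCLT

theorem theorem2p9 {d : ℕ} (hd : 2 ≤ d) (w : StarCLT.Weights d) :
    ∃ μ : MeasureTheory.ProbabilityMeasure ℝ,
      StarCLT.IsCLTLimitLaw w μ ∧
      (∀ ν : MeasureTheory.ProbabilityMeasure ℝ, StarCLT.IsCLTLimitLaw w ν → ν = μ) ∧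
      ∀ (A : Type*) [Ring A] [StarRing A] [Algebra ℂ A] [StarModule ℂ A] (φ : A →ₗ[ℂ] ℂ),
        StarCLT.IsStarProbabilitySpace φ →
        ∀ M : Matrix (Fin d) (Fin d) A, StarCLT.IsTracelessCCRGUE w φ M →
          StarCLT.IsLaw (StarCLT.weightedTrace w φ) M μ := by
  obtain ⟨A₀, hA₀⟩ := StarCLT.exists_isAverageLimit w
  obtain ⟨W, hW⟩ := StarCLT.WordFun.exists_isWick (StarCLT.WordFun.gueCov w)
  obtain ⟨μ, μs, m, hμs, hμ, hm, hslow, hval⟩ := StarCLT.exists_limitLaw w hA₀ hW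
  have hlaw : StarCLT.IsCLTLimitLaw w μ := ⟨A₀, hA₀, μs, fun n _ => hμs n, hμ⟩
  refine ⟨μ, hlaw, fun ν hν => hν.eq hlaw, ?_⟩
  intro A _ _ _ _ φ hφ M hM
  refine hm.isLaw hslow fun k => ?_
  rw [StarCLT.weightedTrace_pow_of_isTracelessCCRGUE hφ.map_one hM hW, hval]
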